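/- Let $G$ be a finite group. For $g\in G$ and $H\le G$ write ${}^gH=gHg^{-1}$ and $H^g=g^{-1}Hg$. **Mackey modules.** A *Mackey functor* $M$ for $G$ consists of abelian groups $M[H]$ $(H\le G)$ and homomorphisms $\mathrm{res}^H_L\colon M[H]\to M[L]$, $\mathrm{ind}_L^H\colon M[L]\to M[H]$ $(L\le H\le G)$, $\mathrm{con}_{g,H}\colon M[H]\to M[{}^gH]$ $(g\in G)$ with: $\mathrm{res}$ and $\mathrm{ind}$ transitive; $\mathrm{con}_{f,{}^gH}\,\mathrm{con}_{g,H}=\mathrm{con}_{fg,H}$; $\mathrm{con}_{g,H}\,\mathrm{ind}_L^H=\mathrm{ind}_{{}^gL}^{{}^gH}\,\mathrm{con}_{g,L}$; $\mathrm{con}_{g,L}\,\mathrm{res}^H_L=\mathrm{res}^{{}^gH}_{{}^gL}\,\mathrm{con}_{g,H}$; $\mathrm{ind}_H^H=\mathrm{res}^H_H=\mathrm{con}_{h,H}=\mathrm{id}$ for $h\in H$; and, for $L,K\le H$, the Mackey formula $$\mathrm{res}^H_L\,\mathrm{ind}_K^H=\sum_{x\in[L\backslash H/K]}\mathrm{ind}_{L\cap{}^xK}^L\;\mathrm{con}_{x,L^x\cap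 K}\;\mathrm{res}^K_{L^x\cap K}.$$ A *commutative Green functor* is a Mackey functor $R$ with commutative rings $R[H]$, unital ring homomorphisms $\mathrm{res}$ and $\mathrm{con}$, and the Frobenius formulas $\mathrm{ind}_L^H(\mathrm{res}^H_L(y)\,x)=y\,\mathrm{ind}_L^H(x)$, $\mathrm{ind}_L^H(x\,\mathrm{res}^H_L(y))=\mathrm{ind}_L^H(x)\,y$. An *$R$-Mackey module* is a Mackey functor $M$ with $R[H]$-module structures on the $M[H]$ such that $\mathrm{res}^H_L(rm)=\mathrm{res}^H_L(r)\,\mathrm{res}^H_L(m)$, $\mathrm{con}_{g,H}(rm)=\mathrm{con}_{g,H}(r)\,\mathrm{con}_{g,H}(m)$, $r\,\mathrm{ind}_L^H(m)=\mathrm{ind}_L^H(\mathrm{res}^H_L(r)\,m)$ and $\mathrm{ind}_L^H(r)\,m=\mathrm{ind}_L^H(r\,\mathrm{res}^H_L(m))$. With the families of $R[H]$-linear maps commuting with $\mathrm{res}$, $\mathrm{ind}$, $\mathrm{con}$ as morphisms they form a category $R\text{-}\mathsf{Mac}$. Let $R^G[H]=R(H)$ be the complex representation ring, with the tensor product as multiplication,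 restriction of representations, induction $V\mapsto\mathbb CH\otimes_{\mathbb CL}V$, and conjugation by precomposition with ${}^gH\to H$, $x\mapsto g^{-1}xg$. **K-theory.** Let $A$ be a unital C*-algebra with an action of $G$ by $*$-automorphisms. For $H\le G$ let $\tilde K^H_0(A)$ be the Grothendieck group, under direct sum, of isomorphism classes of $(H,A)$-modules: finitely generated projective right $A$-modules $E$ with a linear action of $H$ such that $h(ea)=(he)(ha)$. $R(H)$ acts by $[V]\cdot[E]=[V\otimes_{\mathbb C}E]$ (diagonal $H$-action, $A$-action on $E$). Define maps on these groups as follows. * $\mathrm{res}^H_L$ restricts the action of $H$ to $L$. * $\mathrm{con}_{g,H}[E]=[\mathrm{Con}_gE]$, where $\mathrm{Con}_gE$ is $E$ with the new actions $k\cdot e=(g^{-1}kg)e$ of ${}^gH$ and $e\cdot a=e\,(g^{-1}a)$ of $A$. * $\mathrm{ind}_L^H[E]=[\mathrm{Ind}_L^HE]$, where $\mathrm{Ind}_L^HE=\{\varphi\colon H\to E\mid\varphi(xl)=l^{-1}\varphi(x)\ (l\in L)\}$ with $(\varphi a)(x)=\varphi(x)(x^{-1}a)$ and $(h\varphi)(x)=\varphi(h^{-1}x)$.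 * A unital equivariant $*$-homomorphism $f\colon A\to B$ induces $f_*[E]=[E\otimes_AB]$, with $h(e\otimes b)=he\otimes hb$. For an arbitrary, possibly nonunital, C*-algebra $A$ with an action of $G$ (a $G$-C*-algebra), let $A^+$ be its unitization with the extended action and let $K_0^H(A)=\ker\big(\tilde K^H_0(A^+)\to\tilde K_0^H(\mathbb C)\big)$ be the kernel of the map induced by the augmentation. **Proposition.** $R^G$ is a commutative Green functor. For every $G$-C*-algebra $A$, the maps $\mathrm{res}$, $\mathrm{ind}$, $\mathrm{con}$ and the $R(H)$-actions on the groups $\tilde K^H_0(A^+)$ restrict to the subgroups $K^H_0(A)$, and with them the groups $k^G(A)[H]:=K_0^H(A)$ form an $R^G$-Mackey module $k^G(A)$. An equivariant (not necessarily unital) $*$-homomorphism $f\colon A\to B$ induces maps $K_0^H(A)\to K_0^H(B)$, the restrictions of $(f^+)_*$, and with these $k^G$ is a functor from $G$-C*-algebras to $R^G\text{-}\mathsf{Mac}$. For unital $B$, the unital extension $B^+\to B$ of the identity induces isomorphisms $K_0^H(B)\cong\tilde K_0^H(B)$, compatible with $\mathrm{res}$, $\mathrm{ind}$, $\mathrm{con}$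 and the $R(H)$-actions. Finally $k^G(\mathbb C)=R^G$ for the trivial action on $\mathbb C$: the canonical identifications $K_0^H(\mathbb C)\cong\tilde K_0^H(\mathbb C)=R(H)$ form an isomorphism $k^G(\mathbb C)\cong R^G$ of $R^G$-Mackey modules. -/

import Mathlib

open CategoryTheory
open scoped TensorProduct

universe u v v' w w'

noncomputable section

namespace EquivK

/-! ### Mackey functors, Green functors and Mackey modules: the subgroup picture -/

section Mackey

variable {G : Type u} [Group G]

/-- The conjugate subgroup `ᵍH = g H g⁻¹`. -/
def conjSub (g : G) (H : Subgroup G) : Subgroup G := H.map (MulAut.conj g).toMonoidHom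

theorem mem_conjSub {g k : G} {H : Subgroup G} : k ∈ conjSub g H ↔ g⁻¹ * k * g ∈ H := by
  constructor
  · rintro ⟨h, hh, rfl⟩
    simpa [mul_assoc] using hh
  · intro h
    exact ⟨g⁻¹ * k * g, h, by simp [mul_assoc]⟩

theorem conjSub_conjSub (f g : G) (H : Subgroup G) :
    conjSub f (conjSub g H) = conjSub (f * g) H := by
  ext k
  simp only [mem_conjSub, mul_inv_rev, mul_assoc]

theorem conjSub_eq_self {h : G} {H : Subgroup G} (hh : h ∈ H) : conjSub h H = H := by
  ext k
  rw [mem_conjSub]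
  constructor
  · intro hk
    simpa [mul_assoc] using H.mul_mem (H.mul_mem hh hk) (H.inv_mem hh)
  · intro hk
    exact H.mul_mem (H.mul_mem (H.inv_mem hh) hk) hh

theorem conjSub_mono {L H : Subgroup G} (g : G) (h : L ≤ H) : conjSub g L ≤ conjSub g H :=
  Subgroup.map_mono h

/-- `L ∩ ˣK = ˣ(Lˣ ∩ K)`, where `Lˣ = x⁻¹ L x`. -/
theorem inf_conjSub (x : G) (L K : Subgroup G) :
    L ⊓ conjSub x K = conjSub x (conjSub x⁻¹ L ⊓ K) := by
  ext k
  simp [mem_conjSub, Subgroup.mem_inf, mul_assoc]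

/-- `S` is a full set of representatives of the double cosets `L x K` contained in `H`. -/
def IsDoubleCosetReps (L K H : Subgroup G) (S : Finset G) : Prop :=
  (∀ x ∈ S, x ∈ H) ∧ ∀ h ∈ H, ∃! x, x ∈ S ∧ ∃ l ∈ L, ∃ k ∈ K, h = l * x * k

variable (G) in
/-- The data (without the relations) of a Mackey functor for `G`. The conjugation map
`con_{g,H} : M[H] → M[ᵍH]` is given with a name `K` for its target subgroup `ᵍH`, so that no
transport along equalities of subgroups is needed. -/
structure MackeyData where
  obj : Subgroup G → Type w
  [addCommGroup : ∀ H, AddCommGroup (obj H)]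
  res : ∀ {L H : Subgroup G}, L ≤ H → obj H →+ obj L
  ind : ∀ {L H : Subgroup G}, L ≤ H → obj L →+ obj H
  con : ∀ (g : G) {H K : Subgroup G}, K = conjSub g H → obj H →+ obj K

attribute [instance] MackeyData.addCommGroup

/-- The six families of relations of a Mackey functor. -/
structure MackeyData.IsMackey (M : MackeyData.{u, w} G) : Prop where
  res_res : ∀ {L H K : Subgroup G} (hLH : L ≤ H) (hHK : H ≤ K) (m : M.obj K),
    M.res hLH (M.res hHK m) = M.res (hLH.trans hHK) m
  ind_ind : ∀ {L H K : Subgroup G} (hLH : L ≤ H) (hHK : H ≤ K) (m : M.obj L),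
    M.ind hHK (M.ind hLH m) = M.ind (hLH.trans hHK) m
  con_con : ∀ (f g : G) (H : Subgroup G) (m : M.obj H),
    M.con f (K := conjSub (f * g) H) (conjSub_conjSub f g H).symm
      (M.con g (K := conjSub g H) rfl m) = M.con (f * g) rfl m
  con_ind : ∀ (g : G) {L H : Subgroup G} (hLH : L ≤ H) (m : M.obj L),
    M.con g (K := conjSub g H) rfl (M.ind hLH m) =
      M.ind (conjSub_mono g hLH) (M.con g (K := conjSub g L) rfl m)
  con_res : ∀ (g : G) {L H : Subgroup G} (hLH : L ≤ H) (m : M.obj H),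
    M.con g (K := conjSub g L) rfl (M.res hLH m) =
      M.res (conjSub_mono g hLH) (M.con g (K := conjSub g H) rfl m)
  ind_self : ∀ (H : Subgroup G) (m : M.obj H), M.ind (le_refl H) m = m
  res_self : ∀ (H : Subgroup G) (m : M.obj H), M.res (le_refl H) m = m
  con_self : ∀ {h : G} {H : Subgroup G} (hh : h ∈ H) (m : M.obj H),
    M.con h (conjSub_eq_self hh).symm m = m
  /-- The Mackey formula, for every choice of double coset representatives. -/
  mackey : ∀ {L K H : Subgroup G} (hL : L ≤ H) (hK : K ≤ H) (S : Finset G),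
    IsDoubleCosetReps L K H S → ∀ m : M.obj K,
      M.res hL (M.ind hK m) =
        ∑ x ∈ S, M.ind (inf_le_left : L ⊓ conjSub x K ≤ L)
          (M.con x (inf_conjSub x L K)
            (M.res (inf_le_right : conjSub x⁻¹ L ⊓ K ≤ K) m))

variable (G) in
/-- The data of a commutative Green functor: rings, with restriction and conjugation maps that
are unital ring homomorphisms and additive induction maps. -/
structure GreenData where
  obj : Subgroup G → Type w
  [commRing : ∀ H, CommRing (obj H)]
  res : ∀ {L H : Subgroup G}, L ≤ H → obj H →+* obj L
  ind : ∀ {L H : Subgroup G}, L ≤ H → obj L →+ obj H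
  con : ∀ (g : G) {H K : Subgroup G}, K = conjSub g H → obj H →+* obj K

attribute [instance] GreenData.commRing

/-- The underlying Mackey data of a Green functor. -/
def GreenData.toMackeyData (R : GreenData.{u, w} G) : MackeyData.{u, w} G where
  obj := R.obj
  res h := (R.res h).toAddMonoidHom
  ind h := R.ind h
  con g _ _ h := (R.con g h).toAddMonoidHom

/-- A commutative Green functor: a Mackey functor satisfying the Frobenius formulas. -/
structure GreenData.IsGreen (R : GreenData.{u, w} G) : Prop where
  isMackey : R.toMackeyData.IsMackey
  frobenius_left : ∀ {L H : Subgroup G} (h : L ≤ H) (x : R.obj L) (y : R.obj H),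
    R.ind h (R.res h y * x) = y * R.ind h x
  frobenius_right : ∀ {L H : Subgroup G} (h : L ≤ H) (x : R.obj L) (y : R.obj H),
    R.ind h (x * R.res h y) = R.ind h x * y

variable (G) in
/-- Commutative Green functors for `G`. -/
structure GreenFunctor extends GreenData.{u, w} G where
  isGreen : toGreenData.IsGreen

/-- Mackey modules over the Green functor `R`. -/
structure MackeyModule (R : GreenFunctor.{u, w} G) extends MackeyData.{u, w'} G where
  [module : ∀ H, Module (R.obj H) (obj H)]
  isMackey : toMackeyData.IsMackey
  res_smul : ∀ {L H : Subgroup G} (h : L ≤ H) (r : R.obj H) (m : obj H),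
    res h (r • m) = R.res h r • res h m
  con_smul : ∀ (g : G) {H K : Subgroup G} (h : K = conjSub g H) (r : R.obj H) (m : obj H),
    con g h (r • m) = R.con g h r • con g h m
  smul_ind : ∀ {L H : Subgroup G} (h : L ≤ H) (r : R.obj H) (m : obj L),
    r • ind h m = ind h (R.res h r • m)
  ind_smul : ∀ {L H : Subgroup G} (h : L ≤ H) (r : R.obj L) (m : obj H),
    R.ind h r • m = ind h (r • res h m)

attribute [instance] MackeyModule.module

/-- Morphisms of Mackey modules over `R`. -/
@[ext]
structure MackeyModule.Hom {R : GreenFunctor.{u, w} G} (M N : MackeyModule.{u, w, w'} R) where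
  app : ∀ H : Subgroup G, M.obj H →ₗ[R.obj H] N.obj H
  app_res : ∀ {L H : Subgroup G} (h : L ≤ H) (m : M.obj H),
    app L (M.res h m) = N.res h (app H m)
  app_ind : ∀ {L H : Subgroup G} (h : L ≤ H) (m : M.obj L),
    app H (M.ind h m) = N.ind h (app L m)
  app_con : ∀ (g : G) {H K : Subgroup G} (h : K = conjSub g H) (m : M.obj H),
    app K (M.con g h m) = N.con g h (app H m)

/-- The category `R-Mac` of Mackey modules over `R`. -/
instance (R : GreenFunctor.{u, w} G) : Category (MackeyModule.{u, w, w'} R) where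
  Hom := MackeyModule.Hom
  id M :=
    { app := fun _ => LinearMap.id
      app_res := fun _ _ => rfl
      app_ind := fun _ _ => rfl
      app_con := fun _ _ _ _ _ => rfl }
  comp f g :=
    { app := fun H => (g.app H).comp (f.app H)
      app_res := fun h m => by simp [f.app_res, g.app_res]
      app_ind := fun h m => by simp [f.app_ind, g.app_ind]
      app_con := fun x _ _ h m => by simp [f.app_con, g.app_con] }

/-- A Green functor as a Mackey module over itself. -/
def GreenFunctor.self (R : GreenFunctor.{u, w} G) : MackeyModule.{u, w, w} R where
  toMackeyData := R.toMackeyData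
  module H := (inferInstance : Module (R.obj H) (R.obj H))
  isMackey := R.isGreen.isMackey
  res_smul h r m := map_mul (R.res h) r m
  con_smul g _ _ h r m := map_mul (R.con g h) r m
  smul_ind h r m := (R.isGreen.frobenius_left h m r).symm
  ind_smul h r m := (R.isGreen.frobenius_right h r m).symm

end Mackey

/-! ### Grothendieck groups of isomorphism classes -/

section Grothendieck

/-- Objects with an isomorphism relation and a direct sum. -/
class IsoSum (X : Type v) where
  iso : X → X → Prop
  iso_equivalence : Equivalence iso
  zero : X
  sum : X → X → X
  sum_congr : ∀ {a a' b b' : X}, iso a a' → iso b b' → iso (sum a b) (sum a' b')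
  sum_comm : ∀ a b : X, iso (sum a b) (sum b a)
  sum_assoc : ∀ a b c : X, iso (sum (sum a b) c) (sum a (sum b c))
  zero_sum : ∀ a : X, iso (sum zero a) a

variable (X : Type v) [IsoSum X]

/-- Isomorphism as an equivalence relation. -/
def isoSetoid : Setoid X := ⟨IsoSum.iso, IsoSum.iso_equivalence⟩

/-- Isomorphism classes. -/
def IsoClass : Type v := Quotient (isoSetoid X)

variable {X} in
/-- The isomorphism class of an object. -/
def IsoClass.mk (a : X) : IsoClass X := Quotient.mk (isoSetoid X) a

instance : Zero (IsoClass X) := ⟨IsoClass.mk IsoSum.zero⟩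

instance : Add (IsoClass X) :=
  ⟨Quotient.map₂ IsoSum.sum (fun _ _ h _ _ h' => IsoSum.sum_congr h h')⟩

/-- The commutative monoid of isomorphism classes under direct sum. -/
instance : AddCommMonoid (IsoClass X) where
  add_assoc := by
    rintro ⟨a⟩ ⟨b⟩ ⟨c⟩
    exact Quotient.sound (IsoSum.sum_assoc a b c)
  add_comm := by
    rintro ⟨a⟩ ⟨b⟩
    exact Quotient.sound (IsoSum.sum_comm a b)
  zero_add := by
    rintro ⟨a⟩
    exact Quotient.sound (IsoSum.zero_sum a)
  add_zero := by
    rintro ⟨a⟩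
    exact Quotient.sound
      (IsoSum.iso_equivalence.trans (IsoSum.sum_comm a IsoSum.zero) (IsoSum.zero_sum a))
  nsmul := nsmulRec

/-- The Grothendieck group of isomorphism classes under direct sum. -/
def GroGrp : Type v := Algebra.GrothendieckAddGroup (IsoClass X)

instance : AddCommGroup (GroGrp X) :=
  inferInstanceAs (AddCommGroup (Algebra.GrothendieckAddGroup (IsoClass X)))

variable {X}

/-- The class `[a]` of an object in the Grothendieck group. -/
def cls (a : X) : GroGrp X :=
  Algebra.GrothendieckAddGroup.of (IsoClass.mk a)

theorem cls_eq {a b : X} (h : IsoSum.iso a b) : cls a = cls b :=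
  congrArg (Algebra.GrothendieckAddGroup.of (M := IsoClass X)) (Quotient.sound h)

theorem cls_sum (a b : X) : cls (IsoSum.sum a b) = cls a + cls b :=
  map_add (Algebra.GrothendieckAddGroup.of (M := IsoClass X))
    (IsoClass.mk a) (IsoClass.mk b)

/-- An isomorphism invariant, additive function on objects extends to the Grothendieck group. -/
def GroGrp.lift {T : Type w} [AddCommGroup T] (f : X → T)
    (hf : ∀ a b, IsoSum.iso a b → f a = f b)
    (hadd : ∀ a b, f (IsoSum.sum a b) = f a + f b) : GroGrp X →+ T :=
  Algebra.GrothendieckAddGroup.lift (M := IsoClass X)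
    { toFun := Quotient.lift f hf
      map_zero' := by
        change f IsoSum.zero = 0
        have h := hf _ _ (IsoSum.zero_sum (X := X) IsoSum.zero)
        rw [hadd] at h
        simpa using h
      map_add' := by
        rintro ⟨a⟩ ⟨b⟩
        exact hadd a b }

@[simp]
theorem GroGrp.lift_cls {T : Type w} [AddCommGroup T] (f : X → T)
    (hf : ∀ a b, IsoSum.iso a b → f a = f b)
    (hadd : ∀ a b, f (IsoSum.sum a b) = f a + f b) (a : X) : GroGrp.lift f hf hadd (cls a) = f a :=
  DFunLike.congr_fun
    (Algebra.GrothendieckAddGroup.lift (M := IsoClass X) (G := T) |>.symm_apply_apply _)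
    (IsoClass.mk a)

theorem GroGrp.exists_sub (x : GroGrp X) : ∃ a b : X, x = cls a - cls b := by
  induction x using AddLocalization.induction_on with
  | H y =>
    obtain ⟨⟨m⟩, ⟨⟨n⟩, hn⟩⟩ := y
    refine ⟨m, n, ?_⟩
    have h := AddLocalization.mk_add (S := (⊤ : AddSubmonoid (IsoClass X)))
      (IsoClass.mk m) (IsoClass.mk n) ⟨IsoClass.mk n, hn⟩ 0
    let y : GroGrp X :=
      AddLocalization.mk (S := (⊤ : AddSubmonoid (IsoClass X))) (IsoClass.mk m) ⟨IsoClass.mk n, hn⟩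
    have h' : cls m = y + cls n := by
      refine Eq.trans ?_ h.symm
      refine (AddLocalization.mk_eq_mk_iff.2 (AddLocalization.r_of_eq ?_))
      change IsoClass.mk n + 0 + IsoClass.mk m = 0 + (IsoClass.mk m + IsoClass.mk n)
      abel
    exact eq_sub_of_add_eq h'.symm

theorem GroGrp.hom_ext {T : Type w} [AddCommGroup T] {f g : GroGrp X →+ T}
    (h : ∀ a, f (cls a) = g (cls a)) : f = g := by
  apply (Algebra.GrothendieckAddGroup.lift (M := IsoClass X) (G := T)).symm.injective
  ext ⟨a⟩
  exact h a

/-- An additive operation on objects induces a map of Grothendieck groups. -/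
def GroGrp.map {Y : Type w} [IsoSum Y] (F : X → Y)
    (hF : ∀ a b, IsoSum.iso a b → IsoSum.iso (F a) (F b))
    (hadd : ∀ a b, IsoSum.iso (F (IsoSum.sum a b)) (IsoSum.sum (F a) (F b))) :
    GroGrp X →+ GroGrp Y :=
  GroGrp.lift (fun a => cls (F a)) (fun a b h => cls_eq (hF a b h))
    (fun a b => (cls_eq (hadd a b)).trans (cls_sum _ _))

@[simp]
theorem GroGrp.map_cls {Y : Type w} [IsoSum Y] (F : X → Y)
    (hF : ∀ a b, IsoSum.iso a b → IsoSum.iso (F a) (F b))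
    (hadd : ∀ a b, IsoSum.iso (F (IsoSum.sum a b)) (IsoSum.sum (F a) (F b))) (a : X) :
    GroGrp.map F hF hadd (cls a) = cls (F a) :=
  GroGrp.lift_cls _ _ _ a

/-- A biadditive operation on objects induces a biadditive map of Grothendieck groups. -/
def GroGrp.map₂ {Y : Type v'} [IsoSum Y] {Z : Type w} [IsoSum Z] (F : X → Y → Z)
    (hF : ∀ a a' b b', IsoSum.iso a a' → IsoSum.iso b b' →
      IsoSum.iso (F a b) (F a' b'))
    (hl : ∀ a a' b, IsoSum.iso (F (IsoSum.sum a a') b)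
      (IsoSum.sum (F a b) (F a' b)))
    (hr : ∀ a b b', IsoSum.iso (F a (IsoSum.sum b b'))
      (IsoSum.sum (F a b) (F a b'))) :
    GroGrp X →+ GroGrp Y →+ GroGrp Z :=
  GroGrp.lift
    (fun a => GroGrp.map (F a)
      (fun b b' h => hF a a b b' (IsoSum.iso_equivalence.refl a) h) (hr a))
    (fun a a' h => GroGrp.hom_ext fun b => by
      simpa using cls_eq (hF a a' b b h (IsoSum.iso_equivalence.refl b)))
    (fun a a' => GroGrp.hom_ext fun b => by
      simpa using (cls_eq (hl a a' b)).trans (cls_sum _ _))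

@[simp]
theorem GroGrp.map₂_cls {Y : Type v'} [IsoSum Y] {Z : Type w} [IsoSum Z] (F : X → Y → Z)
    (hF : ∀ a a' b b', IsoSum.iso a a' → IsoSum.iso b b' →
      IsoSum.iso (F a b) (F a' b'))
    (hl : ∀ a a' b, IsoSum.iso (F (IsoSum.sum a a') b)
      (IsoSum.sum (F a b) (F a' b)))
    (hr : ∀ a b b', IsoSum.iso (F a (IsoSum.sum b b'))
      (IsoSum.sum (F a b) (F a b'))) (a : X) (b : Y) :
    GroGrp.map₂ F hF hl hr (cls a) (cls b) = cls (F a b) := by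
  simp [GroGrp.map₂]

end Grothendieck

/-! ### The representation Green functor -/

section Rep

/-- Finite dimensional complex representations of `H`. -/
structure FinRep (H : Type u) [Group H] where
  carrier : Type u
  [addCommGroup : AddCommGroup carrier]
  [module : Module ℂ carrier]
  [finite : Module.Finite ℂ carrier]
  ρ : Representation ℂ H carrier

attribute [instance] FinRep.addCommGroup FinRep.module FinRep.finite

namespace FinRep

section Group

variable {H : Type u} [Group H]

/-- Isomorphism of representations. -/
def Iso (V W : FinRep H) : Prop := Nonempty (V.ρ.Equiv W.ρ)

theorem Iso.of {V W : FinRep H} (e : V.carrier ≃ₗ[ℂ] W.carrier)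
    (he : ∀ h x, e (V.ρ h x) = W.ρ h (e x)) : V.Iso W :=
  ⟨.mk e fun h => LinearMap.ext (he h)⟩

theorem Iso.exists {V W : FinRep H} (h : V.Iso W) :
    ∃ e : V.carrier ≃ₗ[ℂ] W.carrier, ∀ h x, e (V.ρ h x) = W.ρ h (e x) := by
  obtain ⟨e⟩ := h
  exact ⟨e.toLinearEquiv, fun h x => LinearMap.congr_fun (e.isIntertwining' h) x⟩

/-- The direct sum of two representations. -/
def sum (V W : FinRep H) : FinRep H where
  carrier := V.carrier × W.carrier
  ρ := V.ρ.prod W.ρ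

/-- The tensor product over `ℂ` of two representations, with the diagonal action. -/
def tensor (V W : FinRep H) : FinRep H where
  carrier := V.carrier ⊗[ℂ] W.carrier
  ρ := V.ρ.tprod W.ρ

/-- The one-dimensional trivial representation. -/
def triv (H : Type u) [Group H] : FinRep H where
  carrier := ULift.{u} ℂ
  ρ := Representation.trivial ℂ H (ULift.{u} ℂ)

theorem sum_congr {V V' W W' : FinRep H} (hV : V.Iso V') (hW : W.Iso W') :
    (V.sum W).Iso (V'.sum W') := by
  obtain ⟨e, he⟩ := hV.exists
  obtain ⟨f, hf⟩ := hW.exists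
  exact Iso.of (e.prodCongr f) fun h x => Prod.ext (he h _) (hf h _)

instance : IsoSum (FinRep H) where
  iso := Iso
  iso_equivalence :=
    { refl := fun V => ⟨.refl V.ρ⟩
      symm := fun ⟨e⟩ => ⟨e.symm⟩
      trans := fun ⟨e⟩ ⟨f⟩ => ⟨e.trans f⟩ }
  zero := ⟨PUnit, 1⟩
  sum := sum
  sum_congr := sum_congr
  sum_comm V W := Iso.of (LinearEquiv.prodComm ℂ V.carrier W.carrier) fun _ _ => rfl
  sum_assoc V W U := Iso.of (LinearEquiv.prodAssoc ℂ V.carrier W.carrier U.carrier) fun _ _ => rfl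
  zero_sum V := Iso.of
    { toFun := fun x : PUnit × V.carrier => x.2
      invFun := fun x => (0, x)
      map_add' := fun _ _ => rfl
      map_smul' := fun _ _ => rfl
      left_inv := fun _ => rfl
      right_inv := fun _ => rfl } fun _ _ => rfl

theorem tensor_iso_of {V W U : FinRep H} (e : V.carrier ⊗[ℂ] W.carrier ≃ₗ[ℂ] U.carrier)
    (he : ∀ h x y, e (V.ρ h x ⊗ₜ W.ρ h y) = U.ρ h (e (x ⊗ₜ y))) : (V.tensor W).Iso U := by
  refine ⟨.mk e fun h => TensorProduct.ext' fun x y => he h x y⟩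

theorem tensor_congr {V V' W W' : FinRep H} (hV : V.Iso V') (hW : W.Iso W') :
    (V.tensor W).Iso (V'.tensor W') := by
  obtain ⟨e, he⟩ := hV.exists
  obtain ⟨f, hf⟩ := hW.exists
  refine tensor_iso_of (U := V'.tensor W') (TensorProduct.congr e f) fun h x y => ?_
  change e _ ⊗ₜ f _ = V'.ρ h (e x) ⊗ₜ[ℂ] W'.ρ h (f y)
  rw [he, hf]

theorem tensor_sum_left (V V' W : FinRep H) :
    ((V.sum V').tensor W).Iso ((V.tensor W).sum (V'.tensor W)) :=
  tensor_iso_of (V := V.sum V') (U := (V.tensor W).sum (V'.tensor W))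
    (TensorProduct.prodLeft ℂ ℂ V.carrier V'.carrier W.carrier) fun _ _ _ => rfl

theorem tensor_sum_right (V W W' : FinRep H) :
    (V.tensor (W.sum W')).Iso ((V.tensor W).sum (V.tensor W')) :=
  tensor_iso_of (W := W.sum W') (U := (V.tensor W).sum (V.tensor W'))
    (TensorProduct.prodRight ℂ ℂ V.carrier W.carrier W'.carrier) fun _ _ _ => rfl

theorem triv_tensor (V : FinRep H) : ((triv H).tensor V).Iso V :=
  tensor_iso_of (V := triv H) ((TensorProduct.congr ULift.moduleEquiv (.refl ℂ _)).trans
      (TensorProduct.lid ℂ V.carrier)) fun h x y => ((V.ρ h).map_smul x.down y).symm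

end Group

/-- The restriction of a representation along a group homomorphism. -/
def comp {H K : Type u} [Group H] [Group K] (φ : K →* H) (V : FinRep H) : FinRep K where
  carrier := V.carrier
  ρ := V.ρ.comp φ

theorem comp_congr {H K : Type u} [Group H] [Group K] (φ : K →* H) {V W : FinRep H}
    (h : V.Iso W) : (V.comp φ).Iso (W.comp φ) := by
  obtain ⟨e, he⟩ := h.exists
  exact Iso.of (V := V.comp φ) (W := W.comp φ) e fun k => he (φ k)

section Ind

variable {L H : Type u} [Group L] [Group H] [Finite H] (φ : L →* H)

/-- The induced representation `ℂH ⊗_{ℂL} V`. -/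
def ind (V : FinRep L) : FinRep H where
  carrier := Representation.IndV φ V.ρ
  finite := Module.Finite.of_surjective (Representation.Coinvariants.mk _)
    (Representation.Coinvariants.mk_surjective _)
  ρ := Representation.ind φ V.ρ

/-- The elements `h ⊗ x` of the induced representation. -/
def indMk (V : FinRep L) (h : H) : V.carrier →ₗ[ℂ] (ind φ V).carrier :=
  Representation.IndV.mk φ V.ρ h

theorem ind_ext {V : FinRep L} {T : Type u} [AddCommGroup T] [Module ℂ T]
    {f g : (ind φ V).carrier →ₗ[ℂ] T} (hfg : ∀ h x, f (indMk φ V h x) = g (indMk φ V h x)) :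
    f = g :=
  Representation.IndV.hom_ext φ V.ρ fun h => LinearMap.ext (hfg h)

/-- Induction of representations on morphisms. -/
def indMap {V W : FinRep L} (f : V.ρ.IntertwiningMap W.ρ) :
    (ind φ V).carrier →ₗ[ℂ] (ind φ W).carrier :=
  (Rep.indMap φ (Rep.ofHom f)).hom.toLinearMap

theorem indMap_indMk {V W : FinRep L} (f : V.ρ.IntertwiningMap W.ρ) (h : H) (x : V.carrier) :
    indMap φ f (indMk φ V h x) = indMk φ W h (f.toLinearMap x) :=
  rfl

theorem indMap_ρ {V W : FinRep L} (f : V.ρ.IntertwiningMap W.ρ) (h : H)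
    (x : (ind φ V).carrier) : indMap φ f ((ind φ V).ρ h x) = (ind φ W).ρ h (indMap φ f x) :=
  LinearMap.congr_fun ((Rep.indMap φ (Rep.ofHom f)).hom.isIntertwining' h) x

theorem ind_congr {V W : FinRep L} (h : V.Iso W) : (ind φ V).Iso (ind φ W) := by
  obtain ⟨e⟩ := h
  refine Iso.of (LinearEquiv.ofLinearMap (indMap φ e.toIntertwiningMap)
    (indMap φ e.symm.toIntertwiningMap) ?_ ?_) (indMap_ρ φ _)
  · refine ind_ext φ fun h x => ?_
    rw [LinearMap.comp_apply, indMap_indMk, indMap_indMk]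
    exact congrArg (indMk φ W h) (e.toLinearEquiv.apply_symm_apply x)
  · refine ind_ext φ fun h x => ?_
    rw [LinearMap.comp_apply, indMap_indMk, indMap_indMk]
    exact congrArg (indMk φ V h) (e.toLinearEquiv.symm_apply_apply x)

theorem ind_sum (V W : FinRep L) : (ind φ (sum V W)).Iso (sum (ind φ V) (ind φ W)) := by
  let p : (sum V W).ρ.IntertwiningMap V.ρ := Representation.IntertwiningMap.fst ℂ V.ρ W.ρ
  let q : (sum V W).ρ.IntertwiningMap W.ρ := Representation.IntertwiningMap.snd ℂ V.ρ W.ρ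
  let i : V.ρ.IntertwiningMap (sum V W).ρ := Representation.IntertwiningMap.inl ℂ V.ρ W.ρ
  let j : W.ρ.IntertwiningMap (sum V W).ρ := Representation.IntertwiningMap.inr ℂ V.ρ W.ρ
  have e : { e : (ind φ (sum V W)).carrier ≃ₗ[ℂ] (ind φ V).carrier × (ind φ W).carrier //
      e.toLinearMap = (indMap φ p).prod (indMap φ q) } := by
    refine ⟨LinearEquiv.ofLinearMap
      ((indMap φ p).prod (indMap φ q)) ((indMap φ i).coprod (indMap φ j)) ?_ ?_, rfl⟩
    · refine LinearMap.prod_ext ?_ ?_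
      · refine ind_ext φ fun h x => ?_
        have h1 : p.toLinearMap (i.toLinearMap x) = x := rfl
        have h2 : q.toLinearMap (i.toLinearMap x) = 0 := rfl
        simp [indMap_indMk, -Representation.IntertwiningMap.coe_toLinearMap, h1, h2]
      · refine ind_ext φ fun h x => ?_
        have h1 : p.toLinearMap (j.toLinearMap x) = 0 := rfl
        have h2 : q.toLinearMap (j.toLinearMap x) = x := rfl
        simp [indMap_indMk, -Representation.IntertwiningMap.coe_toLinearMap, h1, h2]
    · refine ind_ext φ fun h x => ?_
      have h1 : i.toLinearMap (p.toLinearMap x) + j.toLinearMap (q.toLinearMap x) = x :=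
        Prod.ext (add_zero x.1) (zero_add x.2)
      simp only [LinearMap.comp_apply, LinearMap.prod_apply, Function.prod, LinearMap.coprod_apply,
        indMap_indMk, LinearMap.id_apply, ← map_add, h1]
  refine Iso.of (W := sum (ind φ V) (ind φ W)) e.1 fun h x => ?_
  have he : ∀ x, e.1 x = (indMap φ p x, indMap φ q x) := LinearMap.congr_fun e.2
  refine (he _).trans (Eq.trans ?_ (congrArg ((sum (ind φ V) (ind φ W)).ρ h) (he x)).symm)
  exact Prod.ext (indMap_ρ φ p h x) (indMap_ρ φ q h x)

end Ind

end FinRep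

/-- The complex representation ring `R(H)`. -/
def RepRing (H : Type u) [Group H] : Type (u + 1) := GroGrp (FinRep H)

namespace RepRing

variable {H : Type u} [Group H]

instance : AddCommGroup (RepRing H) := inferInstanceAs (AddCommGroup (GroGrp (FinRep H)))

/-- The class of a representation. -/
def of (V : FinRep H) : RepRing H := cls V

/-- The multiplication of `R(H)`, induced by the tensor product of representations. -/
def mulHom : RepRing H →+ RepRing H →+ RepRing H :=
  GroGrp.map₂ FinRep.tensor (fun _ _ _ _ => FinRep.tensor_congr) FinRep.tensor_sum_left
    FinRep.tensor_sum_right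

instance : Mul (RepRing H) := ⟨fun a b => mulHom a b⟩

instance : One (RepRing H) := ⟨of (FinRep.triv H)⟩

theorem of_eq {V W : FinRep H} (h : V.Iso W) : of V = of W := cls_eq h

theorem of_mul_of (V W : FinRep H) : of V * of W = of (V.tensor W) :=
  GroGrp.map₂_cls (FinRep.tensor (H := H)) _ _ _ V W

theorem hom_ext {T : Type w} [AddCommGroup T] {f g : RepRing H →+ T}
    (h : ∀ V, f (of V) = g (of V)) : f = g := GroGrp.hom_ext h

/-- To prove an additive statement on `R(H)`, check it on classes of representations. -/
theorem induction {p : RepRing H → Prop} (of : ∀ V, p (of V))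
    (sub : ∀ a b, p a → p b → p (a - b)) (a : RepRing H) : p a := by
  obtain ⟨V, W, rfl⟩ := GroGrp.exists_sub a
  exact sub _ _ (of V) (of W)

instance : NonUnitalNonAssocRing (RepRing H) where
  left_distrib a b c := (mulHom a).map_add b c
  right_distrib a b c := DFunLike.congr_fun (mulHom.map_add a b) c
  zero_mul a := DFunLike.congr_fun (mulHom (H := H)).map_zero a
  mul_zero a := (mulHom a).map_zero

instance : CommRing (RepRing H) where
  mul_assoc a b c := by
    induction a using induction with
    | sub x y hx hy => simp only [sub_mul, hx, hy]
    | of V =>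
      induction b using induction with
      | sub x y hx hy => simp only [sub_mul, mul_sub, hx, hy]
      | of W =>
        induction c using induction with
        | sub x y hx hy => simp only [mul_sub, hx, hy]
        | of U =>
          simp only [of_mul_of]
          exact of_eq ⟨Representation.TensorProduct.assoc V.ρ W.ρ U.ρ⟩
  mul_comm a b := by
    induction a using induction with
    | sub x y hx hy => simp only [sub_mul, mul_sub, hx, hy]
    | of V =>
      induction b using induction with
      | sub x y hx hy => simp only [sub_mul, mul_sub, hx, hy]
      | of W =>
        simp only [of_mul_of]
        exact of_eq ⟨Representation.TensorProduct.comm V.ρ W.ρ⟩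
  one_mul a := by
    induction a using induction with
    | sub x y hx hy => simp only [mul_sub, hx, hy]
    | of V => exact (of_mul_of _ V).trans (of_eq (FinRep.triv_tensor V))
  mul_one a := by
    induction a using induction with
    | sub x y hx hy => simp only [sub_mul, hx, hy]
    | of V =>
      exact (of_mul_of V _).trans
        ((of_eq ⟨Representation.TensorProduct.comm V.ρ (FinRep.triv H).ρ⟩).trans
          (of_eq (FinRep.triv_tensor V)))

/-- Restriction of representations along a group homomorphism, `R(H) → R(K)`. -/
def compHom {K : Type u} [Group K] (φ : K →* H) : RepRing H →+* RepRing K :=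
  let f : RepRing H →+ RepRing K :=
    GroGrp.map (FinRep.comp φ) (fun _ _ => FinRep.comp_congr φ)
      (fun V W => IsoSum.iso_equivalence.refl ((V.sum W).comp φ))
  have hf : ∀ V, f (of V) = of (V.comp φ) := fun V => GroGrp.map_cls (FinRep.comp φ) _ _ V
  { f with
    map_one' := hf (FinRep.triv H)
    map_mul' := fun a b => by
      change f (a * b) = f a * f b
      induction a using induction with
      | sub x y hx hy => simp only [sub_mul, map_sub, hx, hy]
      | of V =>
        induction b using induction with
        | sub x y hx hy => simp only [mul_sub, map_sub, hx, hy]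
        | of W => rw [of_mul_of, hf, hf, hf, of_mul_of]; rfl }

/-- Induction of representations along a group homomorphism, `R(L) → R(H)`. -/
def indHom {L : Type u} [Group L] [Finite H] (φ : L →* H) : RepRing L →+ RepRing H :=
  GroGrp.map (FinRep.ind φ) (fun _ _ => FinRep.ind_congr φ) (FinRep.ind_sum φ)

end RepRing

/-- The isomorphism `ᵍH → H`, `k ↦ g⁻¹ k g`. -/
def conjHom {G : Type u} [Group G] (g : G) {H K : Subgroup G} (h : K = conjSub g H) : K →* H where
  toFun k := ⟨g⁻¹ * k * g, mem_conjSub.1 (h ▸ k.2)⟩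
  map_one' := by ext; simp
  map_mul' a b := by ext; simp [mul_assoc]

/-- The representation Green functor `R^G`. -/
def repGreen (G : Type u) [Group G] [Finite G] : GreenData.{u, u + 1} G where
  obj H := RepRing H
  res h := RepRing.compHom (Subgroup.inclusion h)
  ind h := RepRing.indHom (Subgroup.inclusion h)
  con g _ _ h := RepRing.compHom (conjHom g h)

/-- The Green functor `R^G`, given that it satisfies the relations. -/
def repGreenFunctor {G : Type u} [Group G] [Finite G] (h : (repGreen G).IsGreen) :
    GreenFunctor.{u, u + 1} G := ⟨repGreen G, h⟩

end Rep

/-! ### Equivariant K-theory of unital `G`-C*-algebras -/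

section EqMod

open MulOpposite (op unop)

variable {G : Type u} [Group G] {A : Type v} [CStarAlgebra A]

/-- Finitely generated projective `(H, Res A)`-modules, for a unital C*-algebra `A` with an action
`α` of `G` and `H ≤ G`: finitely generated projective right `A`-modules `E` (the right action is
written `op a • x` for `x a`) with a representation of `H` on `E` such that
`h (x a) = (h x) (h a)`. The complex vector space structure is the one induced by `A`. A finitely
generated projective `A`-module carries a unique Banach space topology, for which the action of
`H` and all `A`-linear maps are automatically continuous. -/
structure EqMod (α : G →* (A ≃⋆ₐ[ℂ] A)) (H : Subgroup G) where
  carrier : Type w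
  [addCommGroup : AddCommGroup carrier]
  [module : Module ℂ carrier]
  [opModule : Module Aᵐᵒᵖ carrier]
  [tower : IsScalarTower ℂ Aᵐᵒᵖ carrier]
  [finite : Module.Finite Aᵐᵒᵖ carrier]
  [projective : Module.Projective Aᵐᵒᵖ carrier]
  ρ : Representation ℂ H carrier
  ρ_smul : ∀ (h : H) (a : A) (x : carrier), ρ h (op a • x) = op (α h a) • ρ h x

attribute [instance] EqMod.addCommGroup EqMod.module EqMod.opModule EqMod.tower EqMod.finite
  EqMod.projective

namespace EqMod

variable {α : G →* (A ≃⋆ₐ[ℂ] A)} {H : Subgroup G}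

/-- Isomorphism of `(H, A)`-modules. -/
def Iso (E F : EqMod.{u, v, w} α H) : Prop :=
  ∃ e : E.carrier ≃ₗ[Aᵐᵒᵖ] F.carrier, ∀ h x, e (E.ρ h x) = F.ρ h (e x)

theorem Iso.refl (E : EqMod.{u, v, w} α H) : E.Iso E := ⟨.refl _ _, fun _ _ => rfl⟩

theorem Iso.symm {E F : EqMod.{u, v, w} α H} : E.Iso F → F.Iso E := fun ⟨e, he⟩ =>
  ⟨e.symm, fun h x => by rw [LinearEquiv.symm_apply_eq, he, LinearEquiv.apply_symm_apply]⟩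

theorem Iso.trans {E F K : EqMod.{u, v, w} α H} : E.Iso F → F.Iso K → E.Iso K :=
  fun ⟨e, he⟩ ⟨f, hf⟩ => ⟨e.trans f, fun h x => by
    rw [LinearEquiv.trans_apply, he, hf, LinearEquiv.trans_apply]⟩

/-- The direct sum of two `(H, A)`-modules. -/
def sum (E F : EqMod.{u, v, w} α H) : EqMod.{u, v, w} α H where
  carrier := E.carrier × F.carrier
  ρ := E.ρ.prod F.ρ
  ρ_smul h a x := Prod.ext (E.ρ_smul h a x.1) (F.ρ_smul h a x.2)

theorem sum_congr {E E' F F' : EqMod.{u, v, w} α H} (hE : E.Iso E') (hF : F.Iso F') :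
    (E.sum F).Iso (E'.sum F') := by
  obtain ⟨e, he⟩ := hE
  obtain ⟨f, hf⟩ := hF
  exact ⟨e.prodCongr f, fun h x => Prod.ext (he h _) (hf h _)⟩

instance : IsoSum (EqMod.{u, v, w} α H) where
  iso := Iso
  iso_equivalence := ⟨Iso.refl, Iso.symm, Iso.trans⟩
  zero :=
    { carrier := PUnit
      ρ := 1
      ρ_smul := fun _ _ _ => rfl }
  sum := sum
  sum_congr := sum_congr
  sum_comm E F := ⟨LinearEquiv.prodComm Aᵐᵒᵖ E.carrier F.carrier, fun _ _ => rfl⟩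
  sum_assoc E F K := ⟨LinearEquiv.prodAssoc Aᵐᵒᵖ E.carrier F.carrier K.carrier, fun _ _ => rfl⟩
  zero_sum E := ⟨
    { toFun := fun x : PUnit × E.carrier => x.2
      invFun := fun x => (0, x)
      map_add' := fun _ _ => rfl
      map_smul' := fun _ _ => rfl
      left_inv := fun _ => rfl
      right_inv := fun _ => rfl }, fun _ _ => rfl⟩

/-! #### Restriction -/

/-- Restriction of the action of `H` to `L ≤ H`. -/
def res {L H : Subgroup G} (h : L ≤ H) (E : EqMod.{u, v, w} α H) : EqMod.{u, v, w} α L where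
  carrier := E.carrier
  ρ := E.ρ.comp (Subgroup.inclusion h)
  ρ_smul l a x := E.ρ_smul (Subgroup.inclusion h l) a x

theorem res_congr {L H : Subgroup G} (h : L ≤ H) {E F : EqMod.{u, v, w} α H} :
    E.Iso F → (E.res h).Iso (F.res h) := fun ⟨e, he⟩ => ⟨e, fun _ => he _⟩

/-! #### Twisting the module structure, and conjugation -/

/-- The ring automorphism `a ↦ g a` of the opposite algebra. -/
def opAut (α : G →* (A ≃⋆ₐ[ℂ] A)) (g : G) : Aᵐᵒᵖ →+* Aᵐᵒᵖ :=
  RingHom.op (α g : A →+* A)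

theorem opAut_apply (g : G) (a : Aᵐᵒᵖ) : opAut α g a = op (α g (unop a)) := rfl

theorem inv_act (g : G) (a : A) : α g⁻¹ (α g a) = a := by
  rw [← StarAlgEquiv.mul_apply, ← map_mul, inv_mul_cancel, map_one, StarAlgEquiv.one_apply]

theorem act_inv (g : G) (a : A) : α g (α g⁻¹ a) = a := by
  rw [← StarAlgEquiv.mul_apply, ← map_mul, mul_inv_cancel, map_one, StarAlgEquiv.one_apply]

instance opAut_pair (g : G) : RingHomInvPair (opAut α g) (opAut α g⁻¹) where
  comp_eq := RingHom.ext fun a => congrArg op (inv_act g (unop a))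
  comp_eq₂ := RingHom.ext fun a => congrArg op (act_inv g (unop a))

instance opAut_pair' (g : G) : RingHomInvPair (opAut α g⁻¹) (opAut α g) where
  comp_eq := RingHom.ext fun a => congrArg op (act_inv g (unop a))
  comp_eq₂ := RingHom.ext fun a => congrArg op (inv_act g (unop a))

/-- The module `M` with the right `A`-action `x ·ᵍ a = x (g⁻¹ a)`. -/
def Twist (_α : G →* (A ≃⋆ₐ[ℂ] A)) (_g : G) (M : Type w) : Type w := M

section Twist

variable (α) (g : G) (M : Type w) [AddCommGroup M] [Module ℂ M] [Module Aᵐᵒᵖ M]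

instance : AddCommGroup (Twist α g M) := inferInstanceAs (AddCommGroup M)

instance : Module ℂ (Twist α g M) := inferInstanceAs (Module ℂ M)

instance : Module Aᵐᵒᵖ (Twist α g M) := Module.compHom M (opAut α g⁻¹)

/-- The identity map `M → Twist α g M`. -/
def toTwist : M ≃ₗ[ℂ] Twist α g M := LinearEquiv.refl ℂ M

variable {M} in
theorem smul_toTwist (a : A) (x : M) :
    op a • toTwist α g M x = toTwist α g M (op (α g⁻¹ a) • x) := rfl

variable [IsScalarTower ℂ Aᵐᵒᵖ M]

instance twist_tower : IsScalarTower ℂ Aᵐᵒᵖ (Twist α g M) where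
  smul_assoc c a x := by
    obtain ⟨x, rfl⟩ := (toTwist α g M).surjective x
    obtain ⟨a, rfl⟩ := MulOpposite.op_surjective a
    rw [← MulOpposite.op_smul, smul_toTwist, smul_toTwist, map_smul (α g⁻¹), MulOpposite.op_smul,
      smul_assoc, map_smul]

/-- The identity map, as a semilinear equivalence. -/
def twistEquiv : M ≃ₛₗ[opAut α g] Twist α g M where
  toFun := toTwist α g M
  invFun := (toTwist α g M).symm
  map_add' _ _ := rfl
  map_smul' a x := by
    obtain ⟨a, rfl⟩ := MulOpposite.op_surjective a
    rw [opAut_apply, smul_toTwist, MulOpposite.unop_op, inv_act]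
  left_inv _ := rfl
  right_inv _ := rfl

instance [Module.Finite Aᵐᵒᵖ M] : Module.Finite Aᵐᵒᵖ (Twist α g M) :=
  Module.Finite.of_surjective (twistEquiv α g M).toLinearMap (twistEquiv α g M).surjective

instance [Module.Projective Aᵐᵒᵖ M] : Module.Projective Aᵐᵒᵖ (Twist α g M) :=
  Module.Projective.of_equiv (twistEquiv α g M)

end Twist

/-- The conjugate `Con_g E` of an `(H, A)`-module: the space `E` with the action
`k ·ᵍ x = (g⁻¹ k g) x` of `K = ᵍH` and the right `A`-action `x ·ᵍ a = x (g⁻¹ a)`. -/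
def con (g : G) {H K : Subgroup G} (h : K = conjSub g H) (E : EqMod.{u, v, w} α H) :
    EqMod.{u, v, w} α K where
  carrier := Twist α g E.carrier
  tower := twist_tower α g E.carrier
  ρ := E.ρ.comp (conjHom g h)
  ρ_smul k a x := by
    have h1 : α (conjHom g h k : H) (α g⁻¹ a) = α g⁻¹ (α k a) := by
      change α (g⁻¹ * k * g) (α g⁻¹ a) = _
      rw [map_mul, map_mul, StarAlgEquiv.mul_apply, StarAlgEquiv.mul_apply, act_inv]
    have h2 := E.ρ_smul (conjHom g h k) (α g⁻¹ a) ((toTwist α g E.carrier).symm x)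
    rw [h1] at h2
    exact h2

theorem con_congr (g : G) {H K : Subgroup G} (h : K = conjSub g H) {E F : EqMod.{u, v, w} α H} :
    E.Iso F → (E.con g h).Iso (F.con g h) := fun ⟨e, he⟩ =>
  ⟨{ toFun := fun x => e x
     invFun := fun x => e.symm x
     map_add' := e.map_add
     map_smul' := fun a x => e.map_smul (opAut α g⁻¹ a) x
     left_inv := e.left_inv
     right_inv := e.right_inv }, fun _ => he _⟩

theorem con_sum (g : G) {H K : Subgroup G} (h : K = conjSub g H) (E F : EqMod.{u, v, w} α H) :
    ((E.sum F).con g h).Iso ((E.con g h).sum (F.con g h)) :=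
  ⟨{ toFun := fun x => x
     invFun := fun x => x
     map_add' := fun _ _ => rfl
     map_smul' := fun _ _ => rfl
     left_inv := fun _ => rfl
     right_inv := fun _ => rfl }, fun _ _ => rfl⟩

/-! #### Induction -/

section Ind

variable {L H : Subgroup G} (hLH : L ≤ H) (E : EqMod.{u, v, u} α L)

/-- The space of functions `φ : H → E` with `φ (x l) = l⁻¹ φ(x)` for `l ∈ L`, `x ∈ H`. -/
def indSpace : Submodule ℂ (H → E.carrier) where
  carrier := {φ | ∀ (x : H) (l : L), φ (x * Subgroup.inclusion hLH l) = E.ρ l⁻¹ (φ x)}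
  add_mem' ha hb x l := by simp only [Pi.add_apply, map_add, ha x l, hb x l]
  zero_mem' x l := by simp
  smul_mem' c φ hφ x l := by simp only [Pi.smul_apply, map_smul, hφ x l]

variable {hLH E}

theorem indSpace_apply (φ : indSpace hLH E) (x : H) (l : L) :
    φ.1 (x * Subgroup.inclusion hLH l) = E.ρ l⁻¹ (φ.1 x) := φ.2 x l

/-- The right `A`-action `(φ a)(x) = φ(x) (x⁻¹ a)` on the induced module. -/
instance : Module Aᵐᵒᵖ (indSpace hLH E) where
  smul a φ := ⟨fun x => op (α (x : G)⁻¹ (unop a)) • φ.1 x, fun x l => by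
    change op (α ((x : G) * l)⁻¹ (unop a)) • φ.1 (x * Subgroup.inclusion hLH l) =
      E.ρ l⁻¹ (op (α (x : G)⁻¹ (unop a)) • φ.1 x)
    rw [indSpace_apply, E.ρ_smul, mul_inv_rev, map_mul, StarAlgEquiv.mul_apply]
    rfl⟩
  one_smul φ := Subtype.ext <| funext fun x => by
    change op (α (x : G)⁻¹ 1) • φ.1 x = φ.1 x
    rw [map_one, MulOpposite.op_one, one_smul]
  mul_smul a b φ := Subtype.ext <| funext fun x => by
    change op (α (x : G)⁻¹ (unop b * unop a)) • φ.1 x = op _ • op _ • φ.1 x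
    rw [map_mul, MulOpposite.op_mul, mul_smul]
  smul_zero a := Subtype.ext <| funext fun x => smul_zero _
  smul_add a φ ψ := Subtype.ext <| funext fun x => smul_add _ _ _
  add_smul a b φ := Subtype.ext <| funext fun x => by
    change op (α (x : G)⁻¹ (unop a + unop b)) • φ.1 x = op _ • φ.1 x + op _ • φ.1 x
    rw [map_add, MulOpposite.op_add, add_smul]
  zero_smul φ := Subtype.ext <| funext fun x => by
    change op (α (x : G)⁻¹ 0) • φ.1 x = 0
    rw [map_zero, MulOpposite.op_zero, zero_smul]

theorem indSpace_smul (a : A) (φ : indSpace hLH E) (x : H) :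
    (op a • φ).1 x = op (α (x : G)⁻¹ a) • φ.1 x := rfl

instance : IsScalarTower ℂ Aᵐᵒᵖ (indSpace hLH E) where
  smul_assoc c a φ := Subtype.ext <| funext fun x => by
    change op (α (x : G)⁻¹ (c • unop a)) • φ.1 x = c • (op (α (x : G)⁻¹ (unop a)) • φ.1 x)
    rw [map_smul, MulOpposite.op_smul, smul_assoc]

variable (hLH E) in
/-- A function in the induced module is determined by its values on coset representatives. -/
theorem indSpace_equiv : Nonempty (indSpace hLH E ≃ₗ[Aᵐᵒᵖ]
    ∀ c : H ⧸ L.subgroupOf H, Twist α (c.out : G) E.carrier) := by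
  let f : indSpace hLH E →ₗ[Aᵐᵒᵖ] ∀ c : H ⧸ L.subgroupOf H, Twist α (c.out : G) E.carrier :=
    { toFun := fun φ c => φ.1 c.out
      map_add' := fun _ _ => rfl
      map_smul' := fun _ _ => rfl }
  have key : ∀ x : H, ∃ l : L, x = (x : H ⧸ L.subgroupOf H).out * Subgroup.inclusion hLH l := by
    intro x
    have h : ((x : H ⧸ L.subgroupOf H).out)⁻¹ * x ∈ L.subgroupOf H :=
      QuotientGroup.leftRel_apply.1 (Quotient.exact (QuotientGroup.out_eq' _))
    exact ⟨⟨_, h⟩, Subtype.ext (by simp)⟩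
  choose l hl using key
  refine ⟨LinearEquiv.ofBijective f ⟨?_, ?_⟩⟩
  · intro φ ψ h
    refine Subtype.ext (funext fun x => ?_)
    rw [hl x, indSpace_apply, indSpace_apply]
    exact congrArg _ (congrFun h (x : H ⧸ L.subgroupOf H))
  · intro ψ
    have hmul : ∀ (x : H) (k : L), l (x * Subgroup.inclusion hLH k) = l x * k := by
      intro x k
      have hq : ((x * Subgroup.inclusion hLH k : H) : H ⧸ L.subgroupOf H) = x :=
        QuotientGroup.mk_mul_of_mem x k.2
      have h1 := hl (x * Subgroup.inclusion hLH k)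
      rw [hq] at h1
      nth_rewrite 1 [hl x] at h1
      rw [mul_assoc] at h1
      exact (Subgroup.inclusion_injective hLH (by rw [map_mul]; exact mul_left_cancel h1)).symm
    refine ⟨⟨fun x => E.ρ (l x)⁻¹ (ψ (x : H ⧸ L.subgroupOf H)), fun x k => ?_⟩, ?_⟩
    · have hq : ((x * Subgroup.inclusion hLH k : H) : H ⧸ L.subgroupOf H) = x :=
        QuotientGroup.mk_mul_of_mem x k.2
      let ψ' : H ⧸ L.subgroupOf H → E.carrier := ψ
      change E.ρ (l (x * Subgroup.inclusion hLH k))⁻¹ (ψ' _) = E.ρ k⁻¹ (E.ρ (l x)⁻¹ (ψ' _))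
      rw [hmul, hq, mul_inv_rev, map_mul]
      rfl
    · funext c
      have hc : (c.out : H ⧸ L.subgroupOf H) = c := QuotientGroup.out_eq' c
      have h1 := hl c.out
      rw [hc] at h1
      have h2 : l c.out = 1 := Subgroup.inclusion_injective hLH (by
        rw [map_one]
        exact mul_left_cancel (h1.symm.trans (mul_one _).symm))
      let ψ' : H ⧸ L.subgroupOf H → E.carrier := ψ
      change E.ρ (l c.out)⁻¹ (ψ' (c.out : H ⧸ L.subgroupOf H)) = ψ' c
      rw [h2, hc, inv_one, map_one]
      rfl

variable [Finite G]

instance : Module.Finite Aᵐᵒᵖ (indSpace hLH E) := by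
  obtain ⟨e⟩ := indSpace_equiv hLH E
  exact Module.Finite.equiv e.symm

instance : Module.Projective Aᵐᵒᵖ (indSpace hLH E) := by
  classical
  obtain ⟨e⟩ := indSpace_equiv hLH E
  have := Fintype.ofFinite (H ⧸ L.subgroupOf H)
  exact Module.Projective.of_equiv' ((DFinsupp.linearEquivFunOnFintype (R := Aᵐᵒᵖ)).trans e.symm)

variable (hLH E) in
/-- The induced module `Ind_L^H E`, with the action `(h φ)(x) = φ(h⁻¹ x)` of `H`. -/
def ind : EqMod.{u, v, u} α H where
  carrier := indSpace hLH E
  ρ :=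
    { toFun := fun h =>
        { toFun := fun φ => ⟨fun x => φ.1 (h⁻¹ * x), fun x l => by
            exact (congrArg φ.1 (mul_assoc h⁻¹ x _).symm).trans (φ.2 (h⁻¹ * x) l)⟩
          map_add' := fun _ _ => rfl
          map_smul' := fun _ _ => rfl }
      map_one' := LinearMap.ext fun φ => Subtype.ext <| funext fun x => by
        change φ.1 (1⁻¹ * x) = φ.1 x
        rw [inv_one, one_mul]
      map_mul' := fun h k => LinearMap.ext fun φ => Subtype.ext <| funext fun x => by
        change φ.1 ((h * k)⁻¹ * x) = φ.1 (k⁻¹ * (h⁻¹ * x))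
        rw [mul_inv_rev, mul_assoc] }
  ρ_smul h a φ := Subtype.ext <| funext fun x => by
    change op (α ((h : G)⁻¹ * x)⁻¹ a) • φ.1 (h⁻¹ * x) =
      op (α (x : G)⁻¹ (α h a)) • φ.1 (h⁻¹ * x)
    rw [mul_inv_rev, inv_inv, map_mul, StarAlgEquiv.mul_apply]

theorem ind_congr {E F : EqMod.{u, v, u} α L} :
    E.Iso F → (E.ind hLH).Iso (F.ind hLH) := fun ⟨e, he⟩ =>
  ⟨{ toFun := fun φ => ⟨fun x => e (φ.1 x), fun x l => (congrArg e (φ.2 x l)).trans (he _ _)⟩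
     invFun := fun φ => ⟨fun x => e.symm (φ.1 x), fun x l =>
      (congrArg e.symm (φ.2 x l)).trans (by
        rw [LinearEquiv.symm_apply_eq, he, LinearEquiv.apply_symm_apply])⟩
     map_add' := fun φ ψ => Subtype.ext <| funext fun x => e.map_add _ _
     map_smul' := fun a φ => Subtype.ext <| funext fun x => e.map_smul _ _
     left_inv := fun φ => Subtype.ext <| funext fun x => e.symm_apply_apply _
     right_inv := fun φ => Subtype.ext <| funext fun x => e.apply_symm_apply _ },
   fun _ _ => rfl⟩

theorem ind_sum (E F : EqMod.{u, v, u} α L) :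
    ((E.sum F).ind hLH).Iso ((E.ind hLH).sum (F.ind hLH)) :=
  ⟨{ toFun := fun φ => (⟨fun x => (φ.1 x).1, fun x l => congrArg Prod.fst (φ.2 x l)⟩,
       ⟨fun x => (φ.1 x).2, fun x l => congrArg Prod.snd (φ.2 x l)⟩)
     invFun := fun φ => ⟨fun x => (φ.1.1 x, φ.2.1 x), fun x l =>
       Prod.ext (φ.1.2 x l) (φ.2.2 x l)⟩
     map_add' := fun _ _ => rfl
     map_smul' := fun _ _ => rfl
     left_inv := fun _ => rfl
     right_inv := fun _ => rfl }, fun _ _ => rfl⟩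

end Ind

/-! #### Tensor products with representations -/

theorem tensor_finite (V : Type u) [AddCommGroup V] [Module ℂ V] [Module.Finite ℂ V] (E : Type w)
    [AddCommGroup E] [Module ℂ E] [Module Aᵐᵒᵖ E] [IsScalarTower ℂ Aᵐᵒᵖ E] [Module.Finite Aᵐᵒᵖ E] :
    Module.Finite Aᵐᵒᵖ (E ⊗[ℂ] V) := by
  let b := Module.finBasis ℂ V
  let f : (Fin (Module.finrank ℂ V) → E) →ₗ[Aᵐᵒᵖ] E ⊗[ℂ] V :=
    { toFun := fun x => ∑ i, x i ⊗ₜ[ℂ] b i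
      map_add' := fun x y => by simp [TensorProduct.add_tmul, Finset.sum_add_distrib]
      map_smul' := fun a x => by simp [Finset.smul_sum, TensorProduct.smul_tmul'] }
  refine Module.Finite.of_surjective f fun t => ?_
  induction t with
  | zero => exact ⟨0, map_zero f⟩
  | add x y hx hy =>
    obtain ⟨x, rfl⟩ := hx
    obtain ⟨y, rfl⟩ := hy
    exact ⟨x + y, map_add f x y⟩
  | tmul x y =>
    refine ⟨fun i => b.repr y i • x, ?_⟩
    change ∑ i, (b.repr y i • x) ⊗ₜ[ℂ] b i = x ⊗ₜ[ℂ] y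
    simp_rw [TensorProduct.smul_tmul, ← TensorProduct.tmul_sum, b.sum_repr]

/-- The `(H, A)`-module `V ⊗ E` (written with the factors in the order `E ⊗ V`), with the diagonal
action of `H` and the right `A`-action of `E`. -/
def tensor (V : FinRep H) (E : EqMod.{u, v, u} α H) : EqMod.{u, v, u} α H where
  carrier := E.carrier ⊗[ℂ] V.carrier
  finite := tensor_finite V.carrier E.carrier
  ρ := E.ρ.tprod V.ρ
  ρ_smul h a x := by
    induction x with
    | zero => simp
    | add x y hx hy => simp only [map_add, smul_add, hx, hy]
    | tmul x y =>
      change E.ρ h (op a • x) ⊗ₜ[ℂ] V.ρ h y = (op (α h a) • E.ρ h x) ⊗ₜ[ℂ] V.ρ h y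
      rw [E.ρ_smul]

theorem tensor_iso_of {V : FinRep H} {E F : EqMod.{u, v, u} α H}
    (e : E.carrier ⊗[ℂ] V.carrier ≃ₗ[Aᵐᵒᵖ] F.carrier)
    (he : ∀ h x y, e (E.ρ h x ⊗ₜ V.ρ h y) = F.ρ h (e (x ⊗ₜ y))) : (tensor V E).Iso F :=
  ⟨e, fun h => LinearMap.congr_fun (f := e.toLinearMap.restrictScalars ℂ ∘ₗ (tensor V E).ρ h)
    (g := F.ρ h ∘ₗ e.toLinearMap.restrictScalars ℂ) (TensorProduct.ext' (he h))⟩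

theorem tensor_congr {V V' : FinRep H} {E E' : EqMod.{u, v, u} α H} (hV : V.Iso V')
    (hE : E.Iso E') : (tensor V E).Iso (tensor V' E') := by
  obtain ⟨e, he⟩ := hE
  obtain ⟨f, hf⟩ := hV.exists
  exact tensor_iso_of (F := tensor V' E') (TensorProduct.AlgebraTensorModule.congr e f)
    fun h x y => congrArg₂ (fun a b => a ⊗ₜ[ℂ] b) (he h x) (hf h y)

theorem tensor_sum_left (V V' : FinRep H) (E : EqMod.{u, v, u} α H) :
    (tensor (V.sum V') E).Iso ((tensor V E).sum (tensor V' E)) :=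
  tensor_iso_of (V := V.sum V') (F := (tensor V E).sum (tensor V' E))
    (TensorProduct.prodRight ℂ Aᵐᵒᵖ E.carrier V.carrier V'.carrier) fun _ _ _ => rfl

theorem tensor_sum_right (V : FinRep H) (E F : EqMod.{u, v, u} α H) :
    (tensor V (E.sum F)).Iso ((tensor V E).sum (tensor V F)) :=
  tensor_iso_of (E := E.sum F) (F := (tensor V E).sum (tensor V F))
    (TensorProduct.prodLeft ℂ Aᵐᵒᵖ E.carrier F.carrier V.carrier) fun _ _ _ => rfl

/-! #### Extension of scalars -/

section BaseChange

variable {B : Type v'} [CStarAlgebra B] {β : G →* (B ≃⋆ₐ[ℂ] B)} (f : A →⋆ₐ[ℂ] B)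

section Module

variable (E : Type w) [AddCommGroup E] [Module ℂ E] [Module Aᵐᵒᵖ E]

/-- The relations `f(a) b ⊗ x = b ⊗ x a` imposed on `B ⊗_ℂ E`. -/
def scalarRel : Submodule Bᵐᵒᵖ (B ⊗[ℂ] E) :=
  Submodule.span Bᵐᵒᵖ
    {t | ∃ (a : A) (b : B) (x : E), t = (f a * b) ⊗ₜ[ℂ] x - b ⊗ₜ[ℂ] (op a • x)}

/-- The right `B`-module `E ⊗_A B` (written with the factors in the order `B ⊗ E`): the quotient of
`B ⊗_ℂ E` by the relations `f(a) b ⊗ x = b ⊗ x a`. -/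
def ScalarExt : Type (max v' w) := (B ⊗[ℂ] E) ⧸ scalarRel f E

instance : AddCommGroup (ScalarExt f E) := inferInstanceAs (AddCommGroup ((B ⊗[ℂ] E) ⧸ scalarRel f E))
instance : Module ℂ (ScalarExt f E) := inferInstanceAs (Module ℂ ((B ⊗[ℂ] E) ⧸ scalarRel f E))
instance : Module Bᵐᵒᵖ (ScalarExt f E) :=
  inferInstanceAs (Module Bᵐᵒᵖ ((B ⊗[ℂ] E) ⧸ scalarRel f E))
instance : IsScalarTower ℂ Bᵐᵒᵖ (ScalarExt f E) :=
  inferInstanceAs (IsScalarTower ℂ Bᵐᵒᵖ ((B ⊗[ℂ] E) ⧸ scalarRel f E))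

variable {E}

/-- The canonical map `E → E ⊗_A B`, `x ↦ x ⊗ 1`. -/
def extMk : E →ₗ[ℂ] ScalarExt f E :=
  ((scalarRel f E).mkQ.restrictScalars ℂ) ∘ₗ TensorProduct.mk ℂ B E 1

theorem mkQ_tmul (b : B) (x : E) :
    (scalarRel f E).mkQ (b ⊗ₜ[ℂ] x) = (op b • extMk f x : ScalarExt f E) := by
  change _ = (scalarRel f E).mkQ (op b • ((1 : B) ⊗ₜ[ℂ] x))
  rw [TensorProduct.smul_tmul', MulOpposite.smul_eq_mul_unop, one_mul, MulOpposite.unop_op]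

theorem extMk_smul (a : A) (x : E) : extMk f (op a • x) = op (f a) • extMk f x := by
  rw [← mkQ_tmul]
  refine ((Submodule.Quotient.eq (scalarRel f E)).2 ?_).symm
  exact Submodule.subset_span ⟨a, 1, x, by rw [mul_one]; rfl⟩

theorem ext_induction {p : ScalarExt f E → Prop} (zero : p 0)
    (add : ∀ s t, p s → p t → p (s + t)) (mk : ∀ (b : B) (x : E), p (op b • extMk f x)) (t) : p t := by
  obtain ⟨t, rfl⟩ := (scalarRel f E).mkQ_surjective t
  induction t with
  | zero => rw [map_zero]; exact zero
  | add x y hx hy => rw [map_add]; exact add _ _ hx hy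
  | tmul b x => rw [mkQ_tmul]; exact mk b x

theorem ext_hom_ext {T : Type w'} [AddCommGroup T] [Module Bᵐᵒᵖ T]
    {φ ψ : ScalarExt f E →ₗ[Bᵐᵒᵖ] T} (h : ∀ x, φ (extMk f x) = ψ (extMk f x)) : φ = ψ := by
  refine LinearMap.ext fun t => ?_
  induction t using ext_induction with
  | zero => simp
  | add s t hs ht => rw [map_add, map_add, hs, ht]
  | mk b x => rw [map_smul, map_smul, h]

/-- The universal property of extension of scalars. -/
def extLift {T : Type w'} [AddCommGroup T] [Module ℂ T] [Module Bᵐᵒᵖ T] [IsScalarTower ℂ Bᵐᵒᵖ T]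
    (φ : E →ₗ[ℂ] T) (hφ : ∀ (a : A) x, φ (op a • x) = op (f a) • φ x) :
    ScalarExt f E →ₗ[Bᵐᵒᵖ] T :=
  (scalarRel f E).liftQ
    (let F : B ⊗[ℂ] E →ₗ[ℂ] T := TensorProduct.lift
      { toFun := fun b => (op b : Bᵐᵒᵖ) • φ
        map_add' := fun b c => by rw [MulOpposite.op_add, add_smul]
        map_smul' := fun c b => by rw [MulOpposite.op_smul, smul_assoc]; rfl }
    { F with
      map_smul' := fun b t => by
        change F (b • t) = b • F t
        induction t with
        | zero => simp
        | add x y hx hy => simp only [smul_add, map_add, hx, hy]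
        | tmul c x =>
          obtain ⟨b, rfl⟩ := MulOpposite.op_surjective b
          change op (c * b) • φ x = op b • op c • φ x
          rw [MulOpposite.op_mul, mul_smul] })
    (Submodule.span_le.2 (by
      rintro _ ⟨a, b, x, rfl⟩
      rw [SetLike.mem_coe, LinearMap.mem_ker, map_sub, sub_eq_zero]
      change op (f a * b) • φ x = op b • φ (op a • x)
      rw [hφ, MulOpposite.op_mul, mul_smul]))

theorem extLift_mk {T : Type w'} [AddCommGroup T] [Module ℂ T] [Module Bᵐᵒᵖ T]
    [IsScalarTower ℂ Bᵐᵒᵖ T] (φ : E →ₗ[ℂ] T) (hφ : ∀ (a : A) x, φ (op a • x) = op (f a) • φ x)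
    (x : E) : extLift f φ hφ (extMk f x) = φ x := by
  change op (1 : B) • φ x = φ x
  rw [MulOpposite.op_one, one_smul]

theorem ext_finite [Module.Finite Aᵐᵒᵖ E] : Module.Finite Bᵐᵒᵖ (ScalarExt f E) := by
  obtain ⟨s, hs⟩ := Module.Finite.fg_top (R := Aᵐᵒᵖ) (M := E)
  classical
  refine ⟨⟨s.image (extMk f), eq_top_iff.2 ?_⟩⟩
  have key : ∀ x : E, extMk f x ∈
      Submodule.span Bᵐᵒᵖ ((s.image (extMk f) : Finset (ScalarExt f E)) : Set (ScalarExt f E)) := by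
    intro x
    have hx : x ∈ Submodule.span Aᵐᵒᵖ (s : Set E) := hs ▸ Submodule.mem_top
    induction hx using Submodule.span_induction with
    | mem x hx => exact Submodule.subset_span (Finset.mem_image_of_mem _ hx)
    | zero => rw [map_zero]; exact Submodule.zero_mem _
    | add x y _ _ hx hy => rw [map_add]; exact Submodule.add_mem _ hx hy
    | smul a x _ hx =>
      obtain ⟨a, rfl⟩ := MulOpposite.op_surjective a
      rw [extMk_smul]
      exact Submodule.smul_mem _ _ hx
  intro t _
  induction t using ext_induction with
  | zero => exact Submodule.zero_mem _
  | add s t hs ht => exact Submodule.add_mem _ (hs trivial) (ht trivial)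
  | mk b x => exact Submodule.smul_mem _ _ (key x)

theorem ext_projective [IsScalarTower ℂ Aᵐᵒᵖ E] [Module.Projective Aᵐᵒᵖ E] :
    Module.Projective Bᵐᵒᵖ (ScalarExt f E) := by
  refine Module.Projective.of_lifting_property'' fun p hp => ?_
  let fop : Aᵐᵒᵖ →+* Bᵐᵒᵖ := RingHom.op (f : A →+* B)
  let i1 : Module Aᵐᵒᵖ (ScalarExt f E) := Module.compHom _ fop
  let i2 : Module Aᵐᵒᵖ (ScalarExt f E →₀ Bᵐᵒᵖ) := Module.compHom _ fop
  let p' : (ScalarExt f E →₀ Bᵐᵒᵖ) →ₗ[Aᵐᵒᵖ] ScalarExt f E :=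
    { toFun := p
      map_add' := p.map_add
      map_smul' := fun a t => p.map_smul (fop a) t }
  let g : E →ₗ[Aᵐᵒᵖ] ScalarExt f E :=
    { toFun := extMk f
      map_add' := (extMk f).map_add
      map_smul' := fun a x => extMk_smul f (unop a) x }
  obtain ⟨h, hh⟩ := Module.projective_lifting_property p' g hp
  have hA : ∀ (a : A) x, h (op a • x) = op (f a) • h x := fun a x => h.map_smul (op a) x
  let φ : E →ₗ[ℂ] (ScalarExt f E →₀ Bᵐᵒᵖ) :=
    { toFun := h
      map_add' := h.map_add
      map_smul' := fun c x => by
        have h1 := hA (c • 1) x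
        rw [MulOpposite.op_smul, smul_assoc, MulOpposite.op_one, one_smul, map_smul f, map_one f,
          MulOpposite.op_smul, smul_assoc, MulOpposite.op_one, one_smul] at h1
        exact h1 }
  refine ⟨extLift f φ hA, ext_hom_ext f fun x => ?_⟩
  rw [LinearMap.comp_apply, extLift_mk]
  exact LinearMap.congr_fun hh x

end Module

variable (hf : ∀ g a, f (α g a) = β g (f a))

/-- The action of `h ∈ H` on `E ⊗_A B`: `h (x ⊗ b) = h x ⊗ h b`. -/
def extAct (E : EqMod.{u, v, u} α H) (h : H) : ScalarExt f E.carrier →ₗ[ℂ] ScalarExt f E.carrier :=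
  (toTwist β (h : G)⁻¹ (ScalarExt f E.carrier)).symm.toLinearMap ∘ₗ
    (extLift f ((toTwist β (h : G)⁻¹ (ScalarExt f E.carrier)).toLinearMap ∘ₗ extMk f ∘ₗ E.ρ h)
      (fun a x => by
        simp only [LinearMap.comp_apply, LinearEquiv.coe_coe]
        rw [smul_toTwist, E.ρ_smul, extMk_smul, inv_inv, hf])).restrictScalars ℂ

theorem extAct_apply (E : EqMod.{u, v, u} α H) (h : H) (b : B) (x : E.carrier) :
    extAct f hf E h (op b • extMk f x) = op (β h b) • extMk f (E.ρ h x) := by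
  simp only [extAct, LinearMap.comp_apply, LinearEquiv.coe_coe, LinearMap.restrictScalars_apply]
  rw [map_smul, extLift_mk]
  simp only [LinearMap.comp_apply, LinearEquiv.coe_coe]
  rw [smul_toTwist, LinearEquiv.symm_apply_apply, inv_inv]

/-- Extension of scalars of an `(H, A)`-module along a unital `G`-equivariant `*`-homomorphism
`f : A → B`: the module `E ⊗_A B` with the action `h (x ⊗ b) = h x ⊗ h b`. -/
def ext (E : EqMod.{u, v, u} α H) : EqMod.{u, v', max v' u} β H where
  carrier := ScalarExt f E.carrier
  finite := ext_finite f
  projective := ext_projective f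
  ρ :=
    { toFun := extAct f hf E
      map_one' := LinearMap.ext fun t => by
        induction t using ext_induction with
        | zero => simp
        | add s t hs ht => rw [map_add, map_add, hs, ht]
        | mk b x =>
          rw [extAct_apply]
          simp
      map_mul' := fun h k => LinearMap.ext fun t => by
        induction t using ext_induction with
        | zero => simp
        | add s t hs ht => rw [map_add, map_add, hs, ht]
        | mk b x =>
          rw [Module.End.mul_apply, extAct_apply, extAct_apply, extAct_apply]
          simp }
  ρ_smul h b t := by
    change extAct f hf E h (op b • t) = op (β h b) • extAct f hf E h t
    induction t using ext_induction with
    | zero => simp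
    | add s t hs ht => rw [smul_add, map_add, map_add, smul_add, hs, ht]
    | mk c x =>
      rw [← mul_smul, ← MulOpposite.op_mul, extAct_apply, extAct_apply, ← mul_smul,
        ← MulOpposite.op_mul, map_mul]

/-- An isomorphism out of an extension of scalars, from its values on `x ⊗ 1`. -/
theorem ext_iso_of {E : EqMod.{u, v, u} α H} {F : EqMod.{u, v', max v' u} β H}
    (e : ScalarExt f E.carrier ≃ₗ[Bᵐᵒᵖ] F.carrier)
    (he : ∀ h x, e (extMk f (E.ρ h x)) = F.ρ h (e (extMk f x))) : (ext f hf E).Iso F := by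
  refine ⟨e, fun h t => ?_⟩
  have key : ∀ t : ScalarExt f E.carrier, e (extAct f hf E h t) = F.ρ h (e t) := fun t => by
    induction t using ext_induction with
    | zero => rw [map_zero, map_zero, map_zero]
    | add s t hs ht => rw [map_add, map_add, map_add, map_add, hs, ht]
    | mk b x => rw [extAct_apply, map_smul, he, map_smul, F.ρ_smul]
  exact key t

theorem ext_congr {E F : EqMod.{u, v, u} α H} : E.Iso F → (ext f hf E).Iso (ext f hf F) :=
  fun ⟨e, he⟩ => by
    have hc : ∀ (E F : EqMod.{u, v, u} α H) (e : E.carrier ≃ₗ[Aᵐᵒᵖ] F.carrier) (c : ℂ) x,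
        e (c • x) = c • e x := fun E F e c x => by
      have h1 := e.map_smul (c • 1) x
      rwa [smul_assoc, smul_assoc, one_smul, one_smul] at h1
    let φ : E.carrier →ₗ[ℂ] ScalarExt f F.carrier := extMk f ∘ₗ
      { toFun := e, map_add' := e.map_add, map_smul' := hc E F e }
    let ψ : F.carrier →ₗ[ℂ] ScalarExt f E.carrier := extMk f ∘ₗ
      { toFun := e.symm, map_add' := e.symm.map_add, map_smul' := hc F E e.symm }
    have hφ : ∀ x, φ x = extMk f (e x) := fun _ => rfl
    have hψ : ∀ x, ψ x = extMk f (e.symm x) := fun _ => rfl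
    have hφ' : ∀ (a : A) x, φ (op a • x) = op (f a) • φ x := fun a x => by
      rw [hφ, hφ, map_smul, extMk_smul]
    have hψ' : ∀ (a : A) x, ψ (op a • x) = op (f a) • ψ x := fun a x => by
      rw [hψ, hψ, map_smul, extMk_smul]
    let Φ := extLift f φ hφ'
    let Ψ := extLift f ψ hψ'
    have hΦ : ∀ x, Φ (extMk f x) = extMk f (e x) := extLift_mk f φ hφ'
    have hΨ : ∀ x, Ψ (extMk f x) = extMk f (e.symm x) := extLift_mk f ψ hψ'
    have h1 : Φ ∘ₗ Ψ = LinearMap.id := ext_hom_ext f fun x => by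
      rw [LinearMap.comp_apply, hΨ, hΦ, LinearEquiv.apply_symm_apply, LinearMap.id_apply]
    have h2 : Ψ ∘ₗ Φ = LinearMap.id := ext_hom_ext f fun x => by
      rw [LinearMap.comp_apply, hΦ, hΨ, LinearEquiv.symm_apply_apply, LinearMap.id_apply]
    refine ext_iso_of f hf (F := ext f hf F) (LinearEquiv.ofLinearMap Φ Ψ h1 h2) fun h x => ?_
    have h3 := extAct_apply f hf F h 1 (e x)
    rw [map_one, MulOpposite.op_one, one_smul, one_smul] at h3
    have h4 : Φ (extMk f (E.ρ h x)) = extAct f hf F h (Φ (extMk f x)) := by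
      rw [hΦ, hΦ, h3]
      exact congrArg (extMk f) (he h x)
    exact h4

theorem ext_sum (E F : EqMod.{u, v, u} α H) :
    (ext f hf (E.sum F)).Iso ((ext f hf E).sum (ext f hf F)) := by
  let p : E.carrier × F.carrier →ₗ[ℂ] ScalarExt f E.carrier × ScalarExt f F.carrier :=
    (extMk f).prodMap (extMk f)
  let i : E.carrier →ₗ[ℂ] ScalarExt f (E.carrier × F.carrier) :=
    extMk f ∘ₗ LinearMap.inl ℂ E.carrier F.carrier
  let j : F.carrier →ₗ[ℂ] ScalarExt f (E.carrier × F.carrier) :=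
    extMk f ∘ₗ LinearMap.inr ℂ E.carrier F.carrier
  have hp : ∀ x, p x = (extMk f x.1, extMk f x.2) := fun _ => rfl
  have hi : ∀ x, i x = extMk f (x, 0) := fun _ => rfl
  have hj : ∀ x, j x = extMk f (0, x) := fun _ => rfl
  have hp' : ∀ (a : A) x, p (op a • x) = op (f a) • p x := fun a x => by
    rw [hp, hp, Prod.smul_fst, Prod.smul_snd, extMk_smul, extMk_smul, Prod.smul_mk]
  have hi' : ∀ (a : A) x, i (op a • x) = op (f a) • i x := fun a x => by
    rw [hi, hi, ← extMk_smul, Prod.smul_mk, smul_zero]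
  have hj' : ∀ (a : A) x, j (op a • x) = op (f a) • j x := fun a x => by
    rw [hj, hj, ← extMk_smul, Prod.smul_mk, smul_zero]
  let P := extLift f p hp'
  let I := extLift f i hi'
  let J := extLift f j hj'
  have hP : ∀ x, P (extMk f x) = (extMk f x.1, extMk f x.2) := extLift_mk f p hp'
  have hI : ∀ x, I (extMk f x) = extMk f (x, 0) := extLift_mk f i hi'
  have hJ : ∀ x, J (extMk f x) = extMk f (0, x) := extLift_mk f j hj'
  have h1 : P ∘ₗ I.coprod J = LinearMap.id := by
    refine LinearMap.prod_ext (ext_hom_ext f fun x => ?_) (ext_hom_ext f fun x => ?_)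
    · simp [hP, hI]
    · simp [hP, hJ]
  have h2 : I.coprod J ∘ₗ P = LinearMap.id := ext_hom_ext f fun x => by
    simp [hP, hI, hJ, ← map_add]
  refine ext_iso_of f hf (E := E.sum F) (F := (ext f hf E).sum (ext f hf F))
    (LinearEquiv.ofLinearMap P (I.coprod J) h1 h2) fun h (x : E.carrier × F.carrier) => ?_
  have h3 := extAct_apply f hf E h 1 x.1
  have h4 := extAct_apply f hf F h 1 x.2
  rw [map_one, MulOpposite.op_one, one_smul, one_smul] at h3 h4
  have h5 : P (extMk f (E.ρ h x.1, F.ρ h x.2)) =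
      (extAct f hf E h (P (extMk f x)).1, extAct f hf F h (P (extMk f x)).2) := by
    rw [hP, hP, h3, h4]
  exact h5

end BaseChange

/-! #### Representations as `(H, ℂ)`-modules -/

/-- A representation of `H`, as an `(H, ℂ)`-module for the trivial action on `ℂ`. -/
def ofRep (V : FinRep H) : EqMod.{u, 0, u} (1 : G →* (ℂ ≃⋆ₐ[ℂ] ℂ)) H :=
  letI : Module ℂᵐᵒᵖ V.carrier :=
    Module.compHom V.carrier ((RingHom.id ℂ).fromOpposite fun x y => mul_comm x y)
  { carrier := V.carrier
    tower := ⟨fun c a x => mul_smul c (unop a) x⟩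
    finite := by
      obtain ⟨s, hs⟩ := Module.Finite.fg_top (R := ℂ) (M := V.carrier)
      refine ⟨⟨s, eq_top_iff.2 fun x _ => ?_⟩⟩
      have hx : x ∈ Submodule.span ℂ (s : Set V.carrier) := hs ▸ Submodule.mem_top
      induction hx using Submodule.span_induction with
      | mem x hx => exact Submodule.subset_span hx
      | zero => exact Submodule.zero_mem _
      | add x y _ _ hx hy => exact Submodule.add_mem _ (hx trivial) (hy trivial)
      | smul a x _ hx => exact Submodule.smul_mem _ (op a) (hx trivial)
    ρ := V.ρ
    ρ_smul := fun h a x => (V.ρ h).map_smul a x }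


theorem ofRep_congr {V V' : FinRep H} (h : V.Iso V') : (ofRep (G := G) V).Iso (ofRep V') := by
  obtain ⟨e, he⟩ := h.exists
  exact ⟨{ e with map_smul' := fun a x => e.map_smul (unop a) x }, he⟩

theorem ofRep_sum (V V' : FinRep H) :
    (ofRep (G := G) (V.sum V')).Iso ((ofRep V).sum (ofRep V')) :=
  ⟨{ toFun := fun x => x
     invFun := fun x => x
     map_add' := fun _ _ => rfl
     map_smul' := fun _ _ => rfl
     left_inv := fun _ => rfl
     right_inv := fun _ => rfl }, fun _ _ => rfl⟩

end EqMod

end EqMod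

/-! #### The groups `K̃` and their functorialities -/

section KTilde

variable {G : Type u} [Group G] {A : Type v} [CStarAlgebra A]

/-- `K̃^H(A)`: the Grothendieck group of isomorphism classes of finitely generated projective
`(H, A)`-modules, under direct sum. -/
def KTilde (α : G →* (A ≃⋆ₐ[ℂ] A)) (H : Subgroup G) : Type (max u v (w + 1)) :=
  GroGrp (EqMod.{u, v, w} α H)

namespace KTilde

variable {α : G →* (A ≃⋆ₐ[ℂ] A)} {L H K : Subgroup G}

instance : AddCommGroup (KTilde.{u, v, w} α H) :=
  inferInstanceAs (AddCommGroup (GroGrp (EqMod.{u, v, w} α H)))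

/-- The class of a module. -/
def of (E : EqMod.{u, v, w} α H) : KTilde.{u, v, w} α H := cls E

/-- Restriction `K̃^H(A) → K̃^L(A)`. -/
def res (h : L ≤ H) : KTilde.{u, v, w} α H →+ KTilde.{u, v, w} α L :=
  GroGrp.map (EqMod.res h) (fun _ _ => EqMod.res_congr h)
    (fun E F => EqMod.Iso.refl ((E.sum F).res h))

/-- Induction `K̃^L(A) → K̃^H(A)`. -/
def ind [Finite G] (h : L ≤ H) : KTilde.{u, v, u} α L →+ KTilde.{u, v, u} α H :=
  GroGrp.map (fun E : EqMod.{u, v, u} α L => E.ind h) (fun _ _ => EqMod.ind_congr)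
    (fun E F => EqMod.ind_sum E F)

/-- Conjugation `K̃^H(A) → K̃^{ᵍH}(A)`. -/
def con (g : G) (h : K = conjSub g H) : KTilde.{u, v, w} α H →+ KTilde.{u, v, w} α K :=
  GroGrp.map (EqMod.con g h) (fun _ _ => EqMod.con_congr g h) (EqMod.con_sum g h)

/-- The action `[V] · [E] = [V ⊗ E]` of `R(H)` on `K̃^H(A)`. -/
def act : RepRing H →+ KTilde.{u, v, u} α H →+ KTilde.{u, v, u} α H :=
  GroGrp.map₂ EqMod.tensor (fun _ _ _ _ => EqMod.tensor_congr) EqMod.tensor_sum_left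
    EqMod.tensor_sum_right

/-- Functoriality `[E] ↦ [E ⊗_A B]` along unital equivariant `*`-homomorphisms `f : A → B`. -/
def map {B : Type v'} [CStarAlgebra B] {β : G →* (B ≃⋆ₐ[ℂ] B)} (f : A →⋆ₐ[ℂ] B)
    (hf : ∀ g a, f (α g a) = β g (f a)) (H : Subgroup G) :
    KTilde.{u, v, u} α H →+ KTilde.{u, v', max v' u} β H :=
  GroGrp.map (EqMod.ext f hf) (fun _ _ => EqMod.ext_congr f hf) (EqMod.ext_sum f hf)

variable (G) in
/-- The canonical map `R(H) → K̃^H(ℂ)`, where `G` acts trivially on `ℂ`. -/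
def ofRep (H : Subgroup G) : RepRing H →+ KTilde.{u, 0, u} (1 : G →* (ℂ ≃⋆ₐ[ℂ] ℂ)) H :=
  GroGrp.map EqMod.ofRep (fun _ _ => EqMod.ofRep_congr) EqMod.ofRep_sum

end KTilde

end KTilde

/-! ### `G`-C*-algebras and the groups `K_0^H` -/

/-- `G`-C*-algebras: possibly nonunital complex C*-algebras with an action of `G` by
`*`-automorphisms. -/
structure GCStarAlg (G : Type u) [Group G] where
  carrier : Type u
  [cstar : NonUnitalCStarAlgebra carrier]
  act : G →* (carrier ≃⋆ₐ[ℂ] carrier)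

attribute [instance] GCStarAlg.cstar

namespace GCStarAlg

variable {G : Type u} [Group G]

/-- Morphisms of `G`-C*-algebras: equivariant, not necessarily unital, `*`-homomorphisms. -/
@[ext]
structure Hom (A B : GCStarAlg G) where
  toFun : A.carrier →⋆ₙₐ[ℂ] B.carrier
  equivariant : ∀ g a, toFun (A.act g a) = B.act g (toFun a)

/-- The category of `G`-C*-algebras. -/
instance : Category (GCStarAlg G) where
  Hom := Hom
  id A := ⟨NonUnitalStarAlgHom.id ℂ A.carrier, fun _ _ => rfl⟩
  comp f g := ⟨g.toFun.comp f.toFun, fun x a => by simp [f.equivariant, g.equivariant]⟩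

section Unitization

variable {A B : Type v} [NonUnitalCStarAlgebra A] [NonUnitalCStarAlgebra B]

/-- The `*`-automorphism of the unitization `A⁺` that extends one of `A`. -/
def unitAut (φ : A ≃⋆ₐ[ℂ] A) : Unitization ℂ A ≃⋆ₐ[ℂ] Unitization ℂ A :=
  StarAlgEquiv.ofStarAlgHom
    (Unitization.starMap (φ : A →⋆ₙₐ[ℂ] A)) (Unitization.starMap (φ.symm : A →⋆ₙₐ[ℂ] A))
    (by
      rw [← Unitization.starMap_comp, ← Unitization.starMap_id]
      exact congrArg _ (NonUnitalStarAlgHom.ext φ.symm_apply_apply))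
    (by
      rw [← Unitization.starMap_comp, ← Unitization.starMap_id]
      exact congrArg _ (NonUnitalStarAlgHom.ext φ.apply_symm_apply))

theorem unitAut_apply (φ : A ≃⋆ₐ[ℂ] A) (c : ℂ) (a : A) :
    unitAut φ (.inl c + (a : Unitization ℂ A)) = .inl c + ((φ a : A) : Unitization ℂ A) := by
  change Unitization.starMap (φ : A →⋆ₙₐ[ℂ] A) (.inl c + (a : Unitization ℂ A)) = _
  rw [map_add, Unitization.starMap_inl, Unitization.starMap_inr]
  rfl

/-- The action of `G` on the unitization `A⁺` that extends an action on `A`. -/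
def unitAct (α : G →* (A ≃⋆ₐ[ℂ] A)) : G →* (Unitization ℂ A ≃⋆ₐ[ℂ] Unitization ℂ A) where
  toFun g := unitAut (α g)
  map_one' := StarAlgEquiv.ext fun x => by
    induction x using Unitization.ind (R := ℂ) (A := A) with
    | inl_add_inr c a => rw [unitAut_apply, map_one]; rfl
  map_mul' g h := StarAlgEquiv.ext fun x => by
    induction x using Unitization.ind (R := ℂ) (A := A) with
    | inl_add_inr c a =>
      rw [StarAlgEquiv.mul_apply, unitAut_apply, unitAut_apply, unitAut_apply, map_mul]
      rfl

theorem unitAct_apply (α : G →* (A ≃⋆ₐ[ℂ] A)) (g : G) (c : ℂ) (a : A) :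
    unitAct α g (.inl c + (a : Unitization ℂ A)) = .inl c + ((α g a : A) : Unitization ℂ A) :=
  unitAut_apply (α g) c a

variable (A) in
/-- The augmentation `A⁺ → ℂ`. -/
def aug : Unitization ℂ A →⋆ₐ[ℂ] ℂ :=
  { Unitization.fstHom ℂ A with map_star' := fun _ => rfl }

theorem aug_equivariant (α : G →* (A ≃⋆ₐ[ℂ] A)) (g : G) (x : Unitization ℂ A) :
    aug A (unitAct α g x) = (1 : G →* (ℂ ≃⋆ₐ[ℂ] ℂ)) g (aug A x) := by
  induction x using Unitization.ind (R := ℂ) (A := A) with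
  | inl_add_inr c a =>
    rw [unitAct_apply]
    change (.inl c + ((α g a : A) : Unitization ℂ A) : Unitization ℂ A).fst =
      (.inl c + (a : Unitization ℂ A) : Unitization ℂ A).fst
    simp

theorem starMap_equivariant {α : G →* (A ≃⋆ₐ[ℂ] A)} {β : G →* (B ≃⋆ₐ[ℂ] B)} (f : A →⋆ₙₐ[ℂ] B)
    (hf : ∀ g a, f (α g a) = β g (f a)) (g : G) (x : Unitization ℂ A) :
    Unitization.starMap f (unitAct α g x) = unitAct β g (Unitization.starMap f x) := by
  induction x using Unitization.ind (R := ℂ) (A := A) with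
  | inl_add_inr c a =>
    rw [unitAct_apply, map_add, map_add, Unitization.starMap_inl, Unitization.starMap_inr,
      Unitization.starMap_inr, Unitization.algebraMap_eq_inl, unitAct_apply, hf]

theorem starLift_equivariant {C : Type v'} [CStarAlgebra C] {α : G →* (A ≃⋆ₐ[ℂ] A)}
    {γ : G →* (C ≃⋆ₐ[ℂ] C)} (f : A →⋆ₙₐ[ℂ] C) (hf : ∀ g a, f (α g a) = γ g (f a)) (g : G)
    (x : Unitization ℂ A) :
    Unitization.starLift f (unitAct α g x) = γ g (Unitization.starLift f x) := by
  induction x using Unitization.ind (R := ℂ) (A := A) with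
  | inl_add_inr c a =>
    have h : ∀ b : A, Unitization.starLift f (.inl c + (b : Unitization ℂ A)) =
        algebraMap ℂ C c + f b := fun b => by
      change algebraMap ℂ C (Unitization.inl c + (b : Unitization ℂ A)).fst +
        f (Unitization.inl c + (b : Unitization ℂ A)).snd = _
      simp
    have h1 : γ g (algebraMap ℂ C c) = algebraMap ℂ C c := by
      rw [Algebra.algebraMap_eq_smul_one, map_smul (γ g), map_one]
    rw [unitAct_apply, h, h, map_add, h1, hf]

end Unitization

variable (A : GCStarAlg G) (H : Subgroup G)

/-- `K̃^H(A⁺)`. -/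
abbrev KPlus : Type (u + 1) := KTilde.{u, u, u} (unitAct A.act) H

/-- `K_0^H(A)`, the kernel of the map `K̃^H(A⁺) → K̃^H(ℂ)` induced by the augmentation. -/
def K0 : AddSubgroup (A.KPlus H) :=
  (KTilde.map (aug A.carrier) (aug_equivariant A.act) H).ker

/-- The map `K̃^H(A⁺) → K̃^H(B⁺)` induced by a morphism of `G`-C*-algebras `A → B`. -/
def mapPlus {A B : GCStarAlg G} (f : A ⟶ B) (H : Subgroup G) : A.KPlus H →+ B.KPlus H :=
  KTilde.map (Unitization.starMap f.toFun) (starMap_equivariant f.toFun f.equivariant) H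

/-- A unital C*-algebra with an action of `G`, as a `G`-C*-algebra. -/
def of {B : Type u} [CStarAlgebra B] (β : G →* (B ≃⋆ₐ[ℂ] B)) : GCStarAlg G := ⟨B, β⟩

/-- For unital `B`, the map `K̃^H(B⁺) → K̃^H(B)` induced by the unital `*`-homomorphism `B⁺ → B`
that restricts to the identity on `B`. -/
def counit {B : Type u} [CStarAlgebra B] (β : G →* (B ≃⋆ₐ[ℂ] B)) (H : Subgroup G) :
    (of β).KPlus H →+ KTilde.{u, u, u} β H :=
  KTilde.map (Unitization.starLift (NonUnitalStarAlgHom.id ℂ B))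
    (starLift_equivariant (NonUnitalStarAlgHom.id ℂ B) fun _ _ => rfl) H

/-! The complex numbers, in the universe of `G`. -/

instance : StarRing (ULift.{u} ℂ) where
  star z := ⟨star z.down⟩
  star_involutive z := ULift.ext _ _ (star_star z.down)
  star_mul z w := ULift.ext _ _ (star_mul z.down w.down)
  star_add z w := ULift.ext _ _ (star_add z.down w.down)

instance : CStarAlgebra (ULift.{u} ℂ) where
  norm_mul_self_le z := CStarRing.norm_mul_self_le z.down
  star_smul c z := ULift.ext _ _ (star_smul c z.down)

variable (G) in
/-- The `G`-C*-algebra `ℂ` with the trivial action. -/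
def unit : GCStarAlg.{u} G := of (1 : G →* (ULift.{u} ℂ ≃⋆ₐ[ℂ] ULift.{u} ℂ))

/-- The identification of `ULift ℂ` with `ℂ`. -/
def downHom : ULift.{u} ℂ →⋆ₙₐ[ℂ] ℂ where
  toFun := ULift.down
  map_smul' _ _ := rfl
  map_zero' := rfl
  map_add' _ _ := rfl
  map_mul' _ _ := rfl
  map_star' _ := rfl

variable (G) in
/-- The map `K̃^H(ℂ⁺) → K̃^H(ℂ)` induced by the unital `*`-homomorphism `ℂ⁺ → ℂ` that restricts to
the identity on `ℂ`. -/
def unitCounit (H : Subgroup G) :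
    (unit G).KPlus H →+ KTilde.{u, 0, u} (1 : G →* (ℂ ≃⋆ₐ[ℂ] ℂ)) H :=
  KTilde.map (Unitization.starLift downHom) (starLift_equivariant downHom fun _ _ => rfl) H

end GCStarAlg

end EquivK

end

open CategoryTheory EquivK

/-!
The groups `K̃^H(A)`, for a unital algebra `A`, form a Mackey functor because the relations hold
for modules up to isomorphism. With induced modules realized as spaces of functions on `H`, each
relation is an explicit change of variables; in the Mackey formula (`EqMod.mackey`) a function `φ`
on `H` is cut into its restrictions `l ↦ φ (l x)` to the double cosets `L x K`.

That induction commutes with tensor products and with extension of scalars is seen from an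
intrinsic description of induced modules (`EqMod.Induced`): an `(H, A)`-module `F` is induced from
an `(L, A)`-submodule `E` if it is the direct sum of the translates of `E`. Written with an
inclusion, a projection and identities between them, this description passes through additive
functors, and `EqMod.Induced.iso` then identifies the result with the space of functions. It gives
the naturality of induction (`KTilde.map_ind`) and both Frobenius formulas: `V ⊗ Ind E = Ind (Res
V ⊗ E)` (`KTilde.act_ind`) and `Ind V ⊗ E = Ind (V ⊗ Res E)` (`KTilde.indHom_act`), the latter
because the induced representation `ℂ H ⊗ V` is the direct sum of the translates of `1 ⊗ V`.

The representation ring is `K̃^H(ℂ)` (`KTilde.repEquiv`), compatibly with restriction, conjugation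
and products. Since `Ind V = Ind V ⊗ 1`, the second Frobenius formula shows that the two kinds of
induction agree as well (`KTilde.ofRep_ind`). So `R^G` is a Green functor because `K̃(ℂ)` is a
Mackey functor and satisfies the Frobenius formulas.

For a general algebra, all structure maps are natural along the augmentation `A⁺ → ℂ`, hence they
preserve its kernel `K_0^H(A)`, which inherits the relations from `K̃^H(A⁺)`. If `A` has a unit
`e`, then `A⁺` is the product of `A` and `ℂ (1 - e)`, and a module over a product of algebras is
the direct sum of modules over the factors (`EqMod.iso_sum_inflate`); so the kernel of the
augmentation is `K̃^H(A)` (`bijective_map_starLift`).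
-/

open CategoryTheory
open scoped TensorProduct

noncomputable section

namespace EquivK

open MulOpposite (op unop)

/-! ### Classes of `(H, A)`-modules -/

section Basic

variable {G : Type u} [Group G] {A : Type v} [CStarAlgebra A] {α : G →* (A ≃⋆ₐ[ℂ] A)}
  {L H K : Subgroup G}

theorem EqMod.Iso.of_bijective {E F : EqMod.{u, v, w} α H} (e : E.carrier →ₗ[Aᵐᵒᵖ] F.carrier)
    (he : ∀ h x, e (E.ρ h x) = F.ρ h (e x)) (hb : Function.Bijective e) : E.Iso F :=
  ⟨LinearEquiv.ofBijective e hb, he⟩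

theorem EqMod.Iso.of_inverse {E F : EqMod.{u, v, w} α H} (e : E.carrier →ₗ[Aᵐᵒᵖ] F.carrier)
    (f : F.carrier → E.carrier) (he : ∀ h x, e (E.ρ h x) = F.ρ h (e x))
    (hl : ∀ x, f (e x) = x) (hr : ∀ y, e (f y) = y) : E.Iso F :=
  .of_bijective e he ⟨Function.LeftInverse.injective hl, Function.RightInverse.surjective hr⟩

namespace KTilde

theorem of_eq {E F : EqMod.{u, v, w} α H} (h : E.Iso F) :
    (of E : KTilde.{u, v, w} α H) = of F := cls_eq h

theorem of_sum (E F : EqMod.{u, v, w} α H) :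
    (of (E.sum F) : KTilde.{u, v, w} α H) = of E + of F := cls_sum E F

/-- To prove an additive statement on `K̃^H(A)`, check it on classes of modules. -/
theorem induction {p : KTilde.{u, v, w} α H → Prop} (of : ∀ E, p (of E))
    (sub : ∀ a b, p a → p b → p (a - b)) (a : KTilde.{u, v, w} α H) : p a := by
  obtain ⟨E, F, rfl⟩ := GroGrp.exists_sub a
  exact sub _ _ (of E) (of F)

theorem hom_ext {T : Type w'} [AddCommGroup T] {f g : KTilde.{u, v, w} α H →+ T}
    (h : ∀ E, f (of E) = g (of E)) : f = g := GroGrp.hom_ext h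

theorem of_eq_zero (E : EqMod.{u, v, w} α H) [Subsingleton E.carrier] :
    (of E : KTilde.{u, v, w} α H) = 0 := by
  have h : (of (E.sum E) : KTilde.{u, v, w} α H) = of E :=
    of_eq ⟨{ toFun := fun x => x.1
             invFun := fun x => (x, 0)
             map_add' := fun _ _ => rfl
             map_smul' := fun _ _ => rfl
             left_inv := fun x => Prod.ext rfl (Subsingleton.elim (α := E.carrier) _ _)
             right_inv := fun _ => rfl }, fun _ _ => rfl⟩
  rw [of_sum] at h
  simpa using h

@[simp]
theorem res_of (h : L ≤ H) (E : EqMod.{u, v, w} α H) : res h (of E) = of (E.res h) :=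
  GroGrp.map_cls _ _ _ E

@[simp]
theorem con_of (g : G) (h : K = conjSub g H) (E : EqMod.{u, v, w} α H) :
    con g h (of E) = of (E.con g h) :=
  GroGrp.map_cls _ _ _ E

@[simp]
theorem ind_of [Finite G] (h : L ≤ H) (E : EqMod.{u, v, u} α L) :
    ind h (of E) = of (E.ind h) :=
  GroGrp.map_cls (fun E : EqMod.{u, v, u} α L => E.ind h) _ _ E

@[simp]
theorem act_of (V : FinRep H) (E : EqMod.{u, v, u} α H) :
    act (RepRing.of V) (of E) = of (EqMod.tensor V E) :=
  GroGrp.map₂_cls (EqMod.tensor (α := α)) _ _ _ V E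

@[simp]
theorem map_of {B : Type v'} [CStarAlgebra B] {β : G →* (B ≃⋆ₐ[ℂ] B)} (f : A →⋆ₐ[ℂ] B)
    (hf : ∀ g a, f (α g a) = β g (f a)) (E : EqMod.{u, v, u} α H) :
    map f hf H (of E) = of (E.ext f hf) :=
  GroGrp.map_cls (EqMod.ext f hf) _ _ E

@[simp]
theorem ofRep_of (V : FinRep H) : ofRep G H (RepRing.of V) = of (EqMod.ofRep V) :=
  GroGrp.map_cls (EqMod.ofRep (G := G)) _ _ V

end KTilde

@[simp]
theorem RepRing.compHom_of {H K : Type u} [Group H] [Group K] (φ : K →* H) (V : FinRep H) :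
    RepRing.compHom φ (RepRing.of V) = RepRing.of (V.comp φ) :=
  GroGrp.map_cls (FinRep.comp φ) (fun _ _ => FinRep.comp_congr φ)
    (fun V W => IsoSum.iso_equivalence.refl ((V.sum W).comp φ)) V

@[simp]
theorem RepRing.indHom_of {L H : Type u} [Group L] [Group H] [Finite H] (φ : L →* H)
    (V : FinRep L) : RepRing.indHom φ (RepRing.of V) = RepRing.of (V.ind φ) :=
  GroGrp.map_cls (FinRep.ind φ) _ _ V

/-! #### Finite direct sums -/

/-- The direct sum of the modules `F 0, …, F (n - 1)`. -/
def EqMod.pi {n : ℕ} (F : Fin n → EqMod.{u, v, w} α H) : EqMod.{u, v, w} α H :=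
  have : Module.Projective Aᵐᵒᵖ (∀ i, (F i).carrier) :=
    Module.Projective.of_equiv' (DFinsupp.linearEquivFunOnFintype (R := Aᵐᵒᵖ))
  { carrier := ∀ i, (F i).carrier
    ρ :=
      { toFun := fun h => LinearMap.pi fun i => (F i).ρ h ∘ₗ LinearMap.proj i
        map_one' := LinearMap.ext fun x => funext fun i => by simp
        map_mul' := fun h k => LinearMap.ext fun x => funext fun i => by simp }
    ρ_smul := fun h a x => funext fun i => (F i).ρ_smul h a (x i) }

theorem KTilde.of_pi {n : ℕ} (F : Fin n → EqMod.{u, v, w} α H) :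
    (of (EqMod.pi F) : KTilde.{u, v, w} α H) = ∑ i, of (F i) := by
  induction n with
  | zero =>
    have : Subsingleton (EqMod.pi F).carrier :=
      inferInstanceAs (Subsingleton (∀ i, (F i).carrier))
    simp [of_eq_zero]
  | succ n ih =>
    rw [Fin.sum_univ_succ, ← ih fun i => F i.succ, ← of_sum]
    exact of_eq ⟨{
      toFun := fun x => (x 0, fun i => x i.succ)
      invFun := fun x => Fin.cons (α := fun i => (F i).carrier) x.1 x.2
      map_add' := fun _ _ => rfl
      map_smul' := fun _ _ => rfl
      left_inv := fun x => Fin.cons_self_tail x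
      right_inv := fun _ => rfl }, fun _ _ => rfl⟩

/-- A module with equivariant maps to the members of a finite family that identify it with their
product has the sum of the family as its class. -/
theorem KTilde.of_eq_sum {ι : Type w'} (S : Finset ι) {E : EqMod.{u, v, w} α H}
    (F : ι → EqMod.{u, v, w} α H) (p : ∀ i : S, E.carrier →ₗ[Aᵐᵒᵖ] (F i).carrier)
    (hp : ∀ i h x, p i (E.ρ h x) = (F i).ρ h (p i x))
    (hb : Function.Bijective fun x (i : S) => p i x) :
    (of E : KTilde.{u, v, w} α H) = ∑ i ∈ S, of (F i) := by
  rw [← Finset.sum_coe_sort, ← Equiv.sum_comp S.equivFin.symm, ← of_pi]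
  let r := Equiv.piCongrLeft' (fun i : S => (F i).carrier) S.equivFin
  exact of_eq (.of_bijective (F := EqMod.pi fun i => F (S.equivFin.symm i))
    (LinearMap.pi fun i => p (S.equivFin.symm i)) (fun h x => funext fun i => hp _ h x)
    (r.bijective.comp hb))

end Basic

/-! ### The Mackey relations for `K̃` -/

namespace EqMod

variable {G : Type u} [Group G] {A : Type v} [CStarAlgebra A] {α : G →* (A ≃⋆ₐ[ℂ] A)}
  {L H K : Subgroup G}

theorem con_con (f g : G) (E : EqMod.{u, v, w} α H) :
    ((E.con g (K := conjSub g H) rfl).con f (conjSub_conjSub f g H).symm).Iso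
      (E.con (f * g) rfl) := by
  refine .of_inverse (E := (E.con g (K := conjSub g H) rfl).con f (conjSub_conjSub f g H).symm)
    (F := E.con (f * g) rfl)
    { toFun := fun x => (x : E.carrier), map_add' := fun _ _ => rfl, map_smul' := fun a x => ?_ }
    (fun x => x) (fun k x => ?_) (fun _ => rfl) (fun _ => rfl)
  · have h : α (f * g)⁻¹ (unop a) = α g⁻¹ (α f⁻¹ (unop a)) := by
      rw [mul_inv_rev, map_mul, StarAlgEquiv.mul_apply]
    let y : E.carrier := x
    exact congrArg (fun a => op a • y) h.symm
  · change E.ρ _ (x : E.carrier) = E.ρ _ (x : E.carrier)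
    congr 2
    exact Subtype.ext (by simp [conjHom, mul_assoc])

theorem ρ_mul_apply (E : EqMod.{u, v, w} α H) (h k : H) (x : E.carrier) :
    E.ρ (h * k) x = E.ρ h (E.ρ k x) := by
  rw [map_mul, Module.End.mul_apply]

/-- Conjugation by an element `h` of `H` is isomorphic to the identity, by the action of `h`. -/
theorem con_self {h : G} (hh : h ∈ H) (E : EqMod.{u, v, w} α H) :
    (E.con h (conjSub_eq_self hh).symm).Iso E := by
  refine .of_inverse (E := E.con h (conjSub_eq_self hh).symm)
    { toFun := fun x => E.ρ ⟨h, hh⟩ (x : E.carrier)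
      map_add' := fun x y => map_add (E.ρ ⟨h, hh⟩) (x : E.carrier) y
      map_smul' := fun a x => ?_ }
    (fun x => E.ρ ⟨h, hh⟩⁻¹ x) (fun k x => ?_) (fun x => ?_) (fun x => ?_)
  · refine (E.ρ_smul ⟨h, hh⟩ (α h⁻¹ (unop a)) x).trans ?_
    rw [act_inv]
    rfl
  · have hk : ⟨h, hh⟩ * conjHom h (conjSub_eq_self hh).symm k = k * ⟨h, hh⟩ := ?_
    · exact (ρ_mul_apply E _ _ x).symm.trans
        ((congrArg (fun k => E.ρ k (x : E.carrier)) hk).trans (ρ_mul_apply E _ _ x))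
    exact Subtype.ext (by simp [conjHom, mul_assoc])
  · exact E.ρ.inv_self_apply ⟨h, hh⟩ x
  · exact E.ρ.self_inv_apply ⟨h, hh⟩ x

section Ind

variable [Finite G]

/-- The isomorphism is evaluation at the identity. -/
theorem ind_self (E : EqMod.{u, v, u} α H) : (E.ind (le_refl H)).Iso E := by
  have key : ∀ (φ : indSpace (le_refl H) E) (x : H), φ.1 x = E.ρ x⁻¹ (φ.1 1) := fun φ x => by
    have h := indSpace_apply φ 1 x
    rwa [one_mul] at h
  refine .of_inverse (E := E.ind (le_refl H))
    { toFun := fun φ : indSpace (le_refl H) E => φ.1 1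
      map_add' := fun _ _ => rfl
      map_smul' := fun a φ => ?_ }
    (fun x => (⟨fun h => E.ρ h⁻¹ x, fun h l => ?_⟩ : indSpace (le_refl H) E))
    (fun h (φ : indSpace (le_refl H) E) => ?_) (fun (φ : indSpace (le_refl H) E) => ?_)
    (fun x => ?_)
  · obtain ⟨a, rfl⟩ := MulOpposite.op_surjective a
    refine (indSpace_smul a φ 1).trans ?_
    simp
  · rw [← Module.End.mul_apply, ← map_mul, ← mul_inv_rev]
    rfl
  · change φ.1 (h⁻¹ * 1) = E.ρ h (φ.1 1)
    rw [key, mul_one, inv_inv]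
  · exact Subtype.ext (funext fun x => (key φ x).symm)
  · change E.ρ 1⁻¹ x = x
    simp

/-- A function `φ` on `K` corresponds to the function that assigns to `x` the function
`h ↦ φ (x h)` on `H`. -/
theorem ind_ind (hLH : L ≤ H) (hHK : H ≤ K) (E : EqMod.{u, v, u} α L) :
    ((E.ind hLH).ind hHK).Iso (E.ind (hLH.trans hHK)) := by
  have value : ∀ (Φ : indSpace hHK (E.ind hLH)) (x : K) (h : H),
      (Φ.1 x : indSpace hLH E).1 h = (Φ.1 (x * Subgroup.inclusion hHK h) : indSpace hLH E).1 1 :=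
    fun Φ x h => by
      rw [indSpace_apply Φ x h]
      change _ = (Φ.1 x : indSpace hLH E).1 (h⁻¹⁻¹ * 1)
      rw [inv_inv, mul_one]
  refine Iso.symm (.of_inverse (E := E.ind (hLH.trans hHK)) (F := (E.ind hLH).ind hHK)
    { toFun := fun φ : indSpace (hLH.trans hHK) E => (⟨fun x =>
        (⟨fun h => φ.1 (x * Subgroup.inclusion hHK h), fun h l => ?_⟩ : indSpace hLH E),
        fun x h => ?_⟩ : indSpace hHK (E.ind hLH))
      map_add' := fun _ _ => rfl
      map_smul' := fun a φ => ?_ }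
    (fun Φ : indSpace hHK (E.ind hLH) =>
      (⟨fun x => (Φ.1 x : indSpace hLH E).1 1, fun x l => ?_⟩ : indSpace (hLH.trans hHK) E))
    (fun h (φ : indSpace (hLH.trans hHK) E) => ?_)
    (fun φ : indSpace (hLH.trans hHK) E => ?_) (fun Φ : indSpace hHK (E.ind hLH) => ?_))
  · refine (congrArg φ.1 ?_).trans (φ.2 _ l)
    rw [map_mul, ← mul_assoc]
    rfl
  · refine Subtype.ext (funext fun y : H => ?_)
    change φ.1 (x * Subgroup.inclusion hHK h * Subgroup.inclusion hHK y) =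
      φ.1 (x * Subgroup.inclusion hHK (h⁻¹⁻¹ * y))
    rw [inv_inv, map_mul, mul_assoc]
  · obtain ⟨a, rfl⟩ := MulOpposite.op_surjective a
    refine Subtype.ext (funext fun x : K => Subtype.ext (funext fun h : H => ?_))
    change op (α ((x : G) * h)⁻¹ a) • φ.1 (x * Subgroup.inclusion hHK h) =
      op (α (h : G)⁻¹ (α (x : G)⁻¹ a)) • φ.1 (x * Subgroup.inclusion hHK h)
    rw [mul_inv_rev, map_mul, StarAlgEquiv.mul_apply]
  · change (Φ.1 (x * Subgroup.inclusion hHK (Subgroup.inclusion hLH l)) : indSpace hLH E).1 1 =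
      E.ρ l⁻¹ ((Φ.1 x : indSpace hLH E).1 1)
    rw [← value]
    refine Eq.trans ?_ (indSpace_apply (Φ.1 x : indSpace hLH E) 1 l)
    rw [one_mul]
  · refine Subtype.ext (funext fun x : K => Subtype.ext (funext fun y : H => ?_))
    exact congrArg φ.1 (mul_assoc _ _ _).symm
  · refine Subtype.ext (funext fun x : K => ?_)
    change φ.1 (x * Subgroup.inclusion hHK 1) = φ.1 x
    rw [map_one, mul_one]
  · refine Subtype.ext (funext fun x : K => Subtype.ext (funext fun y : H => ?_))
    exact (value Φ x y).symm

/-- A function `φ` on `H` corresponds to the function `x ↦ φ (g⁻¹ x g)` on `ᵍH`. -/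
theorem con_ind (g : G) (hLH : L ≤ H) (E : EqMod.{u, v, u} α L) :
    ((E.ind hLH).con g (K := conjSub g H) rfl).Iso
      ((E.con g (K := conjSub g L) rfl).ind (conjSub_mono g hLH)) := by
  have hg : ∀ x : H, g * (x : G) * g⁻¹ ∈ conjSub g H := fun x =>
    mem_conjSub.2 (by simp [mul_assoc])
  have hg' : ∀ x : L, g * (x : G) * g⁻¹ ∈ conjSub g L := fun x =>
    mem_conjSub.2 (by simp [mul_assoc])
  let c : conjSub g H →* H := conjHom g rfl
  have hc : ∀ x, (c x : G) = g⁻¹ * x * g := fun _ => rfl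
  refine .of_inverse (E := (E.ind hLH).con g rfl) (F := (E.con g rfl).ind (conjSub_mono g hLH))
    { toFun := fun φ : indSpace hLH E => (⟨fun x => φ.1 (c x), fun x l => ?_⟩ :
        indSpace (conjSub_mono g hLH) (E.con g (K := conjSub g L) rfl))
      map_add' := fun _ _ => rfl
      map_smul' := fun a φ => ?_ }
    (fun ψ : indSpace (conjSub_mono g hLH) (E.con g (K := conjSub g L) rfl) =>
      (⟨fun x => ψ.1 ⟨g * x * g⁻¹, hg x⟩, fun x l => ?_⟩ : indSpace hLH E))
    (fun h (φ : indSpace hLH E) => ?_) (fun φ : indSpace hLH E => ?_)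
    (fun ψ : indSpace (conjSub_mono g hLH) (E.con g (K := conjSub g L) rfl) => ?_)
  · have h : c (x * Subgroup.inclusion (conjSub_mono g hLH) l) =
        c x * Subgroup.inclusion hLH (conjHom g rfl l) := map_mul c _ _
    have h' : (conjHom g rfl l)⁻¹ = conjHom g (rfl : conjSub g L = _) l⁻¹ := (map_inv _ _).symm
    refine (congrArg φ.1 h).trans ((φ.2 (c x) (conjHom g rfl l)).trans ?_)
    exact congrArg (fun l => E.ρ l (φ.1 (c x))) h'
  · obtain ⟨a, rfl⟩ := MulOpposite.op_surjective a
    refine Subtype.ext (funext fun x => ?_)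
    change op (α ((c x : H) : G)⁻¹ (α g⁻¹ a)) • (φ : indSpace hLH E).1 (c x) =
      op (α g⁻¹ (α (x : G)⁻¹ a)) • (φ : indSpace hLH E).1 (c x)
    rw [← StarAlgEquiv.mul_apply, ← StarAlgEquiv.mul_apply, ← map_mul, ← map_mul, hc]
    congr 4
    group
  · have h1 := indSpace_apply ψ ⟨g * x * g⁻¹, hg x⟩ ⟨g * l * g⁻¹, hg' l⟩
    have h2 : (⟨g * (x * Subgroup.inclusion hLH l : H) * g⁻¹, hg _⟩ : conjSub g H) =
        ⟨g * x * g⁻¹, hg x⟩ *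
          Subgroup.inclusion (conjSub_mono g hLH) ⟨g * l * g⁻¹, hg' l⟩ :=
      Subtype.ext (by simp [mul_assoc])
    have h3 : conjHom g (rfl : conjSub g L = conjSub g L) ⟨g * l * g⁻¹, hg' l⟩⁻¹ = l⁻¹ :=
      Subtype.ext (by simp [conjHom, mul_assoc])
    refine (congrArg ψ.1 h2).trans (h1.trans ?_)
    exact congrArg (fun l => E.ρ l (ψ.1 ⟨g * x * g⁻¹, hg x⟩ : E.carrier)) h3
  · refine Subtype.ext (funext fun x => ?_)
    change φ.1 ((c h)⁻¹ * c x) = φ.1 (c (h⁻¹ * x))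
    rw [map_mul, map_inv]
  · refine Subtype.ext (funext fun x => ?_)
    exact congrArg φ.1 (Subtype.ext (by simp [hc, mul_assoc]))
  · refine Subtype.ext (funext fun x => ?_)
    exact congrArg ψ.1 (Subtype.ext (by simp [hc, mul_assoc]))

/-- The Mackey formula: a function `φ` in the induced module corresponds to the family of the
functions `l ↦ φ (l x)`, for `x` in a set of double coset representatives. -/
theorem mackey (hL : L ≤ H) (hK : K ≤ H) (S : Finset G) (hS : IsDoubleCosetReps L K H S)
    (E : EqMod.{u, v, u} α K) :
    (KTilde.of ((E.ind hK).res hL) : KTilde.{u, v, u} α L) =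
      ∑ x ∈ S, KTilde.of (((E.res (inf_le_right : conjSub x⁻¹ L ⊓ K ≤ K)).con x
        (inf_conjSub x L K)).ind inf_le_left) := by
  let F : G → EqMod.{u, v, u} α L := fun x =>
    ((E.res (inf_le_right : conjSub x⁻¹ L ⊓ K ≤ K)).con x (inf_conjSub x L K)).ind inf_le_left
  have hx : ∀ (x : S) (l : L), (l : G) * x ∈ H := fun x l => H.mul_mem (hL l.2) (hS.1 x x.2)
  let Sp : G → Type u := fun x => indSpace (inf_le_left : L ⊓ conjSub x K ≤ L)
    ((E.res (inf_le_right : conjSub x⁻¹ L ⊓ K ≤ K)).con x (inf_conjSub x L K))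
  let p : ∀ x : S, indSpace hK E →ₗ[Aᵐᵒᵖ] (F x).carrier := fun x =>
    { toFun := fun φ => (⟨fun l => φ.1 ⟨l * x, hx x l⟩, fun l m => by
        have hm : (x : G)⁻¹ * m * x ∈ K := mem_conjSub.1 m.2.2
        have h1 := indSpace_apply φ ⟨l * x, hx x l⟩ ⟨_, hm⟩
        have h2 : (⟨l * x, hx x l⟩ * Subgroup.inclusion hK ⟨_, hm⟩ : H) =
            ⟨(l * Subgroup.inclusion inf_le_left m : L) * x, hx x _⟩ :=
          Subtype.ext (by simp [mul_assoc])
        rw [h2] at h1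
        refine h1.trans (congrArg (fun k => E.ρ k (φ.1 ⟨l * x, hx x l⟩)) ?_)
        exact Subtype.ext (by simp [conjHom, mul_assoc])⟩ : Sp x)
      map_add' := fun _ _ => rfl
      map_smul' := fun a φ => by
        obtain ⟨a, rfl⟩ := MulOpposite.op_surjective a
        refine Subtype.ext (funext fun l => ?_)
        change op (α ((l : G) * x)⁻¹ a) • φ.1 ⟨l * x, hx x l⟩ =
          op (α (x : G)⁻¹ (α (l : G)⁻¹ a)) • φ.1 ⟨l * x, hx x l⟩
        rw [mul_inv_rev, map_mul, StarAlgEquiv.mul_apply] }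
  refine KTilde.of_eq_sum S (E := (E.ind hK).res hL) F p (fun x l (φ : indSpace hK E) => ?_)
    ⟨fun φ φ' hφ => ?_, fun ψ => ?_⟩
  · refine Subtype.ext (funext fun m => ?_)
    exact congrArg φ.1 (Subtype.ext (mul_assoc _ _ _).symm)
  · refine Subtype.ext (funext fun h => ?_)
    obtain ⟨x, ⟨hxS, l, hl, k, hk, e⟩, -⟩ := hS.2 h h.2
    have h1 : h = ⟨l * x, hx ⟨x, hxS⟩ ⟨l, hl⟩⟩ * Subgroup.inclusion hK ⟨k, hk⟩ := Subtype.ext e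
    have h2 : φ.1 ⟨l * x, hx ⟨x, hxS⟩ ⟨l, hl⟩⟩ = φ'.1 ⟨l * x, hx ⟨x, hxS⟩ ⟨l, hl⟩⟩ :=
      congrFun (congrArg Subtype.val (congrFun hφ ⟨x, hxS⟩ : p ⟨x, hxS⟩ φ = p ⟨x, hxS⟩ φ')) ⟨l, hl⟩
    rw [h1]
    exact (indSpace_apply φ _ _).trans ((congrArg _ h2).trans (indSpace_apply φ' _ _).symm)
  · -- the value of `φ` at `l x k` has to be `k⁻¹ ψ_x(l)`, which depends on `l x k` alone
    let ψ' : ∀ x : S, L → E.carrier := fun x l => (ψ x : Sp x).1 l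
    have indep : ∀ (x x' : S) (l l' : L) (k k' : K), x = x' →
        (l : G) * x * k = l' * x' * k' → E.ρ k⁻¹ (ψ' x l) = E.ρ k'⁻¹ (ψ' x' l') := by
      rintro x _ l l' k k' rfl h
      have hm : (l : G)⁻¹ * l' = x * (k * (k' : G)⁻¹) * (x : G)⁻¹ := by
        rw [inv_mul_eq_iff_eq_mul, ← mul_assoc, ← mul_assoc, ← mul_assoc, h]
        simp [mul_assoc]
      have hm' : (l : G)⁻¹ * l' ∈ L ⊓ conjSub (x : G) K :=
        ⟨L.mul_mem (L.inv_mem l.2) l'.2, mem_conjSub.2 (by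
          rw [hm]
          simpa [mul_assoc] using K.mul_mem k.2 (K.inv_mem k'.2))⟩
      have h1 := (ψ x : Sp x).2 l ⟨_, hm'⟩
      have h2 : (l * Subgroup.inclusion inf_le_left ⟨_, hm'⟩ : L) = l' := Subtype.ext (by simp)
      rw [h2] at h1
      have h3 : ψ' x l' = E.ρ (k' * k⁻¹) (ψ' x l) := by
        refine h1.trans (congrArg (fun k => E.ρ k (ψ' x l)) ?_)
        refine Subtype.ext ?_
        change (x : G)⁻¹ * ((l : G)⁻¹ * l')⁻¹ * x = k' * (k : G)⁻¹
        rw [hm]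
        simp [mul_assoc]
      rw [h3, ← Module.End.mul_apply, ← map_mul]
      simp
    have dec : ∀ h : H, ∃ (x : S) (l : L) (k : K), (h : G) = l * x * k := fun h => by
      obtain ⟨x, ⟨hxS, l, hl, k, hk, e⟩, -⟩ := hS.2 h h.2
      exact ⟨⟨x, hxS⟩, ⟨l, hl⟩, ⟨k, hk⟩, e⟩
    choose x l k hd using dec
    have val : ∀ (h : H) (x' : S) (l' : L) (k' : K), (h : G) = l' * x' * k' →
        E.ρ (k h)⁻¹ (ψ' (x h) (l h)) = E.ρ k'⁻¹ (ψ' x' l') := fun h x' l' k' e => by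
      refine indep _ _ _ _ _ _ (Subtype.ext ?_) ((hd h).symm.trans e)
      exact (hS.2 h h.2).unique ⟨(x h).2, _, (l h).2, _, (k h).2, hd h⟩
        ⟨x'.2, _, l'.2, _, k'.2, e⟩
    refine ⟨(⟨fun h => E.ρ (k h)⁻¹ (ψ' (x h) (l h)), fun h m => ?_⟩ : indSpace hK E), ?_⟩
    · have hm : ((h * Subgroup.inclusion hK m : H) : G) = l h * x h * (k h * m : K) := by
        rw [Subgroup.coe_mul, hd h]
        simp [mul_assoc]
      refine (val _ (x h) (l h) (k h * m) hm).trans ?_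
      rw [mul_inv_rev, ρ_mul_apply]
    · refine funext fun y => Subtype.ext (funext fun m => ?_)
      refine (val ⟨m * y, hx y m⟩ y m 1 (by simp)).trans ?_
      rw [inv_one, map_one]
      rfl

end Ind

end EqMod

/-! ### Recognition of induced modules -/

namespace EqMod

section Induced

variable {G : Type u} [Group G] {A : Type v} [CStarAlgebra A] {α : G →* (A ≃⋆ₐ[ℂ] A)}
  {L H : Subgroup G}

/-- An `(H, A)`-module `F` that is the direct sum of the translates `h E`, for `h` in `H / L`, of
an `(L, A)`-submodule `E`. This is expressed through the inclusion `incl` of `E` and the projection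
`proj` onto it; the identity of `F` is the sum of the projections onto the translates, and summing
over `H` instead of `H / L` counts each of them `|L|` times. In this form the notion is preserved
by additive functors. -/
structure Induced (hLH : L ≤ H) (E : EqMod.{u, v, w} α L) (F : EqMod.{u, v, w} α H) where
  incl : E.carrier →ₗ[Aᵐᵒᵖ] F.carrier
  proj : F.carrier →ₗ[Aᵐᵒᵖ] E.carrier
  incl_ρ : ∀ l x, incl (E.ρ l x) = F.ρ (Subgroup.inclusion hLH l) (incl x)
  proj_ρ : ∀ l y, proj (F.ρ (Subgroup.inclusion hLH l) y) = E.ρ l (proj y)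
  proj_incl : ∀ x, proj (incl x) = x
  proj_incl_of_notMem : ∀ h : H, (h : G) ∉ L → ∀ x, proj (F.ρ h (incl x)) = 0
  sum_translates : ∀ [Fintype H] y, ∑ h : H, F.ρ h (incl (proj (F.ρ h⁻¹ y))) = Nat.card L • y

theorem map_smul_complex {E : EqMod.{u, v, w} α L} {F : EqMod.{u, v, w} α H}
    (e : E.carrier →ₗ[Aᵐᵒᵖ] F.carrier) (c : ℂ) (x : E.carrier) : e (c • x) = c • e x :=
  (e.restrictScalars ℂ).map_smul c x

/-- The number of elements of a finite group is invertible on complex vector spaces. -/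
theorem inv_card_smul [Finite G] (L : Subgroup G) {M : Type w} [AddCommGroup M] [Module ℂ M]
    (x : M) : (Nat.card L : ℂ)⁻¹ • Nat.card L • x = x := by
  rw [← Nat.cast_smul_eq_nsmul ℂ, smul_smul, inv_mul_cancel₀, one_smul]
  exact Nat.cast_ne_zero.2 Nat.card_pos.ne'

theorem card_filter_mem (hLH : L ≤ H) [Fintype H] [DecidablePred fun h : H => (h : G) ∈ L] :
    (Finset.univ.filter fun h : H => (h : G) ∈ L).card = Nat.card L := by
  rw [← Fintype.card_subtype, ← Nat.card_eq_fintype_card]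
  exact Nat.card_congr (Subgroup.subgroupOfEquivOfLe hLH).toEquiv

/-- The inverse isomorphism is `φ ↦ |L|⁻¹ ∑ h φ(h)`, where `h` runs through `H`. -/
theorem Induced.iso [Finite G] {hLH : L ≤ H} {E : EqMod.{u, v, u} α L} {F : EqMod.{u, v, u} α H}
    (D : Induced hLH E F) : F.Iso (E.ind hLH) := by
  classical
  have := Fintype.ofFinite H
  have hproj : ∀ (h : H) (φ : indSpace hLH E) (x : H),
      D.proj (F.ρ (x⁻¹ * h) (D.incl (φ.1 h))) = if ((x⁻¹ * h : H) : G) ∈ L then φ.1 x else 0 := by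
    intro h φ x
    split_ifs with hm
    · have h1 := indSpace_apply φ x ⟨_, hm⟩
      have h2 : x * Subgroup.inclusion hLH ⟨_, hm⟩ = h := Subtype.ext (by simp)
      rw [h2] at h1
      refine (congrArg (fun y => D.proj (F.ρ _ (D.incl y))) h1).trans
        ((D.proj_ρ ⟨_, hm⟩ _).trans ?_)
      rw [D.proj_incl, E.ρ.self_inv_apply]
    · exact D.proj_incl_of_notMem _ hm _
  have hcount : ∀ x : H, (Finset.univ.filter fun h : H => ((x⁻¹ * h : H) : G) ∈ L).card =
      Nat.card L := fun x => by
    rw [← card_filter_mem hLH]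
    refine Finset.card_bij (fun h _ => x⁻¹ * h) (fun h hh => by simpa using hh)
      (fun _ _ _ _ e => mul_left_cancel e) fun h hh => ⟨x * h, by simpa using hh, by simp⟩
  refine .of_inverse (F := E.ind hLH)
    { toFun := fun y => (⟨fun x => D.proj (F.ρ x⁻¹ y), fun x l => ?_⟩ : indSpace hLH E)
      map_add' := fun y z => Subtype.ext (funext fun x => by
        change D.proj (F.ρ x⁻¹ (y + z)) = D.proj (F.ρ x⁻¹ y) + D.proj (F.ρ x⁻¹ z)
        rw [map_add, map_add])
      map_smul' := fun a y => Subtype.ext (funext fun x => ?_) }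
    (fun φ : indSpace hLH E => (Nat.card L : ℂ)⁻¹ • ∑ h : H, F.ρ h (D.incl (φ.1 h)))
    (fun h y => Subtype.ext (funext fun x => ?_)) (fun y => ?_)
    (fun φ : indSpace hLH E => Subtype.ext (funext fun x => ?_))
  · change D.proj (F.ρ (x * Subgroup.inclusion hLH l)⁻¹ y) = E.ρ l⁻¹ (D.proj (F.ρ x⁻¹ y))
    rw [mul_inv_rev, ρ_mul_apply, ← map_inv, D.proj_ρ]
  · obtain ⟨a, rfl⟩ := MulOpposite.op_surjective a
    change D.proj (F.ρ x⁻¹ (op a • y)) = op (α (x : G)⁻¹ a) • D.proj (F.ρ x⁻¹ y)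
    rw [F.ρ_smul, map_smul]
    rfl
  · change D.proj (F.ρ x⁻¹ (F.ρ h y)) = D.proj (F.ρ (h⁻¹ * x)⁻¹ y)
    rw [mul_inv_rev, inv_inv, ρ_mul_apply]
  · change (Nat.card L : ℂ)⁻¹ • ∑ h : H, F.ρ h (D.incl (D.proj (F.ρ h⁻¹ y))) = y
    rw [D.sum_translates, inv_card_smul]
  · change D.proj (F.ρ x⁻¹ ((Nat.card L : ℂ)⁻¹ • ∑ h : H, F.ρ h (D.incl (φ.1 h)))) = φ.1 x
    rw [map_smul, map_smul_complex, map_sum, map_sum]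
    simp_rw [← ρ_mul_apply, hproj]
    rw [← Finset.sum_filter, Finset.sum_const, hcount, inv_card_smul]

open Classical in
/-- The function on `H` that is supported on `L` and has the value `x` at the identity. -/
def indIncl (hLH : L ≤ H) (E : EqMod.{u, v, u} α L) (x : E.carrier) : indSpace hLH E :=
  ⟨fun h => if hh : (h : G) ∈ L then E.ρ ⟨h, hh⟩⁻¹ x else 0, fun h l => by
    have hl : ((h * Subgroup.inclusion hLH l : H) : G) ∈ L ↔ (h : G) ∈ L :=
      L.mul_mem_cancel_right l.2
    by_cases hh : (h : G) ∈ L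
    · refine (dif_pos (hl.2 hh)).trans (Eq.trans ?_ (congrArg (E.ρ l⁻¹) (dif_pos hh)).symm)
      rw [← ρ_mul_apply, ← mul_inv_rev]
      rfl
    · refine (dif_neg (mt hl.1 hh)).trans (Eq.trans ?_ (congrArg (E.ρ l⁻¹) (dif_neg hh)).symm)
      rw [map_zero]⟩

theorem indIncl_of_mem (hLH : L ≤ H) (E : EqMod.{u, v, u} α L) (x : E.carrier) {h : H}
    (hh : (h : G) ∈ L) : (indIncl hLH E x).1 h = E.ρ ⟨h, hh⟩⁻¹ x := dif_pos hh

theorem indIncl_of_notMem (hLH : L ≤ H) (E : EqMod.{u, v, u} α L) (x : E.carrier) {h : H}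
    (hh : (h : G) ∉ L) : (indIncl hLH E x).1 h = 0 := dif_neg hh

/-- An induced module contains the module it is induced from, as the functions supported on `L`. -/
def inducedInd [Finite G] (hLH : L ≤ H) (E : EqMod.{u, v, u} α L) : Induced hLH E (E.ind hLH) where
  incl :=
    { toFun := indIncl hLH E
      map_add' := fun x y => Subtype.ext (funext fun h => by
        change _ = (indIncl hLH E x).1 h + (indIncl hLH E y).1 h
        by_cases hh : (h : G) ∈ L
        · simp only [indIncl_of_mem hLH E _ hh, map_add]
        · simp only [indIncl_of_notMem hLH E _ hh, add_zero])
      map_smul' := fun a x => Subtype.ext (funext fun h => by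
        obtain ⟨a, rfl⟩ := MulOpposite.op_surjective a
        change _ = op (α (h : G)⁻¹ a) • (indIncl hLH E x).1 h
        by_cases hh : (h : G) ∈ L
        · simp only [indIncl_of_mem hLH E _ hh, E.ρ_smul]
          rfl
        · simp only [indIncl_of_notMem hLH E _ hh, smul_zero]) }
  proj :=
    { toFun := fun φ : indSpace hLH E => φ.1 1
      map_add' := fun _ _ => rfl
      map_smul' := fun a φ => by
        obtain ⟨a, rfl⟩ := MulOpposite.op_surjective a
        refine (indSpace_smul a φ 1).trans ?_
        simp }
  incl_ρ l x := Subtype.ext (funext fun h => by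
    change (indIncl hLH E (E.ρ l x)).1 h = (indIncl hLH E x).1 ((Subgroup.inclusion hLH l)⁻¹ * h)
    have hl : (((Subgroup.inclusion hLH l)⁻¹ * h : H) : G) ∈ L ↔ (h : G) ∈ L :=
      L.mul_mem_cancel_left (L.inv_mem l.2)
    by_cases hh : (h : G) ∈ L
    · rw [indIncl_of_mem hLH E _ hh, indIncl_of_mem hLH E _ (hl.2 hh), ← ρ_mul_apply]
      refine congrArg (fun l => E.ρ l x) (Subtype.ext ?_)
      simp
    · rw [indIncl_of_notMem hLH E _ hh, indIncl_of_notMem hLH E _ (mt hl.1 hh)])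
  proj_ρ l φ := by
    let φ : indSpace hLH E := φ
    change φ.1 ((Subgroup.inclusion hLH l)⁻¹ * 1) = E.ρ l (φ.1 1)
    have h1 := indSpace_apply φ 1 l⁻¹
    rwa [inv_inv, one_mul, map_inv, ← mul_one (Subgroup.inclusion hLH l)⁻¹] at h1
  proj_incl x := by
    refine (indIncl_of_mem hLH E x (h := 1) L.one_mem).trans ?_
    have : (⟨((1 : H) : G), L.one_mem⟩ : L)⁻¹ = 1 := inv_one
    rw [this, map_one]
    rfl
  proj_incl_of_notMem h hh x := by
    refine indIncl_of_notMem hLH E x (h := h⁻¹ * 1) ?_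
    rwa [mul_one, Subgroup.coe_inv, inv_mem_iff]
  sum_translates {_} φ := by
    classical
    let φ : indSpace hLH E := φ
    let s : H → indSpace hLH E := fun h => (E.ind hLH).ρ h (indIncl hLH E (φ.1 (h⁻¹⁻¹ * 1)))
    suffices ∑ h, s h = Nat.card L • φ from this
    refine Subtype.ext (funext fun y => ?_)
    have hs : ∀ h, (s h).1 y = if ((h⁻¹ * y : H) : G) ∈ L then φ.1 y else 0 := fun h => by
      change (indIncl hLH E (φ.1 (h⁻¹⁻¹ * 1))).1 (h⁻¹ * y) = _
      split_ifs with hm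
      · rw [indIncl_of_mem hLH E _ hm, inv_inv, mul_one, ← indSpace_apply]
        exact congrArg φ.1 (Subtype.ext (by simp))
      · exact indIncl_of_notMem hLH E _ hm
    have hcount : (Finset.univ.filter fun h : H => ((h⁻¹ * y : H) : G) ∈ L).card =
        Nat.card L := by
      rw [← card_filter_mem hLH]
      refine Finset.card_bij (fun h _ => h⁻¹ * y) (fun h hh => by simpa using hh)
        (fun _ _ _ _ e => inv_injective (mul_right_cancel e))
        fun h hh => ⟨y * h⁻¹, by simpa using hh, by simp⟩
    rw [AddSubmonoidClass.coe_finsetSum, Finset.sum_apply]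
    simp_rw [hs]
    rw [← Finset.sum_filter, Finset.sum_const, hcount]
    rfl

end Induced

/-! ### Tensor products with representations -/

section Tensor

variable {G : Type u} [Group G] {A : Type v} [CStarAlgebra A] {α : G →* (A ≃⋆ₐ[ℂ] A)}
  {L H : Subgroup G}

/-- The element `x ⊗ y` of the tensor product. -/
def tmul {V : FinRep H} {E : EqMod.{u, v, u} α H} (x : E.carrier) (y : V.carrier) :
    (tensor V E).carrier := x ⊗ₜ[ℂ] y

theorem tensor_induction {V : FinRep H} {E : EqMod.{u, v, u} α H}
    {p : (tensor V E).carrier → Prop} (zero : p 0) (add : ∀ s t, p s → p t → p (s + t))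
    (mk : ∀ x y, p (tmul x y)) (t) : p t :=
  TensorProduct.induction_on t zero mk add

theorem tmul_zero {V : FinRep H} {E : EqMod.{u, v, u} α H} (x : E.carrier) :
    (tmul x 0 : (tensor V E).carrier) = 0 := TensorProduct.tmul_zero _ x

theorem zero_tmul {V : FinRep H} {E : EqMod.{u, v, u} α H} (y : V.carrier) :
    (tmul 0 y : (tensor V E).carrier) = 0 := TensorProduct.zero_tmul _ y

theorem add_tmul {V : FinRep H} {E : EqMod.{u, v, u} α H} (x x' : E.carrier) (y : V.carrier) :
    (tmul (x + x') y : (tensor V E).carrier) = tmul x y + tmul x' y :=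
  TensorProduct.add_tmul x x' y

theorem tmul_nsmul {V : FinRep H} {E : EqMod.{u, v, u} α H} (n : ℕ) (x : E.carrier)
    (y : V.carrier) : (tmul x (n • y) : (tensor V E).carrier) = n • tmul x y :=
  map_nsmul (TensorProduct.mk ℂ E.carrier V.carrier x) n y

theorem nsmul_tmul {V : FinRep H} {E : EqMod.{u, v, u} α H} (n : ℕ) (x : E.carrier)
    (y : V.carrier) : (tmul (n • x) y : (tensor V E).carrier) = n • tmul x y :=
  map_nsmul ((TensorProduct.mk ℂ E.carrier V.carrier).flip y) n x

theorem sum_tmul {ι : Type*} {V : FinRep H} {E : EqMod.{u, v, u} α H} (s : Finset ι)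
    (x : ι → E.carrier) (y : V.carrier) :
    ∑ i ∈ s, (tmul (x i) y : (tensor V E).carrier) = tmul (∑ i ∈ s, x i) y :=
  (map_sum ((TensorProduct.mk ℂ E.carrier V.carrier).flip y) x s).symm

theorem tmul_sum {ι : Type*} {V : FinRep H} {E : EqMod.{u, v, u} α H} (s : Finset ι)
    (x : E.carrier) (y : ι → V.carrier) :
    ∑ i ∈ s, (tmul x (y i) : (tensor V E).carrier) = tmul x (∑ i ∈ s, y i) :=
  (map_sum (TensorProduct.mk ℂ E.carrier V.carrier x) y s).symm

/-- The tensor product of an `A`-linear map of modules and a linear map of representations, both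
possibly of different groups. -/
def tensorMap {V : FinRep L} {W : FinRep H} {E : EqMod.{u, v, u} α L} {F : EqMod.{u, v, u} α H}
    (i : E.carrier →ₗ[Aᵐᵒᵖ] F.carrier) (j : V.carrier →ₗ[ℂ] W.carrier) :
    (tensor V E).carrier →ₗ[Aᵐᵒᵖ] (tensor W F).carrier :=
  TensorProduct.AlgebraTensorModule.map i j

theorem tensor_triv (E : EqMod.{u, v, u} α H) : (tensor (FinRep.triv H) E).Iso E :=
  tensor_iso_of (V := FinRep.triv H)
    ((TensorProduct.AlgebraTensorModule.congr (.refl Aᵐᵒᵖ _) ULift.moduleEquiv).trans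
      (TensorProduct.AlgebraTensorModule.rid ℂ Aᵐᵒᵖ E.carrier))
    fun h x y => ((E.ρ h).map_smul y.down x).symm

theorem tensor_tensor (V W : FinRep H) (E : EqMod.{u, v, u} α H) :
    (tensor (V.tensor W) E).Iso (tensor V (tensor W E)) := by
  let e := (TensorProduct.AlgebraTensorModule.congr (.refl Aᵐᵒᵖ E.carrier)
      (TensorProduct.comm ℂ V.carrier W.carrier)).trans
    (TensorProduct.AlgebraTensorModule.assoc ℂ ℂ Aᵐᵒᵖ E.carrier W.carrier V.carrier).symm
  refine tensor_iso_of (V := V.tensor W) (F := tensor V (tensor W E)) e fun h x y => ?_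
  let e' := (tensor V (tensor W E)).ρ h ∘ₗ e.toLinearMap.restrictScalars ℂ ∘ₗ
    TensorProduct.mk ℂ E.carrier (V.carrier ⊗[ℂ] W.carrier) x
  let f' := e.toLinearMap.restrictScalars ℂ ∘ₗ
    TensorProduct.mk ℂ E.carrier (V.carrier ⊗[ℂ] W.carrier) (E.ρ h x) ∘ₗ (V.tensor W).ρ h
  exact LinearMap.congr_fun (f := f') (g := e') (TensorProduct.ext' fun y z => rfl) y

theorem res_tensor (h : L ≤ H) (V : FinRep H) (E : EqMod.{u, v, u} α H) :
    ((tensor V E).res h).Iso (tensor (V.comp (Subgroup.inclusion h)) (E.res h)) :=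
  .refl ((tensor V E).res h)

theorem con_tensor (g : G) {K : Subgroup G} (h : K = conjSub g H) (V : FinRep H)
    (E : EqMod.{u, v, u} α H) :
    ((tensor V E).con g h).Iso (tensor (V.comp (conjHom g h)) (E.con g h)) := by
  refine .of_inverse (E := (tensor V E).con g h)
    (F := tensor (V.comp (conjHom g h)) (E.con g h))
    { toFun := fun t : E.carrier ⊗[ℂ] V.carrier => t
      map_add' := fun _ _ => rfl
      map_smul' := fun a t => ?_ } (fun t => t) (fun _ _ => rfl) (fun _ => rfl) (fun _ => rfl)
  rfl

/-- Tensoring with a representation commutes with induction. -/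
def Induced.tensor [Finite G] {hLH : L ≤ H} {E : EqMod.{u, v, u} α L} {F : EqMod.{u, v, u} α H}
    (D : Induced hLH E F) (V : FinRep H) :
    Induced hLH (EqMod.tensor (V.comp (Subgroup.inclusion hLH)) E) (EqMod.tensor V F) where
  incl := tensorMap D.incl .id
  proj := tensorMap D.proj .id
  incl_ρ l x := by
    induction x using tensor_induction with
    | zero => simp only [map_zero]
    | add x y hx hy => simp only [map_add, hx, hy]
    | mk x y => exact congrArg (fun z => tmul z _) (D.incl_ρ l x)
  proj_ρ l x := by
    induction x using tensor_induction with
    | zero => simp only [map_zero]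
    | add x y hx hy => simp only [map_add, hx, hy]
    | mk x y => exact congrArg (fun z => tmul z _) (D.proj_ρ l x)
  proj_incl x := by
    induction x using tensor_induction with
    | zero => simp only [map_zero]
    | add x y hx hy => simp only [map_add, hx, hy]
    | mk x y => exact congrArg (fun z => tmul z _) (D.proj_incl x)
  proj_incl_of_notMem h hh x := by
    induction x using tensor_induction with
    | zero => simp only [map_zero]
    | add x y hx hy => simp only [map_add, hx, hy, add_zero]
    | mk x y =>
      exact (congrArg (fun z => tmul z _) (D.proj_incl_of_notMem h hh x)).trans (zero_tmul _)
  sum_translates {_} y := by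
    induction y using tensor_induction with
    | zero => simp only [map_zero, Finset.sum_const_zero, smul_zero]
    | add x y hx hy => simp only [map_add, Finset.sum_add_distrib, smul_add, hx, hy]
    | mk x y =>
      have h1 : ∀ h : H, tmul (F.ρ h (D.incl (D.proj (F.ρ h⁻¹ x)))) (V.ρ h (V.ρ h⁻¹ y)) =
          tmul (F.ρ h (D.incl (D.proj (F.ρ h⁻¹ x)))) y := fun h => by rw [V.ρ.self_inv_apply]
      refine (Finset.sum_congr rfl fun h _ => h1 h).trans ?_
      rw [sum_tmul, D.sum_translates, nsmul_tmul]

end Tensor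

end EqMod

namespace FinRep

section Ind

variable {G : Type u} [Group G] [Finite G] {L H : Subgroup G} (hLH : L ≤ H) (V : FinRep L)

open Classical in
/-- The projection of the induced representation to the copy `1 ⊗ V` of `V`. -/
def indProj : (V.ind (Subgroup.inclusion hLH)).carrier →ₗ[ℂ] V.carrier :=
  Representation.Coinvariants.lift _
    (TensorProduct.lift <| (Finsupp.lift _ ℂ _ fun h : H =>
      if hh : (h : G) ∈ L then V.ρ ⟨h, hh⟩⁻¹ else 0) ∘ₗ
      (MonoidAlgebra.coeffLinearEquiv ℂ).toLinearMap)
    fun l => by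
      ext h x
      simp only [LinearMap.coe_comp, Function.comp_apply, MonoidAlgebra.lsingle_apply]
      have hl : ((Subgroup.inclusion hLH l * h : H) : G) ∈ L ↔ (h : G) ∈ L :=
        L.mul_mem_cancel_left l.2
      by_cases hh : (h : G) ∈ L
      · have hh' := hl.2 hh
        have : (⟨_, hh'⟩ : L)⁻¹ = ⟨_, hh⟩⁻¹ * l⁻¹ := by
          rw [← mul_inv_rev]
          rfl
        have key : V.ρ (⟨_, hh'⟩ : L)⁻¹ (V.ρ l x) = V.ρ (⟨_, hh⟩ : L)⁻¹ x := by
          rw [this, map_mul, Module.End.mul_apply, V.ρ.inv_self_apply]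
        simpa [hh, dif_pos (show (l : G) * h ∈ L from hh')] using key
      · simp [hh, dif_neg (show (l : G) * h ∉ L from mt hl.1 hh)]

theorem ind_ρ_indMk {L H : Type u} [Group L] [Group H] [Finite H] (φ : L →* H) (V : FinRep L)
    (h k : H) (x : V.carrier) : (V.ind φ).ρ h (indMk φ V k x) = indMk φ V (k * h⁻¹) x :=
  Representation.ind_mk φ V.ρ h k x

theorem indMk_mul {L H : Type u} [Group L] [Group H] [Finite H] (φ : L →* H) (V : FinRep L)
    (l : L) (h : H) (x : V.carrier) : indMk φ V (φ l * h) (V.ρ l x) = indMk φ V h x := by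
  have h1 := Representation.Coinvariants.mk_self_apply
    (Representation.tprod ((Representation.leftRegular ℂ H).comp φ) V.ρ) l (.single h 1 ⊗ₜ[ℂ] x)
  rw [Representation.tprod_apply, TensorProduct.map_tmul] at h1
  refine Eq.trans ?_ h1
  simp
  rfl

theorem indProj_of_mem (h : H) (hh : (h : G) ∈ L) (x : V.carrier) :
    indProj hLH V (indMk _ V h x) = V.ρ ⟨h, hh⟩⁻¹ x := by
  refine (Representation.Coinvariants.lift_mk _ _ _
    (MonoidAlgebra.single h (1 : ℂ) ⊗ₜ[ℂ] x)).trans ?_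
  simp [hh]

theorem indProj_of_notMem (h : H) (hh : (h : G) ∉ L) (x : V.carrier) :
    indProj hLH V (indMk _ V h x) = 0 := by
  refine (Representation.Coinvariants.lift_mk _ _ _
    (MonoidAlgebra.single h (1 : ℂ) ⊗ₜ[ℂ] x)).trans ?_
  simp [hh]

theorem indMk_one_ρ (l : L) (x : V.carrier) : indMk _ V 1 (V.ρ l x) =
    (V.ind (Subgroup.inclusion hLH)).ρ (Subgroup.inclusion hLH l) (indMk _ V 1 x) := by
  rw [ind_ρ_indMk, one_mul, ← indMk_mul (Subgroup.inclusion hLH) V l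
    (Subgroup.inclusion hLH l)⁻¹, mul_inv_cancel]

theorem indProj_ρ (l : L) (y : (V.ind (Subgroup.inclusion hLH)).carrier) :
    indProj hLH V ((V.ind _).ρ (Subgroup.inclusion hLH l) y) = V.ρ l (indProj hLH V y) := by
  refine LinearMap.congr_fun (f := indProj hLH V ∘ₗ (V.ind _).ρ (Subgroup.inclusion hLH l))
    (g := V.ρ l ∘ₗ indProj hLH V) (ind_ext _ fun h x => ?_) y
  rw [LinearMap.comp_apply, LinearMap.comp_apply, ind_ρ_indMk]
  have hl : ((h * (Subgroup.inclusion hLH l)⁻¹ : H) : G) ∈ L ↔ (h : G) ∈ L :=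
    L.mul_mem_cancel_right (L.inv_mem l.2)
  by_cases hh : (h : G) ∈ L
  · rw [indProj_of_mem hLH V _ hh, indProj_of_mem hLH V _ (hl.2 hh), ← Module.End.mul_apply,
      ← map_mul]
    refine congrArg (fun l => V.ρ l x) (Subtype.ext ?_)
    simp
  · rw [indProj_of_notMem hLH V _ hh, indProj_of_notMem hLH V _ (mt hl.1 hh), map_zero]

/-- The induced representation is the direct sum of the translates of `1 ⊗ V`; each of them is
counted `|L|` times. -/
theorem sum_indProj [Fintype H] (y : (V.ind (Subgroup.inclusion hLH)).carrier) :
    ∑ h : H, (V.ind (Subgroup.inclusion hLH)).ρ h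
      (indMk _ V 1 (indProj hLH V ((V.ind _).ρ h⁻¹ y))) = Nat.card L • y := by
  classical
  let f := ∑ h : H, (V.ind (Subgroup.inclusion hLH)).ρ h ∘ₗ indMk _ V 1 ∘ₗ indProj hLH V ∘ₗ
    (V.ind (Subgroup.inclusion hLH)).ρ h⁻¹
  suffices hf : f = Nat.card L • LinearMap.id by
    have h1 := LinearMap.congr_fun hf y
    simpa [f, LinearMap.sum_apply] using h1
  refine ind_ext _ fun k x => ?_
  have hs : ∀ h : H, (V.ind (Subgroup.inclusion hLH)).ρ h
      (indMk _ V 1 (indProj hLH V ((V.ind _).ρ h⁻¹ (indMk _ V k x)))) =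
      if ((k * h : H) : G) ∈ L then indMk (Subgroup.inclusion hLH) V k x else 0 := fun h => by
    rw [ind_ρ_indMk _ V h⁻¹, inv_inv]
    split_ifs with hm
    · rw [indProj_of_mem hLH V _ hm, ind_ρ_indMk, one_mul,
        ← indMk_mul (Subgroup.inclusion hLH) V ⟨_, hm⟩, V.ρ.self_inv_apply]
      refine congrArg (fun h => indMk _ V h x) (Subtype.ext ?_)
      simp
    · rw [indProj_of_notMem hLH V _ hm, map_zero, map_zero]
  have hcount : (Finset.univ.filter fun h : H => ((k * h : H) : G) ∈ L).card = Nat.card L := by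
    rw [← EqMod.card_filter_mem hLH]
    refine Finset.card_bij (fun h _ => k * h) (fun h hh => by simpa using hh)
      (fun _ _ _ _ e => mul_left_cancel e) fun h hh => ⟨k⁻¹ * h, by simpa using hh, by simp⟩
  simp only [f, LinearMap.sum_apply, LinearMap.comp_apply, LinearMap.smul_apply,
    LinearMap.id_apply, hs]
  rw [← Finset.sum_filter, Finset.sum_const, hcount]

end Ind

end FinRep

/-- The tensor product of `F` with a representation induced from `L` is induced from `L`. -/
def EqMod.inducedTensor {G : Type u} [Group G] [Finite G] {A : Type v} [CStarAlgebra A]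
    {α : G →* (A ≃⋆ₐ[ℂ] A)} {L H : Subgroup G} (hLH : L ≤ H) (V : FinRep L)
    (F : EqMod.{u, v, u} α H) :
    Induced hLH (tensor V (F.res hLH)) (tensor (V.ind (Subgroup.inclusion hLH)) F) where
  incl := tensorMap (E := F.res hLH) (F := F) .id (FinRep.indMk _ V 1)
  proj := tensorMap (E := F) (F := F.res hLH) .id (FinRep.indProj hLH V)
  incl_ρ l x := by
    induction x using tensor_induction with
    | zero => simp only [map_zero]
    | add x y hx hy => simp only [map_add, hx, hy]
    | mk x y => exact congrArg (fun z => tmul _ z) (FinRep.indMk_one_ρ hLH V l y)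
  proj_ρ l x := by
    induction x using tensor_induction with
    | zero => simp only [map_zero]
    | add x y hx hy => simp only [map_add, hx, hy]
    | mk x y => exact congrArg (fun z => tmul _ z) (FinRep.indProj_ρ hLH V l y)
  proj_incl x := by
    induction x using tensor_induction with
    | zero => simp only [map_zero]
    | add x y hx hy => simp only [map_add, hx, hy]
    | mk x y =>
      refine congrArg (fun z => tmul _ z)
        ((FinRep.indProj_of_mem hLH V 1 L.one_mem y).trans ?_)
      exact (congrArg (fun l => V.ρ l y) (inv_one : (1 : L)⁻¹ = 1)).trans (by simp)
  proj_incl_of_notMem h hh x := by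
    induction x using tensor_induction with
    | zero => simp only [map_zero]
    | add x y hx hy => simp only [map_add, hx, hy, add_zero]
    | mk x y =>
      refine (congrArg (fun z => tmul _ z) ?_).trans (tmul_zero _)
      rw [FinRep.ind_ρ_indMk]
      refine FinRep.indProj_of_notMem hLH V _ ?_ y
      rwa [one_mul, Subgroup.coe_inv, inv_mem_iff]
  sum_translates {_} y := by
    induction y using tensor_induction with
    | zero => simp only [map_zero, Finset.sum_const_zero, smul_zero]
    | add x y hx hy => simp only [map_add, Finset.sum_add_distrib, smul_add, hx, hy]
    | mk x y =>
      refine (Finset.sum_congr rfl fun h _ => congrArg (fun x => tmul x ((V.ind _).ρ h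
        (FinRep.indMk _ V 1 (FinRep.indProj hLH V ((V.ind _).ρ h⁻¹ y)))))
        (F.ρ.self_inv_apply h x)).trans ?_
      rw [tmul_sum, FinRep.sum_indProj, tmul_nsmul]

/-! ### Extension of scalars -/

namespace EqMod

section Ext

variable {G : Type u} [Group G] {A : Type v} [CStarAlgebra A] {α : G →* (A ≃⋆ₐ[ℂ] A)}
  {B : Type v'} [CStarAlgebra B] {β : G →* (B ≃⋆ₐ[ℂ] B)} (f : A →⋆ₐ[ℂ] B)
  (hf : ∀ g a, f (α g a) = β g (f a)) {L H : Subgroup G}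

/-- The canonical map `E → E ⊗_A B`. -/
def toExt (E : EqMod.{u, v, u} α H) : E.carrier →ₗ[ℂ] (ext f hf E).carrier := extMk f

theorem toExt_smul (E : EqMod.{u, v, u} α H) (a : A) (x : E.carrier) :
    toExt f hf E (op a • x) = op (f a) • toExt f hf E x := extMk_smul f a x

theorem ext_ρ_toExt (E : EqMod.{u, v, u} α H) (h : H) (x : E.carrier) :
    (ext f hf E).ρ h (toExt f hf E x) = toExt f hf E (E.ρ h x) := by
  have h1 := extAct_apply f hf E h 1 x
  rwa [map_one, MulOpposite.op_one, one_smul, one_smul] at h1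

theorem ext_generation {E : EqMod.{u, v, u} α H} {p : (ext f hf E).carrier → Prop}
    (add : ∀ s t, p s → p t → p (s + t)) (smul : ∀ (b : B) t, p t → p (op b • t))
    (mk : ∀ x, p (toExt f hf E x)) (t) : p t := by
  have h0 : p 0 := by
    have h := mk 0
    rwa [map_zero] at h
  exact ext_induction f (p := p) h0 add (fun b x => smul b _ (mk x)) t

variable {f hf} in
theorem ext_linear_ext {E : EqMod.{u, v, u} α H} {T : Type w} [AddCommGroup T] [Module Bᵐᵒᵖ T]
    {φ ψ : (ext f hf E).carrier →ₗ[Bᵐᵒᵖ] T}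
    (h : ∀ x, φ (toExt f hf E x) = ψ (toExt f hf E x)) : φ = ψ := ext_hom_ext f h

/-- The map out of `E ⊗_A B` given by an additive map on `E` that is linear along `f`. -/
def extDesc (E : EqMod.{u, v, u} α H) {T : Type w} [AddCommGroup T] [Module ℂ T] [Module Bᵐᵒᵖ T]
    [IsScalarTower ℂ Bᵐᵒᵖ T] (φ : E.carrier →+ T)
    (hφ : ∀ (a : A) x, φ (op a • x) = op (f a) • φ x) : (ext f hf E).carrier →ₗ[Bᵐᵒᵖ] T :=
  extLift f
    { φ with
      map_smul' := fun c x => by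
        change φ (c • x) = c • φ x
        have h1 := hφ (c • 1) x
        rwa [MulOpposite.op_smul, smul_assoc, MulOpposite.op_one, one_smul, map_smul f, map_one f,
          MulOpposite.op_smul, smul_assoc, MulOpposite.op_one, one_smul] at h1 } hφ

theorem extDesc_toExt (E : EqMod.{u, v, u} α H) {T : Type w} [AddCommGroup T] [Module ℂ T]
    [Module Bᵐᵒᵖ T] [IsScalarTower ℂ Bᵐᵒᵖ T] (φ : E.carrier →+ T)
    (hφ : ∀ (a : A) x, φ (op a • x) = op (f a) • φ x) (x : E.carrier) :
    extDesc f hf E φ hφ (toExt f hf E x) = φ x := extLift_mk f _ hφ x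

/-- An isomorphism out of an extension of scalars, from maps in both directions. -/
theorem ext_iso_of_inverse {E : EqMod.{u, v, u} α H} {F : EqMod.{u, v', max v' u} β H}
    (φ : E.carrier →+ F.carrier) (hφ : ∀ (a : A) x, φ (op a • x) = op (f a) • φ x)
    (hρ : ∀ h x, φ (E.ρ h x) = F.ρ h (φ x)) (ψ : F.carrier →ₗ[Bᵐᵒᵖ] (ext f hf E).carrier)
    (hψ : ∀ x, ψ (φ x) = toExt f hf E x) (hs : ∀ y, extDesc f hf E φ hφ (ψ y) = y) :
    (ext f hf E).Iso F := by
  have h1 : ψ ∘ₗ extDesc f hf E φ hφ = LinearMap.id := ext_linear_ext fun x => by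
    rw [LinearMap.comp_apply, extDesc_toExt, hψ, LinearMap.id_apply]
  refine .of_inverse (extDesc f hf E φ hφ) ψ (fun h t => ?_) (LinearMap.congr_fun h1) hs
  induction t using ext_generation f hf with
  | add s t hs ht => simp only [map_add, hs, ht]
  | smul b t ht => rw [(ext f hf E).ρ_smul, map_smul, map_smul, F.ρ_smul, ht]
  | mk x => rw [ext_ρ_toExt, extDesc_toExt, extDesc_toExt, hρ]

/-- Extension of scalars on `A`-linear maps. -/
def extMap {E : EqMod.{u, v, u} α L} {F : EqMod.{u, v, u} α H}
    (φ : E.carrier →ₗ[Aᵐᵒᵖ] F.carrier) : (ext f hf E).carrier →ₗ[Bᵐᵒᵖ] (ext f hf F).carrier :=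
  extDesc f hf E ((toExt f hf F).toAddMonoidHom.comp φ.toAddMonoidHom) fun a x => by
    change toExt f hf F (φ (op a • x)) = op (f a) • toExt f hf F (φ x)
    rw [map_smul, toExt_smul]

theorem extMap_toExt {E : EqMod.{u, v, u} α L} {F : EqMod.{u, v, u} α H}
    (φ : E.carrier →ₗ[Aᵐᵒᵖ] F.carrier) (x : E.carrier) :
    extMap f hf φ (toExt f hf E x) = toExt f hf F (φ x) := extDesc_toExt f hf E _ _ x

/-- Extension of scalars commutes with induction. -/
def Induced.ext {hLH : L ≤ H} {E : EqMod.{u, v, u} α L} {F : EqMod.{u, v, u} α H}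
    (D : Induced hLH E F) : Induced hLH (E.ext f hf) (F.ext f hf) where
  incl := extMap f hf D.incl
  proj := extMap f hf D.proj
  incl_ρ l x := by
    induction x using ext_generation f hf with
    | add s t hs ht => simp only [map_add, hs, ht]
    | smul b t ht => rw [EqMod.ρ_smul, map_smul, map_smul, EqMod.ρ_smul, ht]; rfl
    | mk x => simp only [ext_ρ_toExt, extMap_toExt, D.incl_ρ]
  proj_ρ l x := by
    induction x using ext_generation f hf with
    | add s t hs ht => simp only [map_add, hs, ht]
    | smul b t ht => rw [EqMod.ρ_smul, map_smul, map_smul, EqMod.ρ_smul, ht]; rfl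
    | mk x => simp only [ext_ρ_toExt, extMap_toExt, D.proj_ρ]
  proj_incl x := by
    induction x using ext_generation f hf with
    | add s t hs ht => simp only [map_add, hs, ht]
    | smul b t ht => rw [map_smul, map_smul, ht]
    | mk x => simp only [extMap_toExt, D.proj_incl]
  proj_incl_of_notMem h hh x := by
    induction x using ext_generation f hf with
    | add s t hs ht => simp only [map_add, hs, ht, add_zero]
    | smul b t ht => rw [map_smul, EqMod.ρ_smul, map_smul, ht, smul_zero]
    | mk x => simp only [ext_ρ_toExt, extMap_toExt, D.proj_incl_of_notMem h hh, map_zero]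
  sum_translates {_} y := by
    induction y using ext_generation f hf with
    | add s t hs ht => simp only [map_add, Finset.sum_add_distrib, smul_add, hs, ht]
    | smul b t ht =>
      simp only [EqMod.ρ_smul, map_smul, Subgroup.coe_inv, act_inv]
      rw [← Finset.smul_sum, ht, smul_comm]
    | mk x =>
      simp only [ext_ρ_toExt, extMap_toExt]
      rw [← map_sum, D.sum_translates, map_nsmul]

theorem ext_res (h : L ≤ H) (E : EqMod.{u, v, u} α H) :
    (ext f hf (E.res h)).Iso ((ext f hf E).res h) := .refl ((ext f hf E).res h)

/-- The identity map from a module to its conjugate. -/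
def toCon (g : G) {K : Subgroup G} (h : K = conjSub g H) (E : EqMod.{u, v, w} α H) :
    E.carrier ≃+ (E.con g h).carrier := AddEquiv.refl E.carrier

theorem smul_toCon (g : G) {K : Subgroup G} (h : K = conjSub g H) (E : EqMod.{u, v, w} α H) (a : A)
    (x : E.carrier) : op a • toCon g h E x = toCon g h E (op (α g⁻¹ a) • x) := rfl

theorem toCon_smul (g : G) {K : Subgroup G} (h : K = conjSub g H) (E : EqMod.{u, v, w} α H) (a : A)
    (x : E.carrier) : toCon g h E (op a • x) = op (α g a) • toCon g h E x := by
  rw [smul_toCon, inv_act]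

theorem toCon_symm_smul (g : G) {K : Subgroup G} (h : K = conjSub g H) (E : EqMod.{u, v, w} α H)
    (a : A) (x : (E.con g h).carrier) :
    (toCon g h E).symm (op a • x) = op (α g⁻¹ a) • (toCon g h E).symm x := rfl

theorem con_ρ_toCon (g : G) {K : Subgroup G} (h : K = conjSub g H) (E : EqMod.{u, v, w} α H)
    (k : K) (x : E.carrier) :
    (E.con g h).ρ k (toCon g h E x) = toCon g h E (E.ρ (conjHom g h k) x) := rfl

theorem ext_con (g : G) {K : Subgroup G} (h : K = conjSub g H) (E : EqMod.{u, v, u} α H) :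
    (ext f hf (E.con g h)).Iso ((ext f hf E).con g h) := by
  have h' : H = conjSub g⁻¹ K := by
    rw [h, conjSub_conjSub, inv_mul_cancel]
    exact (conjSub_eq_self H.one_mem).symm
  -- the inverse is the map `E ⊗_A B → Con_g E ⊗_A B` that is semilinear along `b ↦ g b`
  let F := ext f hf (E.con g h)
  let ψ₀ : (ext f hf E).carrier →ₗ[Bᵐᵒᵖ] (F.con g⁻¹ h').carrier := extDesc f hf E
    ((toCon g⁻¹ h' F).toAddMonoidHom.comp
      ((toExt f hf (E.con g h)).toAddMonoidHom.comp (toCon g h E).toAddMonoidHom)) fun a x => by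
      change toCon g⁻¹ h' F (toExt f hf (E.con g h) (toCon g h E (op a • x))) =
        op (f a) • toCon g⁻¹ h' F (toExt f hf (E.con g h) (toCon g h E x))
      rw [toCon_smul, toExt_smul, smul_toCon, inv_inv, hf]
  have hψ₀ : ∀ x, ψ₀ (toExt f hf E x) =
      toCon g⁻¹ h' F (toExt f hf (E.con g h) (toCon g h E x)) := extDesc_toExt f hf E _ _
  let φ : (E.con g h).carrier →+ ((ext f hf E).con g h).carrier :=
    (toCon g h (ext f hf E)).toAddMonoidHom.comp
      ((toExt f hf E).toAddMonoidHom.comp (toCon g h E).symm.toAddMonoidHom)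
  have hφ : ∀ x, φ x = toCon g h (ext f hf E) (toExt f hf E ((toCon g h E).symm x)) :=
    fun _ => rfl
  have hφ' : ∀ (a : A) x, φ (op a • x) = op (f a) • φ x := fun a x => by
    rw [hφ, hφ, toCon_symm_smul, toExt_smul, smul_toCon, hf]
  refine ext_iso_of_inverse f hf (F := (ext f hf E).con g h) φ hφ' (fun k x => ?_)
    { toFun := fun t => (toCon g⁻¹ h' F).symm (ψ₀ ((toCon g h (ext f hf E)).symm t))
      map_add' := fun s t => by rw [map_add, map_add, map_add]
      map_smul' := fun b t => ?_ } (fun x => ?_) fun t => ?_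
  · obtain ⟨x, rfl⟩ := (toCon g h E).surjective x
    rw [con_ρ_toCon, hφ, hφ, AddEquiv.symm_apply_apply, AddEquiv.symm_apply_apply, con_ρ_toCon,
      ext_ρ_toExt]
  · obtain ⟨b, rfl⟩ := MulOpposite.op_surjective b
    rw [toCon_symm_smul, map_smul, toCon_symm_smul, inv_inv, act_inv]
    rfl
  · change (toCon g⁻¹ h' F).symm (ψ₀ ((toCon g h (ext f hf E)).symm (φ x))) = _
    rw [hφ, AddEquiv.symm_apply_apply, hψ₀, AddEquiv.symm_apply_apply, AddEquiv.apply_symm_apply]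
  · obtain ⟨t, rfl⟩ := (toCon g h (ext f hf E)).surjective t
    change extDesc f hf (E.con g h) φ hφ' ((toCon g⁻¹ h' F).symm
      (ψ₀ ((toCon g h (ext f hf E)).symm (toCon g h (ext f hf E) t)))) = _
    rw [AddEquiv.symm_apply_apply]
    induction t using ext_generation f hf with
    | add s t hs ht => simp only [map_add, hs, ht]
    | smul b t ht => rw [map_smul, toCon_symm_smul, map_smul, ht, inv_inv, ← toCon_smul]
    | mk x => rw [hψ₀, AddEquiv.symm_apply_apply, extDesc_toExt, hφ, AddEquiv.symm_apply_apply]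

end Ext

section Tensor

variable {G : Type (max u v')} [Group G] {A : Type v} [CStarAlgebra A] {α : G →* (A ≃⋆ₐ[ℂ] A)}
  {B : Type v'} [CStarAlgebra B] {β : G →* (B ≃⋆ₐ[ℂ] B)} (f : A →⋆ₐ[ℂ] B)
  (hf : ∀ g a, f (α g a) = β g (f a)) {L H : Subgroup G}

theorem ext_ind [Finite G] (hLH : L ≤ H) (E : EqMod.{max u v', v, max u v'} α L) :
    (ext f hf (E.ind hLH)).Iso ((ext f hf E).ind hLH) :=
  ((inducedInd hLH E).ext f hf).iso

theorem ext_tensor (V : FinRep H) (E : EqMod.{max u v', v, max u v'} α H) :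
    (ext f hf (tensor V E)).Iso (tensor V (ext f hf E)) := by
  let F := ext f hf (tensor V E)
  let φ : (tensor V E).carrier →ₗ[ℂ] (tensor V (ext f hf E)).carrier :=
    TensorProduct.map (toExt f hf E) .id
  have hφ : ∀ x y, φ (tmul x y) = tmul (toExt f hf E x) y := fun _ _ => rfl
  have hφ' : ∀ (a : A) x, φ.toAddMonoidHom (op a • x) = op (f a) • φ.toAddMonoidHom x := by
    intro a x
    change φ (op a • x) = op (f a) • φ x
    induction x using tensor_induction with
    | zero => simp only [map_zero, smul_zero]
    | add s t hs ht => simp only [map_add, smul_add, hs, ht]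
    | mk x y => exact congrArg (fun x => tmul x y) (toExt_smul f hf E a x)
  let χ : (ext f hf E).carrier →ₗ[Bᵐᵒᵖ] V.carrier →ₗ[ℂ] F.carrier :=
    extDesc f hf E
      { toFun := fun x => toExt f hf (tensor V E) ∘ₗ TensorProduct.mk ℂ E.carrier V.carrier x
        map_zero' := LinearMap.ext fun y =>
          (congrArg (toExt f hf (tensor V E)) (zero_tmul y)).trans (map_zero _)
        map_add' := fun x y => LinearMap.ext fun z =>
          (congrArg (toExt f hf (tensor V E)) (add_tmul x y z)).trans (map_add _ _ _) }
      fun a x => LinearMap.ext fun y => toExt_smul f hf (tensor V E) a (tmul x y)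
  have hχ : ∀ x y, χ (toExt f hf E x) y = toExt f hf (tensor V E) (tmul x y) := fun x y =>
    LinearMap.congr_fun (extDesc_toExt f hf E _ _ x) y
  let ψ : (tensor V (ext f hf E)).carrier →ₗ[Bᵐᵒᵖ] F.carrier :=
    TensorProduct.AlgebraTensorModule.lift χ
  have hψ : ∀ x y, ψ (tmul x y) = χ x y := fun _ _ => rfl
  refine ext_iso_of_inverse f hf (F := tensor V (ext f hf E)) φ.toAddMonoidHom hφ'
    (fun h x => ?_) ψ (fun x => ?_) fun t => ?_
  · change φ _ = _
    induction x using tensor_induction with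
    | zero => simp only [map_zero]
    | add s t hs ht => simp only [map_add, hs, ht]
    | mk x y => exact congrArg (fun x => tmul x _) (ext_ρ_toExt f hf E h x).symm
  · change ψ (φ x) = _
    induction x using tensor_induction with
    | zero => simp only [map_zero]
    | add s t hs ht => simp only [map_add, hs, ht]
    | mk x y => rw [hφ, hψ, hχ]
  · induction t using tensor_induction with
    | zero => simp only [map_zero]
    | add s t hs ht => simp only [map_add, hs, ht]
    | mk t y =>
      induction t using ext_generation f hf with
      | add s t hs ht =>
        simp only [add_tmul, map_add, hs, ht]
      | smul b t ht =>
        have h1 : (tmul (op b • t) y : (tensor V (ext f hf E)).carrier) = op b • tmul t y := rfl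
        rw [h1, map_smul, map_smul, ht]
      | mk x =>
        rw [hψ, hχ, extDesc_toExt]
        rfl

end Tensor

theorem ext_id {G : Type (max u v)} [Group G] {A : Type v} [CStarAlgebra A]
    {α : G →* (A ≃⋆ₐ[ℂ] A)} {H : Subgroup G} (E : EqMod.{max u v, v, max u v} α H) :
    (ext (β := α) (StarAlgHom.id ℂ A) (fun _ _ => rfl) E).Iso E := by
  refine ext_iso_of_inverse (StarAlgHom.id ℂ A) (fun _ _ => rfl) (F := E) (.id _)
    (fun _ _ => rfl) (fun _ _ => rfl)
    { toExt (StarAlgHom.id ℂ A) (fun _ _ => rfl) E with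
      map_smul' := fun a x => toExt_smul (StarAlgHom.id ℂ A) (fun _ _ => rfl) E (unop a) x }
    (fun _ => rfl) fun y => extDesc_toExt (StarAlgHom.id ℂ A) (fun _ _ => rfl) E _ _ y

section Comp

variable {G : Type (max u v v' w)} [Group G] {A : Type v} [CStarAlgebra A]
  {α : G →* (A ≃⋆ₐ[ℂ] A)} {H : Subgroup G} {B : Type v'} [CStarAlgebra B] {β : G →* (B ≃⋆ₐ[ℂ] B)}
  {C : Type w} [CStarAlgebra C] {γ : G →* (C ≃⋆ₐ[ℂ] C)}

theorem ext_comp (f : A →⋆ₐ[ℂ] B) (hf : ∀ g a, f (α g a) = β g (f a)) (f' : B →⋆ₐ[ℂ] C)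
    (hf' : ∀ g b, f' (β g b) = γ g (f' b)) (k : A →⋆ₐ[ℂ] C)
    (hk : ∀ g a, k (α g a) = γ g (k a)) (hfk : ∀ a, f' (f a) = k a)
    (E : EqMod.{max u v v' w, v, max u v v' w} α H) :
    (ext k hk E).Iso (ext f' hf' (ext f hf E)) := by
  let F := ext f' hf' (ext f hf E)
  -- `E ⊗_A C` as a `B`-module
  let _ : Module Bᵐᵒᵖ (ext k hk E).carrier := Module.compHom _ (RingHom.op (f' : B →+* C))
  have smul_def : ∀ (b : B) (t : (ext k hk E).carrier), op b • t = op (f' b) • t :=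
    fun _ _ => rfl
  have _ : IsScalarTower ℂ Bᵐᵒᵖ (ext k hk E).carrier := ⟨fun c b t => by
    obtain ⟨b, rfl⟩ := MulOpposite.op_surjective b
    rw [← MulOpposite.op_smul, smul_def, smul_def, map_smul f', MulOpposite.op_smul, smul_assoc]⟩
  let χ : (ext f hf E).carrier →ₗ[Bᵐᵒᵖ] (ext k hk E).carrier :=
    extDesc f hf E (toExt k hk E).toAddMonoidHom fun a x => by
      rw [smul_def, hfk]
      exact toExt_smul k hk E a x
  have hχ : ∀ x, χ (toExt f hf E x) = toExt k hk E x := extDesc_toExt f hf E _ _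
  let ψ : F.carrier →ₗ[Cᵐᵒᵖ] (ext k hk E).carrier :=
    extDesc f' hf' (ext f hf E) χ.toAddMonoidHom fun b t => χ.map_smul (op b) t
  have hψ : ∀ t, ψ (toExt f' hf' (ext f hf E) t) = χ t := extDesc_toExt f' hf' _ _ _
  let φ : E.carrier →+ F.carrier :=
    (toExt f' hf' (ext f hf E)).toAddMonoidHom.comp (toExt f hf E).toAddMonoidHom
  have hφ : ∀ x, φ x = toExt f' hf' (ext f hf E) (toExt f hf E x) := fun _ => rfl
  have hφ' : ∀ (a : A) x, φ (op a • x) = op (k a) • φ x := fun a x => by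
    rw [hφ, hφ, toExt_smul, toExt_smul, hfk]
  refine ext_iso_of_inverse k hk (F := F) φ hφ' (fun h x => ?_) ψ (fun x => ?_) fun t => ?_
  · rw [hφ, hφ, ext_ρ_toExt, ext_ρ_toExt]
  · rw [hφ, hψ, hχ]
  · induction t using ext_generation f' hf' with
    | add s t hs ht => simp only [map_add, hs, ht]
    | smul b t ht => rw [map_smul, map_smul, ht]
    | mk t =>
      rw [hψ]
      induction t using ext_generation f hf with
      | add s t hs ht => simp only [map_add, hs, ht]
      | smul b t ht => rw [map_smul, smul_def, map_smul, ht, toExt_smul]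
      | mk x => rw [hχ, extDesc_toExt, hφ]

end Comp

end EqMod

/-! ### Inflation along the projection to a direct factor -/

/-- A splitting of a unital `*`-homomorphism `q : C → D` as the projection to a direct factor: a
section that identifies `D` with the ideal of `C` generated by the central idempotent `s 1`. -/
structure FactorSection {C : Type v} {D : Type v'} [CStarAlgebra C] [CStarAlgebra D]
    (q : C →⋆ₐ[ℂ] D) where
  s : D →ₗ[ℂ] C
  q_s : ∀ d, q (s d) = d
  s_q : ∀ c, s (q c) = s 1 * c
  central : ∀ c, s 1 * c = c * s 1

namespace FactorSection

variable {C : Type v} {D : Type v'} [CStarAlgebra C] [CStarAlgebra D] {q : C →⋆ₐ[ℂ] D}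
  (Q : FactorSection q)

theorem s_mul (d : D) (c : C) : Q.s (d * q c) = Q.s d * c := by
  rw [← Q.q_s d, ← map_mul, Q.s_q, Q.s_q, mul_assoc]

theorem mul_s (c : C) (d : D) : Q.s (q c * d) = c * Q.s d := by
  rw [← Q.q_s d, ← map_mul, Q.s_q, Q.s_q, ← mul_assoc, Q.central, mul_assoc]

end FactorSection

namespace EqMod

section Inflate

variable {G : Type u} [Group G] {C : Type v} [CStarAlgebra C] {γ : G →* (C ≃⋆ₐ[ℂ] C)}
  {D : Type v'} [CStarAlgebra D] {δ : G →* (D ≃⋆ₐ[ℂ] D)} {q : C →⋆ₐ[ℂ] D} (Q : FactorSection q)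
  (hq : ∀ g c, q (γ g c) = δ g (q c)) {H : Subgroup G}

/-- The `(H, C)`-module given by an `(H, D)`-module through the projection `q : C → D` to a direct
factor. It is projective because `D` is a direct summand of the module `C`. -/
def inflate (F : EqMod.{u, v', w} δ H) : EqMod.{u, v, w} γ H :=
  letI : Module Cᵐᵒᵖ F.carrier := Module.compHom F.carrier (RingHom.op (q : C →+* D))
  have smul_def : ∀ (c : C) (x : F.carrier), op c • x = op (q c) • x := fun _ _ => rfl
  { carrier := F.carrier
    tower := ⟨fun z c x => by
      obtain ⟨c, rfl⟩ := MulOpposite.op_surjective c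
      rw [← MulOpposite.op_smul, smul_def, smul_def, map_smul q, MulOpposite.op_smul, smul_assoc]⟩
    finite := by
      obtain ⟨t, ht⟩ := Module.Finite.fg_top (R := Dᵐᵒᵖ) (M := F.carrier)
      refine ⟨⟨t, eq_top_iff.2 fun x _ => ?_⟩⟩
      have hx : x ∈ Submodule.span Dᵐᵒᵖ (t : Set F.carrier) := ht ▸ Submodule.mem_top
      induction hx using Submodule.span_induction with
      | mem x hx => exact Submodule.subset_span hx
      | zero => exact Submodule.zero_mem _
      | add x y _ _ hx hy => exact Submodule.add_mem _ (hx trivial) (hy trivial)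
      | smul d x _ hx =>
        have h1 := Submodule.smul_mem _ (op (Q.s (unop d))) (hx trivial)
        rwa [smul_def, Q.q_s] at h1
    projective := by
      -- a splitting over `D`, followed by the section on coefficients, is one over `C`
      obtain ⟨σ, hσ⟩ := Module.projective_def.1 (inferInstance : Module.Projective Dᵐᵒᵖ F.carrier)
      let s' : Dᵐᵒᵖ →+ Cᵐᵒᵖ :=
        { toFun := fun d => op (Q.s (unop d))
          map_zero' := by rw [MulOpposite.unop_zero, map_zero, MulOpposite.op_zero]
          map_add' := fun d d' => by rw [MulOpposite.unop_add, map_add, MulOpposite.op_add] }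
      refine Module.projective_def.2 ⟨
        { toFun := fun x => Finsupp.mapRange.addMonoidHom s' (σ x)
          map_add' := fun x y => by rw [map_add, map_add]
          map_smul' := fun c x => Finsupp.ext fun y => ?_ }, fun x => ?_⟩
      · obtain ⟨c, rfl⟩ := MulOpposite.op_surjective c
        rw [smul_def, map_smul]
        change op (Q.s (unop (σ x y) * q c)) = op (Q.s (unop (σ x y)) * c)
        rw [Q.s_mul]
      · refine Eq.trans ?_ (hσ x)
        change Finsupp.linearCombination Cᵐᵒᵖ id (Finsupp.mapRange s' s'.map_zero (σ x)) = _
        rw [Finsupp.linearCombination_apply, Finsupp.linearCombination_apply]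
        refine (Finsupp.sum_mapRange_index (h := fun y a => a • id y)
          fun y => zero_smul _ _).trans ?_
        refine Finsupp.sum_congr fun y _ => ?_
        change op (q (Q.s _)) • y = _
        rw [Q.q_s]
        rfl
    ρ := F.ρ
    ρ_smul := fun h c x => by
      rw [smul_def, smul_def, F.ρ_smul, hq] }

/-- The identity map from a module to its inflation. -/
def toInflate (F : EqMod.{u, v', w} δ H) : F.carrier ≃+ (inflate Q hq F).carrier :=
  AddEquiv.refl F.carrier

theorem smul_toInflate (F : EqMod.{u, v', w} δ H) (c : C) (x : F.carrier) :
    op c • toInflate Q hq F x = toInflate Q hq F (op (q c) • x) := rfl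

theorem inflate_congr {E F : EqMod.{u, v', w} δ H} :
    E.Iso F → (inflate Q hq E).Iso (inflate Q hq F) := fun ⟨e, he⟩ =>
  ⟨{ toFun := fun x => e x
     invFun := fun x => e.symm x
     map_add' := e.map_add
     map_smul' := fun c x => e.map_smul (op (q (unop c))) x
     left_inv := e.left_inv
     right_inv := e.right_inv }, he⟩

theorem inflate_sum (E F : EqMod.{u, v', w} δ H) :
    (inflate Q hq (E.sum F)).Iso ((inflate Q hq E).sum (inflate Q hq F)) :=
  ⟨{ toFun := fun x => x
     invFun := fun x => x
     map_add' := fun _ _ => rfl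
     map_smul' := fun _ _ => rfl
     left_inv := fun _ => rfl
     right_inv := fun _ => rfl }, fun _ _ => rfl⟩

theorem toExt_surjective (hs : Function.Surjective q) (E : EqMod.{u, v, u} γ H) :
    Function.Surjective (toExt q hq E) := by
  intro t
  induction t using ext_generation q hq with
  | add s t hs ht =>
    obtain ⟨x, rfl⟩ := hs
    obtain ⟨y, rfl⟩ := ht
    exact ⟨x + y, map_add _ x y⟩
  | smul d t ht =>
    obtain ⟨x, rfl⟩ := ht
    obtain ⟨c, rfl⟩ := hs d
    exact ⟨op c • x, toExt_smul q hq E c x⟩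
  | mk x => exact ⟨x, rfl⟩

/-- The elements of `E` that vanish in `E ⊗_C D` are annihilated by the central idempotent that
belongs to the factor `D`. -/
theorem smul_eq_zero_of_toExt_eq_zero (E : EqMod.{u, v, u} γ H) (x : E.carrier)
    (hx : toExt q hq E x = 0) : op (Q.s 1) • x = 0 := by
  -- the map `E ⊗_C D → E` that takes `y ⊗ d` to `y s(d)`
  let Φ : D ⊗[ℂ] E.carrier →ₗ[ℂ] E.carrier := TensorProduct.lift
    (LinearMap.mk₂ ℂ (fun d y => op (Q.s d) • y)
      (fun d d' y => by rw [map_add, MulOpposite.op_add, add_smul])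
      (fun c d y => by rw [map_smul, MulOpposite.op_smul, smul_assoc])
      (fun d y y' => smul_add _ _ _) (fun c d y => smul_comm _ _ _))
  have hΦ : ∀ d y, Φ (d ⊗ₜ[ℂ] y) = op (Q.s d) • y := fun _ _ => rfl
  have hsmul : ∀ (d : Dᵐᵒᵖ) t, Φ (d • t) = op (Q.s (unop d)) • Φ t := fun d t => by
    induction t with
    | zero => simp
    | add s t hs ht => rw [smul_add, map_add, map_add, smul_add, hs, ht]
    | tmul d' y =>
      change Φ ((d' * unop d) ⊗ₜ[ℂ] y) = _
      rw [hΦ, hΦ, ← mul_smul, ← MulOpposite.op_mul, ← Q.s_mul, Q.q_s]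
  have hker : ∀ t ∈ scalarRel q E.carrier, Φ t = 0 := fun t ht => by
    induction ht using Submodule.span_induction with
    | mem t ht =>
      obtain ⟨c, d, y, rfl⟩ := ht
      rw [map_sub, hΦ, hΦ, Q.mul_s, MulOpposite.op_mul, mul_smul, sub_self]
    | zero => exact map_zero Φ
    | add s t _ _ hs ht => rw [map_add, hs, ht, add_zero]
    | smul d t _ ht => rw [hsmul, ht, smul_zero]
  have h1 : (1 : D) ⊗ₜ[ℂ] x ∈ scalarRel q E.carrier :=
    (Submodule.Quotient.mk_eq_zero (scalarRel q E.carrier)).1 hx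
  exact hker _ h1

/-- Extension of scalars along `q` is a left inverse of inflation. -/
theorem ext_inflate {G : Type (max u v')} [Group G] {γ : G →* (C ≃⋆ₐ[ℂ] C)}
    {δ : G →* (D ≃⋆ₐ[ℂ] D)} (hq : ∀ g c, q (γ g c) = δ g (q c)) {H : Subgroup G}
    (F : EqMod.{max u v', v', max u v'} δ H) : (ext q hq (inflate Q hq F)).Iso F := by
  refine ext_iso_of_inverse q hq (F := F) (toInflate Q hq F).symm.toAddMonoidHom
    (fun _ _ => rfl) (fun _ _ => rfl)
    { toFun := fun x => toExt q hq (inflate Q hq F) (toInflate Q hq F x)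
      map_add' := fun x y => by rw [map_add, map_add]
      map_smul' := fun d x => ?_ } (fun _ => rfl) fun y => extDesc_toExt q hq _ _ _ _
  obtain ⟨d, rfl⟩ := MulOpposite.op_surjective d
  have h1 := toExt_smul q hq (inflate Q hq F) (Q.s d) (toInflate Q hq F x)
  rwa [smul_toInflate, Q.q_s] at h1

/-- A module over one factor becomes zero over another one. -/
theorem ext_inflate_subsingleton {D' : Type w'} [CStarAlgebra D'] {δ' : G →* (D' ≃⋆ₐ[ℂ] D')}
    {q' : C →⋆ₐ[ℂ] D'} (hq' : ∀ g c, q' (γ g c) = δ' g (q' c)) (h0 : q' (Q.s 1) = 0)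
    (F : EqMod.{u, v', u} δ H) : Subsingleton (ext q' hq' (inflate Q hq F)).carrier := by
  refine subsingleton_of_forall_eq 0 fun t => ?_
  induction t using ext_generation q' hq' with
  | add s t hs ht => rw [hs, ht, add_zero]
  | smul d t ht => rw [ht, smul_zero]
  | mk x =>
    obtain ⟨x, rfl⟩ := (toInflate Q hq F).surjective x
    have h1 := toExt_smul q' hq' (inflate Q hq F) (Q.s 1) (toInflate Q hq F x)
    rwa [smul_toInflate, Q.q_s, MulOpposite.op_one, one_smul, h0, MulOpposite.op_zero,
      zero_smul] at h1

/-- A module over a product of two algebras is the direct sum of modules over the factors. -/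
theorem iso_sum_inflate {G : Type (max u v' w')} [Group G] {γ : G →* (C ≃⋆ₐ[ℂ] C)}
    {δ : G →* (D ≃⋆ₐ[ℂ] D)} (hq : ∀ g c, q (γ g c) = δ g (q c)) {H : Subgroup G}
    {D' : Type w'} [CStarAlgebra D'] {δ' : G →* (D' ≃⋆ₐ[ℂ] D')}
    {q' : C →⋆ₐ[ℂ] D'} (Q' : FactorSection q') (hq' : ∀ g c, q' (γ g c) = δ' g (q' c))
    (h1 : Q.s 1 + Q'.s 1 = 1) (h0 : q' (Q.s 1) = 0) (h0' : q (Q'.s 1) = 0)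
    (E : EqMod.{max u v' w', v, max u v' w'} γ H) :
    E.Iso ((inflate Q hq (ext q hq E)).sum (inflate Q' hq' (ext q' hq' E))) := by
  refine .of_bijective
    (F := (inflate Q hq (ext q hq E)).sum (inflate Q' hq' (ext q' hq' E)))
    { toFun := fun x => (toInflate Q hq _ (toExt q hq E x), toInflate Q' hq' _ (toExt q' hq' E x))
      map_add' := fun x y => by simp only [map_add]; rfl
      map_smul' := fun c x => ?_ } (fun h x => ?_) ⟨?_, ?_⟩
  · obtain ⟨c, rfl⟩ := MulOpposite.op_surjective c
    rw [toExt_smul, toExt_smul]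
    rfl
  · exact Prod.ext (congrArg (toInflate Q hq _) (ext_ρ_toExt q hq E h x).symm)
      (congrArg (toInflate Q' hq' _) (ext_ρ_toExt q' hq' E h x).symm)
  · refine (injective_iff_map_eq_zero _).2 fun x hx => ?_
    have hx1 : op (Q.s 1) • x = 0 :=
      smul_eq_zero_of_toExt_eq_zero Q hq E x (congrArg Prod.fst hx)
    have hx2 : op (Q'.s 1) • x = 0 :=
      smul_eq_zero_of_toExt_eq_zero Q' hq' E x (congrArg Prod.snd hx)
    rw [← one_smul Cᵐᵒᵖ x, ← MulOpposite.op_one, ← h1, MulOpposite.op_add, add_smul, hx1, hx2,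
      add_zero]
  · rintro ⟨t, t'⟩
    obtain ⟨x, hx⟩ := toExt_surjective hq (fun d => ⟨Q.s d, Q.q_s d⟩) E t
    obtain ⟨y, hy⟩ := toExt_surjective hq' (fun d => ⟨Q'.s d, Q'.q_s d⟩) E t'
    refine ⟨op (Q.s 1) • x + op (Q'.s 1) • y, Prod.ext ?_ ?_⟩
    · change toExt q hq E (op (Q.s 1) • x + op (Q'.s 1) • y) = t
      rw [map_add, toExt_smul, toExt_smul, Q.q_s, h0', MulOpposite.op_one, one_smul,
        MulOpposite.op_zero, zero_smul, add_zero, hx]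
    · change toExt q' hq' E (op (Q.s 1) • x + op (Q'.s 1) • y) = t'
      rw [map_add, toExt_smul, toExt_smul, Q'.q_s, h0, MulOpposite.op_one, one_smul,
        MulOpposite.op_zero, zero_smul, zero_add, hy]

end Inflate

end EqMod

namespace KTilde

section Inflate

variable {C : Type v} [CStarAlgebra C] {D : Type v'} [CStarAlgebra D] {q : C →⋆ₐ[ℂ] D}
  (Q : FactorSection q)

/-- Inflation `K̃^H(D) → K̃^H(C)` along the projection to a direct factor. -/
def inflate {G : Type u} [Group G] {γ : G →* (C ≃⋆ₐ[ℂ] C)} {δ : G →* (D ≃⋆ₐ[ℂ] D)}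
    (hq : ∀ g c, q (γ g c) = δ g (q c)) (H : Subgroup G) :
    KTilde.{u, v', w} δ H →+ KTilde.{u, v, w} γ H :=
  GroGrp.map (EqMod.inflate Q hq) (fun _ _ => EqMod.inflate_congr Q hq) (EqMod.inflate_sum Q hq)

@[simp]
theorem inflate_of {G : Type u} [Group G] {γ : G →* (C ≃⋆ₐ[ℂ] C)} {δ : G →* (D ≃⋆ₐ[ℂ] D)}
    (hq : ∀ g c, q (γ g c) = δ g (q c)) {H : Subgroup G} (F : EqMod.{u, v', w} δ H) :
    inflate Q hq H (of F) = of (EqMod.inflate Q hq F) :=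
  GroGrp.map_cls (EqMod.inflate Q hq) _ _ F

theorem map_inflate {G : Type (max u v')} [Group G] {γ : G →* (C ≃⋆ₐ[ℂ] C)}
    {δ : G →* (D ≃⋆ₐ[ℂ] D)} (hq : ∀ g c, q (γ g c) = δ g (q c)) {H : Subgroup G}
    (x : KTilde.{max u v', v', max u v'} δ H) : map q hq H (inflate Q hq H x) = x := by
  induction x using induction with
  | of F => rw [inflate_of, map_of]; exact of_eq (EqMod.ext_inflate.{u} Q hq F)
  | sub a b ha hb => rw [map_sub, map_sub, ha, hb]

variable {G : Type (max u v' w')} [Group G] {γ : G →* (C ≃⋆ₐ[ℂ] C)}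
  {δ : G →* (D ≃⋆ₐ[ℂ] D)} (hq : ∀ g c, q (γ g c) = δ g (q c)) {H : Subgroup G}
  {D' : Type w'} [CStarAlgebra D'] {δ' : G →* (D' ≃⋆ₐ[ℂ] D')}
  {q' : C →⋆ₐ[ℂ] D'} (Q' : FactorSection q') (hq' : ∀ g c, q' (γ g c) = δ' g (q' c))

theorem map_inflate_eq_zero (h0 : q' (Q.s 1) = 0)
    (x : KTilde.{max u v' w', v', max u v' w'} δ H) :
    map q' hq' H (inflate Q hq H x) = 0 := by
  induction x using induction with
  | of F =>
    rw [inflate_of, map_of]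
    have := EqMod.ext_inflate_subsingleton Q hq hq' h0 F
    exact of_eq_zero _
  | sub a b ha hb => rw [map_sub, map_sub, ha, hb, sub_zero]

theorem inflate_map_add_inflate_map (h1 : Q.s 1 + Q'.s 1 = 1) (h0 : q' (Q.s 1) = 0)
    (h0' : q (Q'.s 1) = 0) (x : KTilde.{max u v' w', v, max u v' w'} γ H) :
    inflate Q hq H (map q hq H x) + inflate Q' hq' H (map q' hq' H x) = x := by
  induction x using induction with
  | of E =>
    rw [map_of, map_of, inflate_of, inflate_of, ← of_sum]
    exact of_eq (EqMod.iso_sum_inflate.{u} Q hq Q' hq' h1 h0 h0' E).symm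
  | sub a b ha hb =>
    simp only [map_sub]
    rw [sub_add_sub_comm, ha, hb]

end Inflate

end KTilde

/-! ### The Mackey structure on `K̃` -/

/-- The relations of a Mackey functor can be checked after an injective map to a Mackey functor. -/
theorem MackeyData.IsMackey.of_injective {G : Type u} [Group G] {M : MackeyData.{u, w} G}
    {N : MackeyData.{u, w'} G} (hN : N.IsMackey) (φ : ∀ H, M.obj H →+ N.obj H)
    (inj : ∀ H, Function.Injective (φ H))
    (res : ∀ {L H : Subgroup G} (h : L ≤ H) m, φ L (M.res h m) = N.res h (φ H m))
    (ind : ∀ {L H : Subgroup G} (h : L ≤ H) m, φ H (M.ind h m) = N.ind h (φ L m))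
    (con : ∀ (g : G) {H K : Subgroup G} (h : K = conjSub g H) m,
      φ K (M.con g h m) = N.con g h (φ H m)) : M.IsMackey where
  res_res hLH hHK m := inj _ (by simp only [res, hN.res_res])
  ind_ind hLH hHK m := inj _ (by simp only [ind, hN.ind_ind])
  con_con f g H m := inj _ (by simp only [con, hN.con_con])
  con_ind g L H hLH m := inj _ (by simp only [con, ind, hN.con_ind])
  con_res g L H hLH m := inj _ (by simp only [con, res, hN.con_res])
  ind_self H m := inj _ (by simp only [ind, hN.ind_self])
  res_self H m := inj _ (by simp only [res, hN.res_self])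
  con_self hh m := inj _ (by simp only [con, hN.con_self hh])
  mackey hL hK S hS m := inj _ (by
    simp only [res, ind, con, map_sum, hN.mackey hL hK S hS])

namespace KTilde

section Mackey

variable {G : Type u} [Group G] [Finite G] {A : Type v} [CStarAlgebra A]
  (α : G →* (A ≃⋆ₐ[ℂ] A))

/-- The groups `K̃^H(A)` with restriction, induction and conjugation. -/
def mackeyData : MackeyData.{u, max u v (u + 1)} G where
  obj H := KTilde.{u, v, u} α H
  res h := res h
  ind h := ind h
  con g _ _ h := con g h

theorem isMackey : (mackeyData α).IsMackey where
  res_res {L H K} hLH hHK m := by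
    change res hLH (res hHK m) = res (hLH.trans hHK) m
    refine DFunLike.congr_fun (f := (res hLH).comp (res hHK)) (hom_ext fun E => ?_) m
    rw [AddMonoidHom.comp_apply, res_of, res_of, res_of]
    exact of_eq (.refl (E.res (hLH.trans hHK)))
  ind_ind {L H K} hLH hHK m := by
    change ind hHK (ind hLH m) = ind (hLH.trans hHK) m
    refine DFunLike.congr_fun (f := (ind hHK).comp (ind hLH)) (hom_ext fun E => ?_) m
    simpa using of_eq (E.ind_ind hLH hHK)
  con_con f g H m := by
    change con f _ (con g _ m) = con (f * g) _ m
    refine DFunLike.congr_fun (f := (con f _).comp (con g _)) (hom_ext fun E => ?_) m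
    rw [AddMonoidHom.comp_apply, con_of, con_of, con_of]
    exact of_eq (E.con_con f g)
  con_ind g L H hLH m := by
    change con g _ (ind hLH m) = ind _ (con g _ m)
    refine DFunLike.congr_fun (f := (con g _).comp (ind hLH))
      (g := (ind (conjSub_mono g hLH)).comp (con g rfl)) (hom_ext fun E => ?_) m
    simpa using of_eq (E.con_ind g hLH)
  con_res g L H hLH m := by
    change con g _ (res hLH m) = res _ (con g _ m)
    refine DFunLike.congr_fun (f := (con g _).comp (res hLH))
      (g := (res (conjSub_mono g hLH)).comp (con g rfl)) (hom_ext fun E => ?_) m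
    rw [AddMonoidHom.comp_apply, AddMonoidHom.comp_apply, res_of, con_of, con_of, res_of]
    exact of_eq (.refl ((E.con g (K := conjSub g H) rfl).res (conjSub_mono g hLH)))
  ind_self H m := by
    change ind (le_refl H) m = m
    refine DFunLike.congr_fun (g := AddMonoidHom.id _) (hom_ext fun E => ?_) m
    simpa using of_eq E.ind_self
  res_self H m := by
    change res (le_refl H) m = m
    refine DFunLike.congr_fun (g := AddMonoidHom.id _) (hom_ext fun E => ?_) m
    rw [res_of, AddMonoidHom.id_apply]
    exact of_eq (.refl E)
  con_self {h H} hh m := by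
    change con h (conjSub_eq_self hh).symm m = m
    refine DFunLike.congr_fun (g := AddMonoidHom.id _) (hom_ext fun E => ?_) m
    simpa using of_eq (E.con_self hh)
  mackey {L K H} hL hK S hS m := by
    change res hL (ind hK m) = ∑ x ∈ S, ind (inf_le_left : L ⊓ conjSub x K ≤ L)
      (con x (inf_conjSub x L K) (res (inf_le_right : conjSub x⁻¹ L ⊓ K ≤ K) m))
    induction m using induction with
    | of E => simpa using E.mackey hL hK S hS
    | sub a b ha hb => simp only [map_sub, ha, hb, Finset.sum_sub_distrib]

end Mackey

/-! ### The action of the representation ring -/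

section Act

variable {G : Type u} [Group G] {A : Type v} [CStarAlgebra A] {α : G →* (A ≃⋆ₐ[ℂ] A)}
  {L H K : Subgroup G}

/-- Two biadditive functions on `R(H') × K̃^H(A)` agree if they do so on classes of representations
and modules. -/
theorem biadditive_ext {H' : Type u} [Group H'] {T : Type w'} [AddCommGroup T]
    {f g : RepRing H' → KTilde.{u, v, w} α H → T}
    (hf : ∀ r s x, f (r - s) x = f r x - f s x) (hf' : ∀ r x y, f r (x - y) = f r x - f r y)
    (hg : ∀ r s x, g (r - s) x = g r x - g s x) (hg' : ∀ r x y, g r (x - y) = g r x - g r y)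
    (h : ∀ V E, f (.of V) (of E) = g (.of V) (of E)) (r : RepRing H') (x : KTilde.{u, v, w} α H) :
    f r x = g r x := by
  induction r using RepRing.induction with
  | sub r s hr hs => rw [hf, hg, hr, hs]
  | of V =>
    induction x using induction with
    | sub x y hx hy => rw [hf', hg', hx, hy]
    | of E => exact h V E

theorem act_sub (r s : RepRing H) (x : KTilde.{u, v, u} α H) :
    act (r - s) x = act r x - act s x := by
  rw [map_sub, AddMonoidHom.sub_apply]

theorem one_act (x : KTilde.{u, v, u} α H) : act 1 x = x := by
  refine DFunLike.congr_fun (f := act 1) (g := AddMonoidHom.id _) (hom_ext fun E => ?_) x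
  exact (act_of _ E).trans (of_eq E.tensor_triv)

theorem mul_act (r s : RepRing H) (x : KTilde.{u, v, u} α H) :
    act (r * s) x = act r (act s x) := by
  induction r using RepRing.induction with
  | sub a b ha hb => rw [sub_mul, act_sub, act_sub, ha, hb]
  | of V =>
    induction s using RepRing.induction with
    | sub a b ha hb => rw [mul_sub, act_sub, act_sub, map_sub, ha, hb]
    | of W =>
      induction x using induction with
      | sub x y hx hy => rw [map_sub, map_sub, map_sub, hx, hy]
      | of E =>
        rw [RepRing.of_mul_of, act_of, act_of, act_of]
        exact of_eq (E.tensor_tensor V W)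

/-- The `R(H)`-module structure of `K̃^H(A)`. -/
instance : Module (RepRing H) (KTilde.{u, v, u} α H) where
  smul r x := act r x
  one_smul := one_act
  mul_smul := mul_act
  smul_zero r := map_zero (act r)
  smul_add r := map_add (act r)
  add_smul r s x := by
    change act (r + s) x = act r x + act s x
    rw [map_add, AddMonoidHom.add_apply]
  zero_smul x := by
    change act 0 x = 0
    rw [map_zero, AddMonoidHom.zero_apply]

theorem res_act (h : L ≤ H) (r : RepRing H) (x : KTilde.{u, v, u} α H) :
    res h (act r x) = act (RepRing.compHom (Subgroup.inclusion h) r) (res h x) := by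
  refine biadditive_ext (f := fun r x => res h (act r x))
    (g := fun r x => act (RepRing.compHom (Subgroup.inclusion h) r) (res h x))
    (fun a b x => ?_) (fun a x y => ?_) (fun a b x => ?_) (fun a x y => ?_) (fun V E => ?_) r x
  · simp only [map_sub, AddMonoidHom.sub_apply]
  · simp only [map_sub]
  · simp only [map_sub, AddMonoidHom.sub_apply]
  · simp only [map_sub]
  · simpa using of_eq (E.res_tensor h V)

theorem con_act (g : G) (h : K = conjSub g H) (r : RepRing H) (x : KTilde.{u, v, u} α H) :
    con g h (act r x) = act (RepRing.compHom (conjHom g h) r) (con g h x) := by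
  refine biadditive_ext (f := fun r x => con g h (act r x))
    (g := fun r x => act (RepRing.compHom (conjHom g h) r) (con g h x))
    (fun a b x => ?_) (fun a x y => ?_) (fun a b x => ?_) (fun a x y => ?_) (fun V E => ?_) r x
  · simp only [map_sub, AddMonoidHom.sub_apply]
  · simp only [map_sub]
  · simp only [map_sub, AddMonoidHom.sub_apply]
  · simp only [map_sub]
  · simpa using of_eq (E.con_tensor g h V)

/-- The Frobenius formula `V ⊗ Ind E = Ind (Res V ⊗ E)`. -/
theorem act_ind [Finite G] (h : L ≤ H) (r : RepRing H) (x : KTilde.{u, v, u} α L) :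
    act r (ind h x) = ind h (act (RepRing.compHom (Subgroup.inclusion h) r) x) := by
  refine biadditive_ext (f := fun r x => act r (ind h x))
    (g := fun r x => ind h (act (RepRing.compHom (Subgroup.inclusion h) r) x))
    (fun a b x => ?_) (fun a x y => ?_) (fun a b x => ?_) (fun a x y => ?_) (fun V E => ?_) r x
  · simp only [map_sub, AddMonoidHom.sub_apply]
  · simp only [map_sub]
  · simp only [map_sub, AddMonoidHom.sub_apply]
  · simp only [map_sub]
  · simpa using of_eq ((EqMod.inducedInd h E).tensor V).iso

/-- The Frobenius formula `Ind V ⊗ E = Ind (V ⊗ Res E)`. -/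
theorem indHom_act [Finite G] (h : L ≤ H) (r : RepRing L) (x : KTilde.{u, v, u} α H) :
    act (RepRing.indHom (Subgroup.inclusion h) r) x = ind h (act r (res h x)) := by
  refine biadditive_ext (f := fun r x => act (RepRing.indHom (Subgroup.inclusion h) r) x)
    (g := fun r x => ind h (act r (res h x)))
    (fun a b x => ?_) (fun a x y => ?_) (fun a b x => ?_) (fun a x y => ?_) (fun V E => ?_) r x
  · simp only [map_sub, AddMonoidHom.sub_apply]
  · simp only [map_sub]
  · simp only [map_sub, AddMonoidHom.sub_apply]
  · simp only [map_sub]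
  · simpa using of_eq (EqMod.inducedTensor h V E).iso

end Act

/-! ### Naturality in the algebra -/

section Map

variable {G : Type (max u v')} [Group G] {A : Type v} [CStarAlgebra A] {α : G →* (A ≃⋆ₐ[ℂ] A)}
  {B : Type v'} [CStarAlgebra B] {β : G →* (B ≃⋆ₐ[ℂ] B)} (f : A →⋆ₐ[ℂ] B)
  (hf : ∀ g a, f (α g a) = β g (f a)) {L H K : Subgroup G}

theorem map_res (h : L ≤ H) (x : KTilde.{max u v', v, max u v'} α H) :
    map f hf L (res h x) = res h (map f hf H x) := by
  refine DFunLike.congr_fun (f := (map f hf L).comp (res h)) (g := (res h).comp (map f hf H))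
    (hom_ext fun E => ?_) x
  simpa using of_eq (E.ext_res f hf h)

theorem map_con (g : G) (h : K = conjSub g H) (x : KTilde.{max u v', v, max u v'} α H) :
    map f hf K (con g h x) = con g h (map f hf H x) := by
  refine DFunLike.congr_fun (f := (map f hf K).comp (con g h)) (g := (con g h).comp (map f hf H))
    (hom_ext fun E => ?_) x
  simpa using of_eq (E.ext_con f hf g h)

theorem map_ind [Finite G] (h : L ≤ H) (x : KTilde.{max u v', v, max u v'} α L) :
    map f hf H (ind h x) = ind h (map f hf L x) := by
  refine DFunLike.congr_fun (f := (map f hf H).comp (ind h)) (g := (ind h).comp (map f hf L))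
    (hom_ext fun E => ?_) x
  simpa using of_eq (EqMod.ext_ind.{u} f hf h E)

theorem map_act (r : RepRing H) (x : KTilde.{max u v', v, max u v'} α H) :
    map f hf H (act r x) = act r (map f hf H x) := by
  refine biadditive_ext (f := fun r x => map f hf H (act r x))
    (g := fun r x => act r (map f hf H x))
    (fun a b x => ?_) (fun a x y => ?_) (fun a b x => ?_) (fun a x y => ?_) (fun V E => ?_) r x
  · simp only [map_sub, AddMonoidHom.sub_apply]
  · simp only [map_sub]
  · simp only [map_sub, AddMonoidHom.sub_apply]
  · simp only [map_sub]
  · simpa using of_eq (EqMod.ext_tensor.{u} f hf V E)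

end Map

theorem map_id {G : Type (max u v)} [Group G] {A : Type v} [CStarAlgebra A]
    {α : G →* (A ≃⋆ₐ[ℂ] A)} {H : Subgroup G} (x : KTilde.{max u v, v, max u v} α H) :
    map (β := α) (StarAlgHom.id ℂ A) (fun _ _ => rfl) H x = x := by
  refine DFunLike.congr_fun (f := map _ _ H) (g := AddMonoidHom.id _) (hom_ext fun E => ?_) x
  exact (map_of (β := α) _ _ E).trans (of_eq (EqMod.ext_id.{u} E))

theorem map_map {G : Type (max u v v' w)} [Group G] {A : Type v} [CStarAlgebra A]
    {α : G →* (A ≃⋆ₐ[ℂ] A)} {H : Subgroup G} {B : Type v'} [CStarAlgebra B]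
    {β : G →* (B ≃⋆ₐ[ℂ] B)} {C : Type w} [CStarAlgebra C] {γ : G →* (C ≃⋆ₐ[ℂ] C)}
    (f : A →⋆ₐ[ℂ] B) (hf : ∀ g a, f (α g a) = β g (f a)) (f' : B →⋆ₐ[ℂ] C)
    (hf' : ∀ g b, f' (β g b) = γ g (f' b)) (k : A →⋆ₐ[ℂ] C)
    (hk : ∀ g a, k (α g a) = γ g (k a)) (hfk : ∀ a, f' (f a) = k a)
    (x : KTilde.{max u v v' w, v, max u v v' w} α H) :
    map f' hf' H (map f hf H x) = map k hk H x := by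
  refine DFunLike.congr_fun (f := (map f' hf' H).comp (map f hf H)) (hom_ext fun E => ?_) x
  rw [AddMonoidHom.comp_apply, map_of, map_of, map_of]
  exact of_eq (EqMod.ext_comp.{u} f hf f' hf' k hk hfk E).symm

end KTilde

/-! ### The representation ring as `K̃` of the complex numbers -/

namespace EqMod

section Rep

variable {G : Type u} [Group G] {H : Subgroup G}

/-- The right action of `ℂ` on an `(H, ℂ)`-module is its structure of a complex vector space. -/
theorem op_smul_complex (E : EqMod.{u, 0, u} (1 : G →* (ℂ ≃⋆ₐ[ℂ] ℂ)) H) (c : ℂ) (x : E.carrier) :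
    op c • x = c • x := by
  have h := smul_assoc c (1 : ℂᵐᵒᵖ) x
  rw [one_smul] at h
  rw [← h]
  congr 1
  exact MulOpposite.unop_injective (mul_one c).symm

/-- The representation underlying an `(H, ℂ)`-module. -/
def toRep (E : EqMod.{u, 0, u} (1 : G →* (ℂ ≃⋆ₐ[ℂ] ℂ)) H) : FinRep H where
  carrier := E.carrier
  finite := by
    obtain ⟨t, ht⟩ := Module.Finite.fg_top (R := ℂᵐᵒᵖ) (M := E.carrier)
    refine ⟨⟨t, eq_top_iff.2 fun x _ => ?_⟩⟩
    have hx : x ∈ Submodule.span ℂᵐᵒᵖ (t : Set E.carrier) := ht ▸ Submodule.mem_top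
    induction hx using Submodule.span_induction with
    | mem x hx => exact Submodule.subset_span hx
    | zero => exact Submodule.zero_mem _
    | add x y _ _ hx hy => exact Submodule.add_mem _ (hx trivial) (hy trivial)
    | smul a x _ hx =>
      have h1 := Submodule.smul_mem _ (unop a) (hx trivial)
      rwa [← op_smul_complex E (unop a) x] at h1
  ρ := E.ρ

theorem toRep_congr {E F : EqMod.{u, 0, u} (1 : G →* (ℂ ≃⋆ₐ[ℂ] ℂ)) H} :
    E.Iso F → E.toRep.Iso F.toRep := fun ⟨e, he⟩ =>
  FinRep.Iso.of (V := E.toRep) (W := F.toRep) (e.restrictScalars ℂ) he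

theorem toRep_sum (E F : EqMod.{u, 0, u} (1 : G →* (ℂ ≃⋆ₐ[ℂ] ℂ)) H) :
    (E.sum F).toRep.Iso (E.toRep.sum F.toRep) :=
  IsoSum.iso_equivalence.refl (E.sum F).toRep

theorem ofRep_toRep (E : EqMod.{u, 0, u} (1 : G →* (ℂ ≃⋆ₐ[ℂ] ℂ)) H) :
    (ofRep (G := G) E.toRep).Iso E :=
  .of_inverse (E := ofRep (G := G) E.toRep)
    { toFun := fun x => x
      map_add' := fun _ _ => rfl
      map_smul' := fun a x => (op_smul_complex E (unop a) x).symm }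
    (fun x => x) (fun _ _ => rfl) (fun _ => rfl) (fun _ => rfl)

theorem ofRep_tensor (V W : FinRep H) :
    (ofRep (G := G) (V.tensor W)).Iso (tensor V (ofRep W)) := by
  refine .of_inverse (E := ofRep (G := G) (V.tensor W)) (F := tensor V (ofRep W))
    { toFun := TensorProduct.comm ℂ V.carrier W.carrier
      map_add' := map_add (TensorProduct.comm ℂ V.carrier W.carrier)
      map_smul' := fun a x => ?_ } (TensorProduct.comm ℂ V.carrier W.carrier).symm
    (fun h x => ?_) (fun x => (TensorProduct.comm ℂ V.carrier W.carrier).symm_apply_apply x)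
    (fun x => (TensorProduct.comm ℂ V.carrier W.carrier).apply_symm_apply x)
  · exact ((TensorProduct.comm ℂ V.carrier W.carrier).map_smul (unop a) x).trans
      (op_smul_complex (tensor V (ofRep (G := G) W)) (unop a) _).symm
  · refine LinearMap.congr_fun
      (f := (TensorProduct.comm ℂ V.carrier W.carrier).toLinearMap ∘ₗ (V.tensor W).ρ h)
      (g := (W.ρ.tprod V.ρ) h ∘ₗ (TensorProduct.comm ℂ V.carrier W.carrier).toLinearMap)
      (TensorProduct.ext' fun _ _ => rfl) x

end Rep

end EqMod

namespace KTilde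

section Rep

variable {G : Type u} [Group G] {L H K : Subgroup G}

/-- The inverse of the canonical map `R(H) → K̃^H(ℂ)`. -/
def toRep (H : Subgroup G) : KTilde.{u, 0, u} (1 : G →* (ℂ ≃⋆ₐ[ℂ] ℂ)) H →+ RepRing H :=
  GroGrp.map EqMod.toRep (fun _ _ => EqMod.toRep_congr) EqMod.toRep_sum

theorem toRep_of (E : EqMod.{u, 0, u} (1 : G →* (ℂ ≃⋆ₐ[ℂ] ℂ)) H) :
    toRep H (of E) = RepRing.of E.toRep := GroGrp.map_cls EqMod.toRep _ _ E

/-- `K̃^H(ℂ)` is the representation ring `R(H)`. -/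
def repEquiv (H : Subgroup G) :
    RepRing H ≃+ KTilde.{u, 0, u} (1 : G →* (ℂ ≃⋆ₐ[ℂ] ℂ)) H where
  __ := ofRep G H
  invFun := toRep H
  left_inv x := by
    refine DFunLike.congr_fun (f := (toRep H).comp (ofRep G H)) (g := AddMonoidHom.id _)
      (RepRing.hom_ext fun V => ?_) x
    rw [AddMonoidHom.comp_apply, ofRep_of, toRep_of]
    rfl
  right_inv x := by
    refine DFunLike.congr_fun (f := (ofRep G H).comp (toRep H)) (g := AddMonoidHom.id _)
      (hom_ext fun E => ?_) x
    rw [AddMonoidHom.comp_apply, toRep_of, ofRep_of]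
    exact of_eq E.ofRep_toRep

theorem ofRep_injective (H : Subgroup G) : Function.Injective (ofRep G H) :=
  (repEquiv H).injective

theorem ofRep_res (h : L ≤ H) (x : RepRing H) :
    ofRep G L (RepRing.compHom (Subgroup.inclusion h) x) = res h (ofRep G H x) := by
  refine DFunLike.congr_fun (f := (ofRep G L).comp (RepRing.compHom _).toAddMonoidHom)
    (g := (res h).comp (ofRep G H)) (RepRing.hom_ext fun V => ?_) x
  rw [AddMonoidHom.comp_apply, AddMonoidHom.comp_apply, ofRep_of, res_of]
  exact (congrArg _ (RepRing.compHom_of _ V)).trans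
    ((ofRep_of _).trans (of_eq (.refl ((EqMod.ofRep (G := G) V).res h))))

theorem ofRep_con (g : G) (h : K = conjSub g H) (x : RepRing H) :
    ofRep G K (RepRing.compHom (conjHom g h) x) = con g h (ofRep G H x) := by
  refine DFunLike.congr_fun (f := (ofRep G K).comp (RepRing.compHom _).toAddMonoidHom)
    (g := (con g h).comp (ofRep G H)) (RepRing.hom_ext fun V => ?_) x
  have h1 : (EqMod.ofRep (G := G) (V.comp (conjHom g h))).Iso ((EqMod.ofRep V).con g h) :=
    .of_inverse (F := (EqMod.ofRep (G := G) V).con g h)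
      { toFun := fun x => x, map_add' := fun _ _ => rfl, map_smul' := fun _ _ => rfl }
      (fun x => x) (fun _ _ => rfl) (fun _ => rfl) (fun _ => rfl)
  simpa using of_eq h1

theorem ofRep_mul [Finite G] (r s : RepRing H) : ofRep G H (r * s) = act r (ofRep G H s) := by
  induction r using RepRing.induction with
  | sub a b ha hb => rw [sub_mul, map_sub, act_sub, ha, hb]
  | of V =>
    induction s using RepRing.induction with
    | sub a b ha hb => rw [mul_sub, map_sub, map_sub, map_sub, ha, hb]
    | of W =>
      rw [RepRing.of_mul_of, ofRep_of, ofRep_of, act_of]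
      exact of_eq (EqMod.ofRep_tensor V W)

/-- This is the second Frobenius formula `Ind V ⊗ E = Ind (V ⊗ Res E)` for `E = ℂ`. -/
theorem ofRep_ind [Finite G] (h : L ≤ H) (x : RepRing L) :
    ofRep G H (RepRing.indHom (Subgroup.inclusion h) x) = ind h (ofRep G L x) := by
  rw [← mul_one (RepRing.indHom (Subgroup.inclusion h) x), ofRep_mul, indHom_act, ← ofRep_res,
    map_one, ← ofRep_mul, mul_one]

end Rep

end KTilde

/-- The Mackey relations and the Frobenius formula are those of `K̃(ℂ)`, since the canonical map
`R(H) → K̃^H(ℂ)` is injective. -/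
theorem repGreen_isGreen (G : Type u) [Group G] [Finite G] : (repGreen G).IsGreen := by
  have left : ∀ {L H : Subgroup G} (h : L ≤ H) (x : RepRing L) (y : RepRing H),
      RepRing.indHom (Subgroup.inclusion h) (RepRing.compHom (Subgroup.inclusion h) y * x) =
        y * RepRing.indHom (Subgroup.inclusion h) x := fun h x y => by
    apply KTilde.ofRep_injective
    rw [KTilde.ofRep_ind, KTilde.ofRep_mul, ← KTilde.act_ind, KTilde.ofRep_mul, KTilde.ofRep_ind]
  have right : ∀ {L H : Subgroup G} (h : L ≤ H) (x : RepRing L) (y : RepRing H),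
      RepRing.indHom (Subgroup.inclusion h) (x * RepRing.compHom (Subgroup.inclusion h) y) =
        RepRing.indHom (Subgroup.inclusion h) x * y := fun h x y => by
    rw [mul_comm x, left, mul_comm]
  exact
    { isMackey := (KTilde.isMackey 1).of_injective (KTilde.ofRep G) KTilde.ofRep_injective
        KTilde.ofRep_res KTilde.ofRep_ind fun g _ _ h m => KTilde.ofRep_con g h m
      frobenius_left := left
      frobenius_right := right }

/-! ### Unital algebras -/

section Corner

open Unitization (starLift)

variable {A : Type v} [NonUnitalCStarAlgebra A] {D : Type v'} [CStarAlgebra D]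
  (f : A →⋆ₙₐ[ℂ] D) (hf : Function.Bijective f)

theorem starLift_inl_add_inr (c : ℂ) (a : A) :
    starLift f (.inl c + (a : Unitization ℂ A)) = c • 1 + f a := by
  change algebraMap ℂ D (Unitization.inl c + (a : Unitization ℂ A)).fst +
    f (Unitization.inl c + (a : Unitization ℂ A)).snd = _
  simp [Algebra.algebraMap_eq_smul_one]

/-- The inverse of a bijective `*`-homomorphism, as a linear map. Its value at `1` is the unit of
`A`. -/
def cornerInv : D →ₗ[ℂ] A :=
  ((LinearEquiv.ofBijective (f : A →ₗ[ℂ] D) hf).symm : D →ₗ[ℂ] A)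

theorem apply_cornerInv (d : D) : f (cornerInv f hf d) = d :=
  (LinearEquiv.ofBijective (f : A →ₗ[ℂ] D) hf).apply_symm_apply d

theorem cornerInv_apply (a : A) : cornerInv f hf (f a) = a :=
  (LinearEquiv.ofBijective (f : A →ₗ[ℂ] D) hf).symm_apply_apply a

theorem cornerInv_one_mul (a : A) : cornerInv f hf 1 * a = a :=
  hf.1 (by rw [map_mul, apply_cornerInv, one_mul])

theorem mul_cornerInv_one (a : A) : a * cornerInv f hf 1 = a :=
  hf.1 (by rw [map_mul, apply_cornerInv, mul_one])

/-- If `A` is unital, here through a bijective `*`-homomorphism `f` to a unital algebra `D`, then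
`A` is a direct factor of `A⁺`. -/
def liftSection : FactorSection (starLift f) where
  s := Unitization.inrHom ℂ ℂ A ∘ₗ cornerInv f hf
  q_s d := by
    have h := starLift_inl_add_inr f 0 (cornerInv f hf d)
    rw [apply_cornerInv] at h
    simpa using h
  s_q c := by
    induction c using Unitization.ind with
    | inl_add_inr z a =>
      rw [starLift_inl_add_inr, map_add, map_smul]
      change z • ((cornerInv f hf 1 : A) : Unitization ℂ A) +
        ((cornerInv f hf (f a) : A) : Unitization ℂ A) =
        ((cornerInv f hf 1 : A) : Unitization ℂ A) * _
      rw [cornerInv_apply, mul_add, ← Unitization.inr_mul, cornerInv_one_mul,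
        Unitization.inr_mul_inl, Unitization.inr_smul]
  central c := by
    induction c using Unitization.ind with
    | inl_add_inr z a =>
      change ((cornerInv f hf 1 : A) : Unitization ℂ A) * _ =
        _ * ((cornerInv f hf 1 : A) : Unitization ℂ A)
      rw [mul_add, add_mul, ← Unitization.inr_mul, ← Unitization.inr_mul, cornerInv_one_mul,
        mul_cornerInv_one, Unitization.inr_mul_inl, Unitization.inl_mul_inr]

/-- If `A` is unital with unit `e`, then the augmentation of `A⁺` is the projection to the direct
factor `ℂ (1 - e)`. -/
def augSection : FactorSection (GCStarAlg.aug A) where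
  s := LinearMap.toSpanSingleton ℂ (Unitization ℂ A)
    (1 - ((cornerInv f hf 1 : A) : Unitization ℂ A))
  q_s d := by
    rw [LinearMap.toSpanSingleton_apply, map_smul, map_sub, map_one]
    change d • ((1 : ℂ) - 0) = d
    simp
  s_q c := by
    rw [LinearMap.toSpanSingleton_apply, LinearMap.toSpanSingleton_apply, one_smul]
    induction c using Unitization.ind with
    | inl_add_inr z a =>
      have h : GCStarAlg.aug A (.inl z + (a : Unitization ℂ A)) = z := by
        change (Unitization.inl z + (a : Unitization ℂ A)).fst = z
        simp
      rw [h, sub_mul, one_mul, mul_add, ← Unitization.inr_mul, cornerInv_one_mul,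
        Unitization.inr_mul_inl, smul_sub, Unitization.inr_smul, ← Unitization.inl_one,
        ← Unitization.inl_smul, smul_eq_mul, mul_one]
      abel
  central c := by
    rw [LinearMap.toSpanSingleton_apply, one_smul]
    induction c using Unitization.ind with
    | inl_add_inr z a =>
      rw [sub_mul, mul_sub, one_mul, mul_one, mul_add, add_mul, ← Unitization.inr_mul,
        ← Unitization.inr_mul, cornerInv_one_mul, mul_cornerInv_one, Unitization.inr_mul_inl,
        Unitization.inl_mul_inr]

theorem liftSection_s_one :
    (liftSection f hf).s 1 = ((cornerInv f hf 1 : A) : Unitization ℂ A) := rfl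

theorem augSection_s_one :
    (augSection f hf).s 1 = 1 - ((cornerInv f hf 1 : A) : Unitization ℂ A) := one_smul _ _

theorem liftSection_add_augSection : (liftSection f hf).s 1 + (augSection f hf).s 1 = 1 := by
  rw [liftSection_s_one, augSection_s_one, add_sub_cancel]

theorem aug_liftSection : GCStarAlg.aug A ((liftSection f hf).s 1) = 0 := rfl

theorem starLift_augSection : starLift f ((augSection f hf).s 1) = 0 := by
  rw [augSection_s_one, map_sub, map_one, ← liftSection_s_one, (liftSection f hf).q_s, sub_self]

variable {G : Type (max v v')} [Group G] {α : G →* (A ≃⋆ₐ[ℂ] A)} {δ : G →* (D ≃⋆ₐ[ℂ] D)}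
  (hα : ∀ g a, f (α g a) = δ g (f a))

/-- If `A` is unital with unit `e`, then `A⁺ = A × ℂ (1 - e)`, and the kernel of the map induced by
the augmentation is `K̃` of the first factor. -/
theorem bijective_map_starLift (hf : Function.Bijective f) (H : Subgroup G) :
    Function.Bijective (fun x : (KTilde.map.{max v v', v, 0} (GCStarAlg.aug A)
      (GCStarAlg.aug_equivariant α) H).ker =>
        KTilde.map.{max v v', v, v'} (starLift f) (GCStarAlg.starLift_equivariant f hα) H x.1) := by
  have hq := GCStarAlg.starLift_equivariant f hα
  have hq' := GCStarAlg.aug_equivariant α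
  constructor
  · intro x y hxy
    have h := fun z : KTilde.{max v v', v, max v v'} (GCStarAlg.unitAct α) H =>
      KTilde.inflate_map_add_inflate_map.{max v v', v, v', 0} (liftSection f hf) hq
        (augSection f hf) hq' (liftSection_add_augSection f hf) (aug_liftSection f hf)
        (starLift_augSection f hf) z
    have hx := h x.1
    have hy := h y.1
    rw [AddMonoidHom.mem_ker.1 x.2, map_zero, add_zero] at hx
    rw [AddMonoidHom.mem_ker.1 y.2, map_zero, add_zero] at hy
    have hxy' : KTilde.map.{max v v', v, v'} (starLift f) hq H x.1 =
      KTilde.map.{max v v', v, v'} (starLift f) hq H y.1 := hxy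
    rw [hxy'] at hx
    exact Subtype.ext (hx.symm.trans hy)
  · intro y
    exact ⟨⟨KTilde.inflate (liftSection f hf) hq H y,
      KTilde.map_inflate_eq_zero.{max v v', v, v', 0} _ hq hq' (aug_liftSection f hf) y⟩,
      KTilde.map_inflate.{max v v', v, v'} _ hq y⟩

end Corner

/-- A morphism of Mackey modules with bijective components is an isomorphism. -/
def MackeyModule.isoOfBijective {G : Type u} [Group G] {R : GreenFunctor.{u, w} G}
    {M N : MackeyModule.{u, w, w'} R} (f : M ⟶ N)
    (hf : ∀ H, Function.Bijective (MackeyModule.Hom.app f H)) : M ≅ N where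
  hom := f
  inv := MackeyModule.Hom.mk
    (fun H => ((LinearEquiv.ofBijective (f.app H) (hf H)).symm : N.obj H →ₗ[R.obj H] M.obj H))
    (fun {L H} h m => (LinearEquiv.symm_apply_eq _).2 (by
      refine ((f.app_res h _).trans ?_).symm
      exact congrArg _ ((LinearEquiv.ofBijective (f.app H) (hf H)).apply_symm_apply m)))
    (fun {L H} h m => (LinearEquiv.symm_apply_eq _).2 (by
      refine ((f.app_ind h _).trans ?_).symm
      exact congrArg _ ((LinearEquiv.ofBijective (f.app L) (hf L)).apply_symm_apply m)))
    (fun g {H K} h m => (LinearEquiv.symm_apply_eq _).2 (by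
      refine ((f.app_con g h _).trans ?_).symm
      exact congrArg _ ((LinearEquiv.ofBijective (f.app H) (hf H)).apply_symm_apply m)))
  hom_inv_id := MackeyModule.Hom.ext (funext fun H => LinearMap.ext fun x =>
    (LinearEquiv.ofBijective (f.app H) (hf H)).symm_apply_apply x)
  inv_hom_id := MackeyModule.Hom.ext (funext fun H => LinearMap.ext fun x =>
    (LinearEquiv.ofBijective (f.app H) (hf H)).apply_symm_apply x)

/-! ### The functor `k^G` -/

namespace GCStarAlg

variable {G : Type u} [Group G] (A : GCStarAlg.{u} G) {L H K : Subgroup G}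

theorem mem_K0 {x : A.KPlus H} :
    x ∈ A.K0 H ↔ KTilde.map.{u, u, 0} (aug A.carrier) (aug_equivariant A.act) H x = 0 := Iff.rfl

theorem res_mem_K0 (h : L ≤ H) {x : A.KPlus H} (hx : x ∈ A.K0 H) : KTilde.res h x ∈ A.K0 L := by
  rw [mem_K0] at hx ⊢
  exact (KTilde.map_res.{u, u, 0} _ _ h x).trans ((congrArg _ hx).trans (map_zero _))

theorem con_mem_K0 (g : G) (h : K = conjSub g H) {x : A.KPlus H} (hx : x ∈ A.K0 H) :
    KTilde.con g h x ∈ A.K0 K := by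
  rw [mem_K0] at hx ⊢
  exact (KTilde.map_con.{u, u, 0} _ _ g h x).trans ((congrArg _ hx).trans (map_zero _))

theorem ind_mem_K0 [Finite G] (h : L ≤ H) {x : A.KPlus L} (hx : x ∈ A.K0 L) :
    KTilde.ind h x ∈ A.K0 H := by
  rw [mem_K0] at hx ⊢
  exact (KTilde.map_ind.{u, u, 0} _ _ h x).trans ((congrArg _ hx).trans (map_zero _))

theorem act_mem_K0 (r : RepRing H) {x : A.KPlus H} (hx : x ∈ A.K0 H) :
    KTilde.act r x ∈ A.K0 H := by
  rw [mem_K0] at hx ⊢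
  exact (KTilde.map_act.{u, u, 0} _ _ r x).trans ((congrArg _ hx).trans (map_zero _))

theorem mapPlus_mem_K0 {A B : GCStarAlg.{u} G} (f : A ⟶ B) {x : A.KPlus H} (hx : x ∈ A.K0 H) :
    mapPlus f H x ∈ B.K0 H := by
  rw [mem_K0] at hx ⊢
  refine (KTilde.map_map.{u, u, u, 0} _ _ _ _ (aug A.carrier) (aug_equivariant A.act)
    (fun a => ?_) x).trans hx
  induction a using Unitization.ind with
  | inl_add_inr c a =>
    rw [map_add, Unitization.starMap_inl, Unitization.starMap_inr]
    change c + 0 = c + 0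
    rfl

theorem mapPlus_id (x : A.KPlus H) : mapPlus (𝟙 A) H x = x := by
  have h : Unitization.starMap (NonUnitalStarAlgHom.id ℂ A.carrier) = StarAlgHom.id ℂ _ :=
    Unitization.starMap_id
  have key : ∀ (k : Unitization ℂ A.carrier →⋆ₐ[ℂ] Unitization ℂ A.carrier) (hk : ∀ g a,
      k (unitAct A.act g a) = unitAct A.act g (k a)), k = StarAlgHom.id ℂ _ →
        KTilde.map.{u, u, u} k hk H x = x := by
    rintro _ _ rfl
    exact KTilde.map_id.{u, u} x
  exact key _ _ h

theorem mapPlus_comp {A B C : GCStarAlg.{u} G} (f : A ⟶ B) (f' : B ⟶ C) (x : A.KPlus H) :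
    mapPlus (f ≫ f') H x = mapPlus f' H (mapPlus f H x) := by
  refine (KTilde.map_map.{u, u, u, u} _ _ _ _ _ _ (fun a => ?_) x).symm
  exact (DFunLike.congr_fun (Unitization.starMap_comp (ψ := f'.toFun) (φ := f.toFun)) a).symm

/-- The restriction of a homomorphism to the subgroups `K_0`. -/
def restrictK0 {A B : GCStarAlg.{u} G} (φ : A.KPlus H →+ B.KPlus L)
    (hφ : ∀ {x}, x ∈ A.K0 H → φ x ∈ B.K0 L) : A.K0 H →+ B.K0 L :=
  (φ.comp (A.K0 H).subtype).codRestrict (B.K0 L) fun x => hφ x.2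

theorem bijective_counit {B : Type u} [CStarAlgebra B] (β : G →* (B ≃⋆ₐ[ℂ] B)) (H : Subgroup G) :
    Function.Bijective (fun x : (of β).K0 H => counit β H x.1) :=
  bijective_map_starLift.{u, u} (NonUnitalStarAlgHom.id ℂ B) (α := β) (δ := β) (fun _ _ => rfl)
    Function.bijective_id H

/-- For unital `B`, the isomorphism `K_0^H(B) ≃ K̃_0^H(B)` induced by the counit. -/
def counitEquiv {B : Type u} [CStarAlgebra B] (β : G →* (B ≃⋆ₐ[ℂ] B)) (H : Subgroup G) :
    (of β).K0 H ≃+ KTilde.{u, u, u} β H :=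
  AddEquiv.ofBijective ((counit β H).comp ((of β).K0 H).subtype) (bijective_counit β H)

theorem bijective_unitCounit (H : Subgroup G) :
    Function.Bijective (fun x : (unit G).K0 H => unitCounit G H x.1) :=
  bijective_map_starLift.{u, 0} downHom (fun _ _ => rfl)
    ⟨ULift.down_injective, ULift.down_surjective⟩ H

/-- The map `K_0^H(ℂ) → K̃^H(ℂ) = R(H)`. -/
def unitToRep (H : Subgroup G) : (unit G).K0 H →+ RepRing H :=
  (KTilde.repEquiv H).symm.toAddMonoidHom.comp ((unitCounit G H).comp ((unit G).K0 H).subtype)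

theorem ofRep_unitToRep (x : (unit G).K0 H) :
    KTilde.ofRep G H (unitToRep H x) = unitCounit G H x.1 :=
  (KTilde.repEquiv H).apply_symm_apply _

theorem bijective_unitToRep (H : Subgroup G) : Function.Bijective (unitToRep (G := G) H) :=
  (KTilde.repEquiv H).symm.bijective.comp (bijective_unitCounit H)

variable [Finite G]

/-- The groups `K_0^H(A)` with restriction, induction and conjugation. -/
def k0Data : MackeyData.{u, u + 1} G where
  obj H := A.K0 H
  res h := restrictK0 (KTilde.res h) (A.res_mem_K0 h)
  ind h := restrictK0 (KTilde.ind h) (A.ind_mem_K0 h)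
  con g _ _ h := restrictK0 (KTilde.con g h) (A.con_mem_K0 g h)

theorem k0Data_isMackey : A.k0Data.IsMackey :=
  (KTilde.isMackey (unitAct A.act)).of_injective (fun H => (A.K0 H).subtype)
    (fun _ => Subtype.val_injective) (fun _ _ => rfl) (fun _ _ => rfl) (fun _ _ _ _ _ => rfl)

/-- The `R(H)`-module structure of `K_0^H(A)`. -/
instance moduleK0 : Module (RepRing H) (A.K0 H) where
  smul r x := ⟨KTilde.act r x.1, A.act_mem_K0 r x.2⟩
  one_smul x := Subtype.ext (one_smul (RepRing H) x.1)
  mul_smul r s x := Subtype.ext (mul_smul r s x.1)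
  smul_zero r := Subtype.ext (smul_zero r)
  smul_add r x y := Subtype.ext (smul_add r x.1 y.1)
  add_smul r s x := Subtype.ext (add_smul r s x.1)
  zero_smul x := Subtype.ext (zero_smul (RepRing H) x.1)

/-- The `R^G`-Mackey module `k^G(A)`. -/
def k0Module : MackeyModule.{u, u + 1, u + 1} (repGreenFunctor (repGreen_isGreen G)) where
  toMackeyData := A.k0Data
  module _ := A.moduleK0
  isMackey := A.k0Data_isMackey
  res_smul h r m := Subtype.ext (KTilde.res_act h r m.1)
  con_smul g _ _ h r m := Subtype.ext (KTilde.con_act g h r m.1)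
  smul_ind h r m := Subtype.ext (KTilde.act_ind h r m.1)
  ind_smul h r m := Subtype.ext (KTilde.indHom_act h r m.1)

variable (G) in
/-- The functor `k^G` from `G`-C*-algebras to Mackey modules over `R^G`. -/
def k0Functor : GCStarAlg.{u} G ⥤
    MackeyModule.{u, u + 1, u + 1} (repGreenFunctor (repGreen_isGreen G)) where
  obj A := A.k0Module
  map f :=
    { app := fun H =>
        { toFun := restrictK0 (mapPlus f H) (mapPlus_mem_K0 f)
          map_add' := map_add (restrictK0 (mapPlus f H) (mapPlus_mem_K0 f))
          map_smul' := fun r x => Subtype.ext (KTilde.map_act.{u, u, u} _ _ r x.1) }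
      app_res := fun h m => Subtype.ext (KTilde.map_res.{u, u, u} _ _ h m.1)
      app_ind := fun h m => Subtype.ext (KTilde.map_ind.{u, u, u} _ _ h m.1)
      app_con := fun g _ _ h m => Subtype.ext (KTilde.map_con.{u, u, u} _ _ g h m.1) }
  map_id A := MackeyModule.Hom.ext (funext fun _ => LinearMap.ext fun x =>
    Subtype.ext (A.mapPlus_id x.1))
  map_comp f f' := MackeyModule.Hom.ext (funext fun _ => LinearMap.ext fun x =>
    Subtype.ext (mapPlus_comp f f' x.1))

variable (G) in
/-- The morphism `k^G(ℂ) → R^G`. -/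
def unitHom : (unit G).k0Module ⟶ GreenFunctor.self (repGreenFunctor (repGreen_isGreen G)) :=
  MackeyModule.Hom.mk
    (fun H =>
      { toFun := unitToRep H
        map_add' := map_add (unitToRep H)
        map_smul' := fun r x => KTilde.ofRep_injective H (by
          refine (ofRep_unitToRep _).trans ?_
          refine (KTilde.map_act.{u, u, 0} _ _ r x.1).trans ?_
          refine ((KTilde.ofRep_mul r (unitToRep H x)).trans ?_).symm
          exact congrArg _ (ofRep_unitToRep _)) })
    (fun {_} {_} h m => KTilde.ofRep_injective _ (by
      refine (ofRep_unitToRep _).trans ?_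
      refine (KTilde.map_res.{u, u, 0} _ _ h m.1).trans ?_
      refine ((KTilde.ofRep_res h _).trans ?_).symm
      exact congrArg _ (ofRep_unitToRep _)))
    (fun {_} {_} h m => KTilde.ofRep_injective _ (by
      refine (ofRep_unitToRep _).trans ?_
      refine (KTilde.map_ind.{u, u, 0} _ _ h m.1).trans ?_
      refine ((KTilde.ofRep_ind h _).trans ?_).symm
      exact congrArg _ (ofRep_unitToRep _)))
    (fun g {_} {_} h m => KTilde.ofRep_injective _ (by
      refine (ofRep_unitToRep _).trans ?_
      refine (KTilde.map_con.{u, u, 0} _ _ g h m.1).trans ?_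
      refine ((KTilde.ofRep_con g h _).trans ?_).symm
      exact congrArg _ (ofRep_unitToRep _)))

variable (G) in
/-- The isomorphism `k^G(ℂ) ≅ R^G`. -/
def unitIso : (unit G).k0Module ≅ GreenFunctor.self (repGreenFunctor (repGreen_isGreen G)) :=
  MackeyModule.isoOfBijective (unitHom G) bijective_unitToRep

theorem ofRep_unitIso (H : Subgroup G) (x : (unit G).K0 H) :
    KTilde.ofRep G H (MackeyModule.Hom.app (unitIso G).hom H x) = unitCounit G H x.1 :=
  ofRep_unitToRep x

end GCStarAlg

end EquivK

end

open CategoryTheory EquivK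

theorem mainTheorem9 (G : Type u) [Group G] [Finite G] :
    ∃ (hR : (repGreen G).IsGreen)
      (k : GCStarAlg.{u} G ⥤ MackeyModule.{u, u + 1, u + 1} (repGreenFunctor hR))
      (e : ∀ (A : GCStarAlg.{u} G) (H : Subgroup G), (k.obj A).obj H ≃+ A.K0 H),
      -- the structure maps are those of equivariant K-theory
      (∀ (A : GCStarAlg.{u} G) (L H : Subgroup G) (h : L ≤ H) (x : (k.obj A).obj H),
        (e A L ((k.obj A).res h x) : A.KPlus L) = KTilde.res h (e A H x : A.KPlus H)) ∧
      (∀ (A : GCStarAlg.{u} G) (L H : Subgroup G) (h : L ≤ H) (x : (k.obj A).obj L),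
        (e A H ((k.obj A).ind h x) : A.KPlus H) = KTilde.ind h (e A L x : A.KPlus L)) ∧
      (∀ (A : GCStarAlg.{u} G) (g : G) (H K : Subgroup G) (h : K = conjSub g H)
        (x : (k.obj A).obj H),
        (e A K ((k.obj A).con g h x) : A.KPlus K) = KTilde.con g h (e A H x : A.KPlus H)) ∧
      (∀ (A : GCStarAlg.{u} G) (H : Subgroup G) (r : (repGreenFunctor hR).obj H) (x : (k.obj A).obj H),
        (e A H (r • x) : A.KPlus H) =
          KTilde.act r (e A H x : A.KPlus H)) ∧
      -- the functor is given by the functorialities of all `K_0^H`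
      (∀ (A B : GCStarAlg.{u} G) (f : A ⟶ B) (H : Subgroup G) (x : (k.obj A).obj H),
        (e B H (MackeyModule.Hom.app (k.map f) H x) : B.KPlus H) =
          GCStarAlg.mapPlus f H (e A H x : A.KPlus H)) ∧
      -- for a unital algebra, `K_0^H(B)` is `K̃^H(B)`, with the structure maps of the latter
      (∀ (B : Type u) [CStarAlgebra B] (β : G →* (B ≃⋆ₐ[ℂ] B)),
        ∃ θ : ∀ H : Subgroup G, (k.obj (GCStarAlg.of β)).obj H ≃+ KTilde.{u, u, u} β H,
          (∀ H x, θ H x = GCStarAlg.counit β H (e (GCStarAlg.of β) H x)) ∧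
          (∀ (L H : Subgroup G) (h : L ≤ H) x,
            θ L ((k.obj (GCStarAlg.of β)).res h x) = KTilde.res h (θ H x)) ∧
          (∀ (L H : Subgroup G) (h : L ≤ H) x,
            θ H ((k.obj (GCStarAlg.of β)).ind h x) = KTilde.ind h (θ L x)) ∧
          (∀ (g : G) (H K : Subgroup G) (h : K = conjSub g H) x,
            θ K ((k.obj (GCStarAlg.of β)).con g h x) = KTilde.con g h (θ H x)) ∧
          (∀ (H : Subgroup G) (r : (repGreenFunctor hR).obj H) x,
            θ H (r • x) = KTilde.act r (θ H x))) ∧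
      -- `k^G(ℂ)` is `R^G`, through the canonical `K_0^H(ℂ) = K̃^H(ℂ) = R(H)`
      (∃ φ : k.obj (GCStarAlg.unit G) ≅ GreenFunctor.self (repGreenFunctor hR),
        ∀ (H : Subgroup G) (x : (k.obj (GCStarAlg.unit G)).obj H),
          KTilde.ofRep G H (MackeyModule.Hom.app φ.hom H x) =
            GCStarAlg.unitCounit G H (e (GCStarAlg.unit G) H x)) := by
  refine ⟨repGreen_isGreen G, GCStarAlg.k0Functor G, fun A H => AddEquiv.refl (A.K0 H),
    fun _ _ _ _ _ => rfl, fun _ _ _ _ _ => rfl, fun _ _ _ _ _ _ => rfl, fun _ _ _ _ => rfl,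
    fun _ _ _ _ _ => rfl, fun B _ β => ?_, ?_⟩
  · refine ⟨GCStarAlg.counitEquiv β, fun _ _ => rfl, fun L H h x => ?_, fun L H h x => ?_,
      fun g H K h x => ?_, fun H r x => ?_⟩
    · exact KTilde.map_res.{u, u, u} _ _ h x.1
    · exact KTilde.map_ind.{u, u, u} _ _ h x.1
    · exact KTilde.map_con.{u, u, u} _ _ g h x.1
    · exact KTilde.map_act.{u, u, u} _ _ r x.1
  · exact ⟨GCStarAlg.unitIso G, GCStarAlg.ofRep_unitIso⟩
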